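/- Let $F(x,y)$ be a CNF over Boolean variables $x=(x_1,\dots,x_n)$ and $y=(y_1,\dots,y_{n'})$; it is a 2-CNF if every clause has at most two literals. All probabilities are over uniformly random assignments. (1) MAJ-MAJ-2SAT is in $\mathsf{P}$: the language of all (encoded) 2-CNFs $F(x,y)$ with $$\Pr_{a\in\{0,1\}^n}\Big[\Pr_{b\in\{0,1\}^{n'}}[F(a,b)=1]\ge \tfrac12\Big]\ge \tfrac12$$ is decidable in polynomial time. (2) Moreover, there is a single deterministic algorithm that, given a 2-CNF $F(x,y)$ and rational $\rho,\sigma\in(0,1)$, decides whether $$\Pr_{a\in\{0,1\}^n}\Big[\Pr_{b\in\{0,1\}^{n'}}[F(a,b)=1]\ge \sigma\Big]\ge \rho ,$$ and, when the answer is YES, also returns the exact number of assignments $a\in\{0,1\}^n$ with $\Pr_b[F(a,b)=1]\ge\sigma$. Its running time is $$\mathrm{poly}(1/\rho)\cdot\mathrm{poly}(\ell)\cdot s^{O(1+\log(1/\sigma))},$$ where $s=n+n'+m+2$ is the size of $F$ ($m$ is its number of clauses), $\ell$ is the total bit length of the numerators and denominators of $\rho$ and $\sigma$, and the constants are absolute.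 Time is the number of steps of a multi-stack Turing machine. -/

import Mathlib

namespace MajMaj

/-! ### CNF formulas with a split set of variables -/

/-- A literal over the variable set `V`: the variable itself (`sign = true`) or its negation
(`sign = false`). -/
structure Literal (V : Type) where
  /-- the variable of the literal -/
  var : V
  /-- `true` for the variable, `false` for its negation -/
  sign : Bool
  deriving DecidableEq

/-- A CNF formula over the `n` variables `x` (left summand) and the `n'` variables `y` (right
summand): a list of clauses, each of which is a list of literals. -/
structure Formula where
  /-- number of `x`-variables -/
  n : ℕ
  /-- number of `y`-variables -/
  n' : ℕ
  /-- the clauses -/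
  clauses : List (List (Literal (Fin n ⊕ Fin n')))
  deriving DecidableEq

/-- The truth value of a literal under an assignment. -/
def Literal.eval {V : Type} (v : V → Bool) (l : Literal V) : Bool :=
  if l.sign then v l.var else !(v l.var)

/-- `F(a, b)`: every clause contains a true literal. The empty formula is true and an empty clause
is false. -/
def Formula.eval (F : Formula) (a : Fin F.n → Bool) (b : Fin F.n' → Bool) : Bool :=
  F.clauses.all fun C => C.any fun l => l.eval (Sum.elim a b)

/-- `F` is a `k`-CNF: every clause has width at most `k`. -/
def Formula.IsKCNF (k : ℕ) (F : Formula) : Prop :=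
  ∀ C ∈ F.clauses, C.length ≤ k

/-- The probability of an event under the uniform distribution on a finite type. -/
def prob {α : Type} [Fintype α] (p : α → Bool) : ℚ :=
  ((Finset.univ.filter fun a => p a = true).card : ℚ) / (Fintype.card α : ℚ)

/-- The assignment `a` is good for `σ`, that is, `Pr_b[F(a, b) = 1] ≥ σ`. -/
def Formula.good (F : Formula) (σ : ℚ) (a : Fin F.n → Bool) : Bool :=
  decide (σ ≤ prob fun b => F.eval a b)

/-- The condition `Pr_a[Pr_b[F(a, b) = 1] ≥ σ] ≥ ρ`. -/
def Formula.AboveThreshold (F : Formula) (ρ σ : ℚ) : Prop :=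
  ρ ≤ prob fun a => F.good σ a

instance (F : Formula) (ρ σ : ℚ) : Decidable (F.AboveThreshold ρ σ) :=
  inferInstanceAs (Decidable (_ ≤ _))

/-- The number of `a` such that `Pr_b[F(a, b) = 1] ≥ σ`. -/
def Formula.goodCount (F : Formula) (σ : ℚ) : ℕ :=
  (Finset.univ.filter fun a => F.good σ a = true).card

/-! ### Encodings as words over finite alphabets -/

/-- The input alphabet. -/
inductive Sym
  /-- one for each `x`-variable -/
  | xvar
  /-- one for each `y`-variable -/
  | yvar
  /-- starts a clause -/
  | clause
  /-- starts a literal; `isY` tells the kind of its variable -/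
  | lit (isY sign : Bool)
  /-- unary digit of the index of a variable -/
  | tick
  /-- binary digit of a threshold -/
  | bit (b : Bool)
  /-- ends a number -/
  | sep
  deriving DecidableEq, Fintype

/-- A literal is written as its kind and sign, followed by the index of its variable in unary. -/
def Literal.encode {n n' : ℕ} (l : Literal (Fin n ⊕ Fin n')) : List Sym :=
  match l.var with
  | Sum.inl i => Sym.lit false l.sign :: List.replicate i.val Sym.tick
  | Sum.inr j => Sym.lit true l.sign :: List.replicate j.val Sym.tick

/-- A formula is written as `n` and `n'` in unary, followed by its clauses. -/
def Formula.encode (F : Formula) : List Sym :=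
  List.replicate F.n Sym.xvar ++ List.replicate F.n' Sym.yvar ++
    F.clauses.flatMap fun C => Sym.clause :: C.flatMap Literal.encode

/-- A natural number in binary, least significant digit first. -/
def encodeBin (m : ℕ) : List Sym :=
  m.bits.map Sym.bit ++ [Sym.sep]

/-- A non-negative rational number: numerator and denominator in lowest terms, in binary. -/
def encodeRat (q : ℚ) : List Sym :=
  encodeBin q.num.natAbs ++ encodeBin q.den

/-- The input `(F, ρ, σ)` of the threshold problem. -/
def encodeInput (F : Formula) (ρ σ : ℚ) : List Sym :=
  encodeRat ρ ++ encodeRat σ ++ F.encode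

/-- The output: `none` (answer NO) is the word `0`, and `some m` (answer YES, together with the
number `m`) is the digit `1` followed by `m` in binary. -/
def encodeAnswer : Option ℕ → List Bool
  | none => [false]
  | some m => true :: m.bits

/-- What the algorithm has to return: NO, or YES with the exact number of good assignments. -/
def Formula.answer (F : Formula) (ρ σ : ℚ) : Option ℕ :=
  if F.AboveThreshold ρ σ then some (F.goodCount σ) else none

/-! ### Size measures -/

/-- The size of a formula: the number of variables and clauses (plus `2`, so that it is at
least `2`). -/
def Formula.size (F : Formula) : ℕ :=
  F.n + F.n' + F.clauses.length + 2

/-- The number of binary digits of numerator and denominator. -/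
def bitLength (q : ℚ) : ℕ :=
  q.num.natAbs.bits.length + q.den.bits.length

/-! ### Complexity -/

/-- The class P over the alphabet `Γ`: the languages whose membership function is computed by a
(multi-stack) Turing machine in a number of steps that is polynomial in the length of the word. -/
def PTIME (Γ : Type) : Set (Language Γ) :=
  {L | ∃ f : List Γ → Bool, (∀ w, f w = true ↔ w ∈ L) ∧
    Nonempty (Turing.TM2ComputableInPolyTime (id : List Γ → List Γ) Computability.encodeBool f)}

/-- MAJ-MAJ-`k`SAT, as a language: the words that encode a `k`-CNF `F(x, y)` for which at least half
of the assignments to `x` are such that at least half of the assignments to `y` satisfy `F`. -/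
def MAJMAJkSAT (k : ℕ) : Language Sym :=
  {w | ∃ F : Formula, F.IsKCNF k ∧ F.encode = w ∧ F.AboveThreshold (1 / 2) (1 / 2)}

/-- The Turing machine `M`, started on the word `input`, halts with the word `output` after at
most `t` steps. -/
def RunsInTime {Γ₀ Γ₁ : Type} (M : Turing.TM2ComputableAux Γ₀ Γ₁)
    (input : List Γ₀) (output : List Γ₁) (t : ℕ) : Prop :=
  Nonempty (Turing.TM2OutputsInTime M.tm (input.map M.inputAlphabet.invFun)
    (some (output.map M.outputAlphabet.invFun)) t)

end MajMaj

/-! Split the clauses into those over `x` only, those over `y` only, and mixed ones, and choose `k`,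
`r` with `2 ^ (-k) < ρ` and `2 ^ (-r) < σ` (`slack`, `lt_slack`).

Clauses over one kind of variable: each of a family of variable-disjoint non-tautological clauses
holds independently with probability at most `3/4`, and `(3/4) ^ 3 ≤ 1/2`. So if more than a
fraction `2 ^ (-r)` of all assignments satisfies the clauses, such a family has at most `3 * r`
members (`length_le_of_num`). Expand the clauses into a disjoint sum of cubes, branching three ways
only at a clause with both variables fresh. The branching clauses of one path are variable-disjoint,
so there are at most `27 ^ r` cubes (`length_ufold_dnfStep`). Cubes are easy to count (`bval_cnt`).

Mixed clauses: branch on whether the `x`-literal is true. If it is false, the `y`-literal is forced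
and joins a set `U`. More than `r` distinct forced literals leave a probability below `σ`, so once
`U` has `r` elements a further forcing branch contains no good assignment (`mixVal_eq`). At most `r`
of the `m` clauses force a literal along a path, hence at most `(m + 1) ^ r` branches per cube
(`length_ufold_mixStep`). In the end each state is a cube over `x` on which the condition on `y` no
longer depends on `x`: test whether the `y`-clauses together with `U` reach the threshold
(`atLeast_tfold`), and add up the sizes of the `x`-cubes that pass.

The lists are truncated at these bounds, so the running time is controlled on every input.
Truncation can only lose cubes, so the count is never too large (`bval_count_le`). If the
`x`-clauses hold with probability above `2 ^ (-k)`, nothing is lost and the count is exact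
(`bval_count_eq`). That is the case for every YES instance, while on a NO instance an undercount
still gives NO (`Formula.solve_eq`).

For the running time, structured stack programs are compiled to Turing machines, and a predicate
`Poly` on functions between tree-encoded types is closed under the usual list operations and under
iteration with a bound on intermediate values. Truncation bounds are unary numbers. For variable
thresholds they are counted as part of the input size (`Input`), so `poly_answerOf` gives time
polynomial in `ℓ`, `s`, `27 ^ k` and `(27 * (m + 1)) ^ r`; since `2 ^ k` is `O(1/ρ)` and `r` is at
most `2 + log (1/σ)`, this is the required bound (`time_le`). For both thresholds `1/2` the
truncation bounds are polynomial in the input length. -/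

namespace MajMaj

/-! ### Compiling structured programs to multi-stack Turing machines. -/

section Compile

variable {K : Type} {Γ : K → Type} {σ : Type}

/-- Structured programs acting on finitely many stacks and a register. -/
inductive Prog (Γ : K → Type) (σ : Type) : Type
  | push (k : K) (f : σ → Γ k) : Prog Γ σ
  | pop (k : K) (f : σ → Option (Γ k) → σ) : Prog Γ σ
  | load (f : σ → σ) : Prog Γ σ
  | seq (p q : Prog Γ σ) : Prog Γ σ
  | ite (c : σ → Bool) (p q : Prog Γ σ) : Prog Γ σ
  | loop (c : σ → Bool) (p : Prog Γ σ) : Prog Γ σ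

namespace Prog

/-- The labels of the machine code of a program. -/
def Lab : Prog Γ σ → Type
  | push _ _ => Unit
  | pop _ _ => Unit
  | load _ => Unit
  | seq p q => p.Lab ⊕ q.Lab
  | ite _ p q => Option (p.Lab ⊕ q.Lab)
  | loop _ p => Option p.Lab

/-- A program has finitely many labels. -/
@[reducible]
def labFintype : (p : Prog Γ σ) → Fintype p.Lab
  | push _ _ => inferInstanceAs (Fintype Unit)
  | pop _ _ => inferInstanceAs (Fintype Unit)
  | load _ => inferInstanceAs (Fintype Unit)
  | seq p q => @instFintypeSum _ _ p.labFintype q.labFintype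
  | ite _ p q => @instFintypeOption _ (@instFintypeSum _ _ p.labFintype q.labFintype)
  | loop _ p => @instFintypeOption _ p.labFintype

/-- The label at which the machine code of a program starts. -/
def start : (p : Prog Γ σ) → p.Lab
  | push _ _ => ()
  | pop _ _ => ()
  | load _ => ()
  | seq p _ => Sum.inl p.start
  | ite _ _ _ => none
  | loop _ _ => none

/-- The machine code of a program whose labels are embedded by `e`, and which continues with
`next`. -/
def code {Λ : Type} : (p : Prog Γ σ) → (p.Lab → Λ) → Turing.TM2.Stmt Γ Λ σ → p.Lab →
    Turing.TM2.Stmt Γ Λ σ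
  | push k f, _, next, _ => .push k f next
  | pop k f, _, next, _ => .pop k f next
  | load f, _, next, _ => .load f next
  | seq p q, e, _, Sum.inl l =>
      p.code (fun l => e (Sum.inl l)) (.goto fun _ => e (Sum.inr q.start)) l
  | seq _ q, e, next, Sum.inr l => q.code (fun l => e (Sum.inr l)) next l
  | ite c p q, e, _, none =>
      .branch c (.goto fun _ => e (some (Sum.inl p.start)))
        (.goto fun _ => e (some (Sum.inr q.start)))
  | ite _ p _, e, next, some (Sum.inl l) => p.code (fun l => e (some (Sum.inl l))) next l
  | ite _ _ q, e, next, some (Sum.inr l) => q.code (fun l => e (some (Sum.inr l))) next l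
  | loop c p, e, next, none => .branch c (.goto fun _ => e (some p.start)) next
  | loop _ p, e, _, some l => p.code (fun l => e (some l)) (.goto fun _ => e none) l

variable [DecidableEq K]

/-- From the register `v` and the stacks `S`, the program ends with the register `v'` and the stacks
`S'` after at most `T` steps. -/
def Runs (p : Prog Γ σ) (v : σ) (S : ∀ k, List (Γ k)) (v' : σ) (S' : ∀ k, List (Γ k))
    (T : ℕ) : Prop :=
  ∀ (Λ : Type) (m : Λ → Turing.TM2.Stmt Γ Λ σ) (e : p.Lab → Λ) (next : Turing.TM2.Stmt Γ Λ σ),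
    (∀ l, m (e l) = p.code e next l) →
      ∃ t ≤ T, (flip bind (Turing.TM2.step m))^[t] (some ⟨some (e p.start), v, S⟩) =
        some (Turing.TM2.stepAux next v' S')

variable {p q : Prog Γ σ} {c : σ → Bool} {v v' v'' : σ} {S S' S'' : ∀ k, List (Γ k)} {T T' : ℕ}

theorem Runs.mono (h : p.Runs v S v' S' T) (hT : T ≤ T') : p.Runs v S v' S' T' := by
  intro Λ m e next hm
  obtain ⟨t, ht, h⟩ := h Λ m e next hm
  exact ⟨t, ht.trans hT, h⟩

theorem runs_push (k : K) (f : σ → Γ k) :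
    (push k f).Runs v S v (Function.update S k (f v :: S k)) 1 := by
  intro Λ m e next hm
  refine ⟨1, le_rfl, ?_⟩
  simp [flip, hm, code]

theorem runs_pop (k : K) (f : σ → Option (Γ k) → σ) :
    (pop k f).Runs v S (f v (S k).head?) (Function.update S k (S k).tail) 1 := by
  intro Λ m e next hm
  refine ⟨1, le_rfl, ?_⟩
  simp [flip, hm, code]

theorem runs_load (f : σ → σ) : (load f : Prog Γ σ).Runs v S (f v) S 1 := by
  intro Λ m e next hm
  refine ⟨1, le_rfl, ?_⟩
  simp [flip, hm, code]

/-- `Runs` quantifies over the ambient machine, the embedding of the labels and the continuation; so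
`p` can be instantiated inside the composite with the continuation that jumps to the start of `q`.
-/
theorem Runs.seq (hp : p.Runs v S v' S' T) (hq : q.Runs v' S' v'' S'' T') :
    (seq p q).Runs v S v'' S'' (T + T') := by
  intro Λ m e next hm
  obtain ⟨t, ht, h⟩ := hp Λ m (fun l => e (Sum.inl l)) (.goto fun _ => e (Sum.inr q.start))
    fun l => hm (Sum.inl l)
  obtain ⟨t', ht', h'⟩ := hq Λ m (fun l => e (Sum.inr l)) next fun l => hm (Sum.inr l)
  refine ⟨t' + t, by omega, ?_⟩
  rw [Function.iterate_add_apply]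
  exact (congrArg _ h).trans h'

theorem Runs.ite_true (hc : c v = true) (hp : p.Runs v S v' S' T) :
    (ite c p q).Runs v S v' S' (T + 1) := by
  intro Λ m e next hm
  obtain ⟨t, ht, h⟩ := hp Λ m (fun l => e (some (Sum.inl l))) next fun l => hm (some (Sum.inl l))
  refine ⟨t + 1, by omega, ?_⟩
  have h0 : m (e none) = .branch c (.goto fun _ => e (some (Sum.inl p.start)))
      (.goto fun _ => e (some (Sum.inr q.start))) := hm none
  rw [Function.iterate_add_apply, ← h]
  simp [flip, start, h0, hc]

theorem Runs.ite_false (hc : c v = false) (hq : q.Runs v S v' S' T) :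
    (ite c p q).Runs v S v' S' (T + 1) := by
  intro Λ m e next hm
  obtain ⟨t, ht, h⟩ := hq Λ m (fun l => e (some (Sum.inr l))) next fun l => hm (some (Sum.inr l))
  refine ⟨t + 1, by omega, ?_⟩
  have h0 : m (e none) = .branch c (.goto fun _ => e (some (Sum.inl p.start)))
      (.goto fun _ => e (some (Sum.inr q.start))) := hm none
  rw [Function.iterate_add_apply, ← h]
  simp [flip, start, h0, hc]

theorem runs_loop_false (hc : c v = false) : (loop c p).Runs v S v S 1 := by
  intro Λ m e next hm
  have h0 : m (e none) = .branch c (.goto fun _ => e (some p.start)) next := hm none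
  refine ⟨1, le_rfl, ?_⟩
  simp [flip, start, h0, hc]

/-- Loops are unrolled one round at a time, so every loop is analysed by induction on its data; the
extra step is the test. -/
theorem Runs.loop_true (hc : c v = true) (hp : p.Runs v S v' S' T)
    (hl : (loop c p).Runs v' S' v'' S'' T') : (loop c p).Runs v S v'' S'' (T + T' + 1) := by
  intro Λ m e next hm
  obtain ⟨t, ht, h⟩ := hp Λ m (fun l => e (some l)) (.goto fun _ => e none) fun l => hm (some l)
  obtain ⟨t', ht', h'⟩ := hl Λ m e next hm
  have h0 : m (e none) = .branch c (.goto fun _ => e (some p.start)) next := hm none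
  refine ⟨t' + t + 1, by omega, ?_⟩
  rw [Function.iterate_add_apply, Function.iterate_add_apply]
  rw [show (flip bind (Turing.TM2.step m))^[1] (some ⟨some (e (loop c p).start), v, S⟩) =
      some ⟨some (e (some p.start)), v, S⟩ by simp [flip, start, h0, hc]]
  exact (congrArg _ h).trans h'

end Prog

end Compile

end MajMaj

/-! ### Stack programs that manipulate binary trees. -/

namespace MajMaj

/-- Binary trees, the data of the programs. -/
inductive D : Type
  | nil : D
  | cons (x y : D) : D
  deriving DecidableEq

/-- A tree in Polish notation. -/
def D.word : D → List Bool
  | .nil => [false]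
  | .cons x y => true :: (x.word ++ y.word)

/-- The work stacks. -/
inductive Work
  | main
  | a
  | b
  | c
  deriving DecidableEq

instance : Fintype Work := ⟨{.main, .a, .b, .c}, fun x => by cases x <;> decide⟩

/-- The stacks: input, output and work stacks. -/
inductive Stk
  | inp
  | out
  | w (k : Work)
  deriving DecidableEq, Fintype

/-- The stack alphabets. -/
@[reducible]
def Alph : Stk → Type
  | .inp => Sym
  | .out => Bool
  | .w _ => Bool

/-- The register of the machine. -/
structure Reg where
  /-- the last symbol read from the input -/
  s : Option Sym
  /-- the last symbol read from a work stack -/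
  r : Option Bool
  /-- the last symbol read from another work stack -/
  r' : Option Bool
  /-- a flag -/
  f : Bool
  deriving Fintype

/-- The register in its initial state. -/
def Reg.zero : Reg := ⟨none, none, none, false⟩

/-- Programs of the machine. -/
abbrev Pr : Type := Prog Alph Reg

/-- The work stacks with the given contents. -/
def wk (m a b c : List Bool) : Work → List Bool
  | .main => m
  | .a => a
  | .b => b
  | .c => c

/-- All stacks, with the given contents. -/
def stk (i : List Sym) (o : List Bool) (W : Work → List Bool) : ∀ k, List (Alph k)
  | .inp => i
  | .out => o
  | .w k => W k

section Stacks

variable (i : List Sym) (o m a b c l : List Bool) (W : Work → List Bool)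

@[simp] theorem stk_inp : stk i o W .inp = i := rfl
@[simp] theorem stk_out : stk i o W .out = o := rfl
@[simp] theorem stk_w (k : Work) : stk i o W (.w k) = W k := rfl
@[simp] theorem wk_main : wk m a b c .main = m := rfl
@[simp] theorem wk_a : wk m a b c .a = a := rfl
@[simp] theorem wk_b : wk m a b c .b = b := rfl
@[simp] theorem wk_c : wk m a b c .c = c := rfl

@[simp] theorem update_inp (l : List Sym) :
    Function.update (stk i o W) .inp l = stk l o W := by
  funext k; rcases k with _ | _ | k <;> rfl
@[simp] theorem update_out : Function.update (stk i o W) .out l = stk i l W := by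
  funext k; rcases k with _ | _ | k <;> rfl
@[simp] theorem update_w (k : Work) :
    Function.update (stk i o W) (.w k) l = stk i o (Function.update W k l) := by
  funext j
  rcases j with _ | _ | j
  · rfl
  · rfl
  · by_cases h : j = k
    · subst h; simp
    · rw [Function.update_of_ne (by simpa using h)]
      simp [h]
@[simp] theorem update_main : Function.update (wk m a b c) .main l = wk l a b c := by
  funext k; cases k <;> rfl
@[simp] theorem update_a : Function.update (wk m a b c) .a l = wk m l b c := by
  funext k; cases k <;> rfl
@[simp] theorem update_b : Function.update (wk m a b c) .b l = wk m a l c := by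
  funext k; cases k <;> rfl
@[simp] theorem update_c : Function.update (wk m a b c) .c l = wk m a b l := by
  funext k; cases k <;> rfl

end Stacks

namespace Pr

open Prog

/-- The program `p` changes the register and the work stacks as indicated, in at most `T` steps. -/
def WRuns (p : Pr) (v : Reg) (W : Work → List Bool) (v' : Reg) (W' : Work → List Bool)
    (T : ℕ) : Prop :=
  ∀ i o, p.Runs v (stk i o W) v' (stk i o W') T

section Rules

variable {p q : Pr} {c : Reg → Bool} {v v' v'' : Reg} {W W' W'' : Work → List Bool} {T T' : ℕ}

theorem WRuns.mono (h : WRuns p v W v' W' T) (hT : T ≤ T') : WRuns p v W v' W' T' :=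
  fun i o => (h i o).mono hT

theorem wruns_push (k : Work) (f : Reg → Bool) :
    WRuns (.push (.w k) f) v W v (Function.update W k (f v :: W k)) 1 := fun i o => by
  simpa using runs_push (v := v) (S := stk i o W) (Stk.w k) f

theorem wruns_pop (k : Work) (f : Reg → Option Bool → Reg) :
    WRuns (.pop (.w k) f) v W (f v (W k).head?) (Function.update W k (W k).tail) 1 := fun i o => by
  simpa using runs_pop (v := v) (S := stk i o W) (Stk.w k) f

theorem wruns_load (f : Reg → Reg) : WRuns (.load f) v W (f v) W 1 := fun _ _ => runs_load f

theorem WRuns.seq (hp : WRuns p v W v' W' T) (hq : WRuns q v' W' v'' W'' T') :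
    WRuns (.seq p q) v W v'' W'' (T + T') := fun i o => (hp i o).seq (hq i o)

theorem WRuns.ite_true (hc : c v = true) (hp : WRuns p v W v' W' T) :
    WRuns (.ite c p q) v W v' W' (T + 1) := fun i o => (hp i o).ite_true hc

theorem WRuns.ite_false (hc : c v = false) (hq : WRuns q v W v' W' T) :
    WRuns (.ite c p q) v W v' W' (T + 1) := fun i o => (hq i o).ite_false hc

theorem wruns_loop_false (hc : c v = false) : WRuns (.loop c p) v W v W 1 :=
  fun _ _ => runs_loop_false hc

theorem WRuns.loop_true (hc : c v = true) (hp : WRuns p v W v' W' T)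
    (hl : WRuns (.loop c p) v' W' v'' W'' T') : WRuns (.loop c p) v W v'' W'' (T + T' + 1) :=
  fun i o => (hp i o).loop_true hc (hl i o)

end Rules

/-- Push the given symbol. -/
def put (k : Work) (x : Bool) : Pr := .push (.w k) fun _ => x

/-- Pop a symbol into the register `r`. -/
def get (k : Work) : Pr := .pop (.w k) fun v x => { v with r := x }

/-- Pop a symbol into the register `r'`. -/
def get' (k : Work) : Pr := .pop (.w k) fun v x => { v with r' := x }

/-- Push the content of the register `r`. -/
def wr (k : Work) : Pr := .push (.w k) fun v => v.r.getD false

/-- Reset the register. -/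
def reset : Pr := .load fun _ => Reg.zero

/-- Move the stack `src` onto the stack `dst`, in reverse order. -/
def pour (src dst : Work) : Pr :=
  .seq (get src) (.loop (fun v => v.r.isSome) (.seq (wr dst) (get src)))

/-- Move the stack `a` onto the stack `main` and onto the stack `b`, in reverse order. -/
def pour₂ : Pr :=
  .seq (get .a) (.loop (fun v => v.r.isSome) (.seq (wr .main) (.seq (wr .b) (get .a))))

/-- Remove all symbols from the stack `a`. -/
def drain : Pr := .seq (get .a) (.loop (fun v => v.r.isSome) (get .a))

theorem WRuns.congr {p : Pr} {v v₁ v' v₁' : Reg} {W W₁ W' W₁' : Work → List Bool} {T : ℕ}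
    (h : WRuns p v₁ W₁ v₁' W₁' T) (hv : v = v₁) (hW : W = W₁) (hv' : v' = v₁') (hW' : W' = W₁') :
    WRuns p v W v' W' T := by
  subst hv hW hv' hW'; exact h

theorem wruns_pour {src dst : Work} (h : src ≠ dst) (W : Work → List Bool) :
    WRuns (pour src dst) Reg.zero W Reg.zero
      (Function.update (Function.update W src []) dst ((W src).reverse ++ W dst))
      (3 * (W src).length + 2) := by
  -- Loop invariant: the symbol `x` has been popped but not yet written, so the register carries one
  -- symbol in addition to `l`.
  have key : ∀ (l : List Bool) (x : Bool) (W : Work → List Bool), W src = l →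
      WRuns (Prog.loop (fun v : Reg => v.r.isSome) (.seq (wr dst) (get src)) : Pr)
        ⟨none, some x, none, false⟩ W Reg.zero
        (Function.update (Function.update W src []) dst (l.reverse ++ x :: W dst))
        (3 * l.length + 4) := by
    intro l
    induction l with
    | nil =>
      intro x W hW
      refine WRuns.loop_true (T' := 1) rfl ((wruns_push _ _).seq (wruns_pop _ _)) ?_
      refine (wruns_loop_false ?_).congr rfl rfl ?_ ?_
      · simp [hW, h]
      · simp [hW, h]; rfl
      · simp [hW, h, Function.update_comm h]
    | cons y l ih =>
      intro x W hW
      refine (WRuns.loop_true rfl ((wruns_push _ _).seq (wruns_pop _ _))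
        ((ih y (Function.update (Function.update W src l) dst (x :: W dst)) ?_).congr
          ?_ ?_ rfl ?_)).mono ?_
      · simp [h]
      · simp [hW, h]
      · simp [hW, h, Function.update_comm h]
      · funext k
        simp only [Function.update_apply]
        split_ifs <;> simp
      · simp; omega
  cases hW : W src with
  | nil =>
    refine ((wruns_pop _ _).seq ((wruns_loop_false ?_).congr rfl rfl ?_ ?_))
    · simp [hW]
    · simp [hW, Reg.zero]
    · simp [hW, h.symm]
  | cons x l =>
    refine ((wruns_pop _ _).seq ((key l x (Function.update W src l) ?_).congr ?_ ?_ ?_ ?_)).mono ?_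
    · simp
    · simp [hW, Reg.zero]
    · simp [hW]
    · rfl
    · simp [h.symm]
    · simp; omega

theorem wruns_pour₂ (m a : List Bool) :
    WRuns pour₂ Reg.zero (wk m a [] []) Reg.zero (wk (a.reverse ++ m) [] a.reverse [])
      (4 * a.length + 2) := by
  have key : ∀ (l : List Bool) (x : Bool) (m b : List Bool),
      WRuns (Prog.loop (fun v : Reg => v.r.isSome) (.seq (wr .main) (.seq (wr .b) (get .a))) : Pr)
        ⟨none, some x, none, false⟩ (wk m l b []) Reg.zero
        (wk (l.reverse ++ x :: m) [] (l.reverse ++ x :: b) []) (4 * l.length + 5) := by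
    intro l
    induction l with
    | nil =>
      intro x m b
      refine (WRuns.loop_true (T' := 1) rfl
        ((wruns_push _ _).seq ((wruns_push _ _).seq (wruns_pop _ _))) ?_)
      refine (wruns_loop_false ?_).congr rfl rfl ?_ ?_ <;> simp [Reg.zero]
    | cons y l ih =>
      intro x m b
      refine (WRuns.loop_true rfl ((wruns_push _ _).seq ((wruns_push _ _).seq (wruns_pop _ _)))
        ((ih y (x :: m) (x :: b)).congr ?_ ?_ rfl ?_)).mono ?_
      · simp
      · simp
      · simp
      · simp; omega
  cases a with
  | nil => refine ((wruns_pop _ _).seq ((wruns_loop_false ?_).congr rfl rfl ?_ ?_)) <;> simp [Reg.zero]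
  | cons x l =>
    refine ((wruns_pop _ _).seq ((key l x m []).congr ?_ ?_ ?_ ?_)).mono ?_
    · simp [Reg.zero]
    · simp
    · rfl
    · simp
    · simp; omega

theorem wruns_drain (m a : List Bool) :
    WRuns drain Reg.zero (wk m a [] []) Reg.zero (wk m [] [] []) (2 * a.length + 2) := by
  have key : ∀ (l : List Bool) (x : Bool),
      WRuns (Prog.loop (fun v : Reg => v.r.isSome) (get .a) : Pr)
        ⟨none, some x, none, false⟩ (wk m l [] []) Reg.zero (wk m [] [] []) (2 * l.length + 3) := by
    intro l
    induction l with
    | nil =>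
      intro x
      refine (WRuns.loop_true (T' := 1) rfl (wruns_pop _ _) ?_)
      refine (wruns_loop_false ?_).congr rfl rfl ?_ ?_ <;> simp [Reg.zero]
    | cons y l ih =>
      intro x
      refine (WRuns.loop_true rfl (wruns_pop _ _) ((ih y).congr ?_ ?_ rfl rfl)).mono ?_
      · simp
      · simp
      · simp; omega
  cases a with
  | nil => refine ((wruns_pop _ _).seq ((wruns_loop_false ?_).congr rfl rfl ?_ ?_)) <;> simp [Reg.zero]
  | cons x l =>
    refine ((wruns_pop _ _).seq ((key l x).congr ?_ ?_ ?_ ?_)).mono ?_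
    · simp [Reg.zero]
    · simp
    · rfl
    · simp
    · simp; omega

/-- The loop of `moveTree`. -/
def moveLoop : Pr :=
  .loop (fun v => v.f) (.seq (get .main) (.seq (wr .a) (.ite (fun v => v.r.getD false) (put .c true)
    (.seq (get' .c) (.load fun v => ⟨none, none, none, v.r'.isSome⟩)))))

/-- Move the topmost tree of the stack `main` onto the stack `a`, in reverse order. -/
def moveTree : Pr := .seq (.load fun v => { v with f := true }) moveLoop

/-- The stack `c` counts in unary the right subtrees still to be read: the root of a `cons` adds a
mark, and a `nil` completes a subtree and removes one. The tree is complete when a mark is requested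
and none is left. -/
theorem wruns_moveTree (x : D) (m b : List Bool) :
    WRuns moveTree Reg.zero (wk (x.word ++ m) [] b []) Reg.zero (wk m x.word.reverse b [])
      (6 * x.word.length + 2) := by
  -- Continuation form: any run of the loop from the state after `x` extends to a run from the state
  -- before `x`. This makes the induction on trees compose, the run for the right subtree being the
  -- continuation for the left one.
  have key : ∀ (x : D) (v : Reg) (m a c : List Bool) (v' : Reg) (W' : Work → List Bool) (T : ℕ),
      v.f = true →
      WRuns moveLoop ⟨none, none, none, c.head?.isSome⟩
        (wk m (x.word.reverse ++ a) b c.tail) v' W' T →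
      WRuns moveLoop v (wk (x.word ++ m) a b c) v' W' (T + 6 * x.word.length) := by
    intro x
    induction x with
    | nil =>
      intro v m a c v' W' T hv h
      refine (WRuns.loop_true hv ((wruns_pop _ _).seq ((wruns_push _ _).seq (WRuns.ite_false ?_
        ((wruns_pop _ _).seq (wruns_load _))))) (h.congr ?_ ?_ rfl rfl)).mono ?_
      · simp [D.word]
      · simp
      · simp [D.word]
      · simp [D.word]; omega
    | cons x y ihx ihy =>
      intro v m a c v' W' T hv h
      refine (WRuns.loop_true hv ((wruns_pop _ _).seq ((wruns_push _ _).seq (WRuns.ite_true ?_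
        (wruns_push _ _)))) ((ihx _ (y.word ++ m) (true :: a) (true :: c) v' W' _ ?_
          (ihy _ m _ c v' W' T ?_ ?_)).congr rfl ?_ rfl rfl)).mono ?_
      · simp [D.word]
      · simp [hv]
      · simp
      · simpa [D.word] using h
      · simp [D.word]
      · simp [D.word]; omega
  refine ((wruns_load _).seq (key x _ m [] [] Reg.zero (wk m x.word.reverse b []) 1 rfl
    ((wruns_loop_false ?_).congr ?_ ?_ rfl rfl))).mono ?_
  · rfl
  · rfl
  · simp
  · omega

/-- The program `p` changes the stack `main` as indicated, in at most `T` steps. -/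
def Exec (p : Pr) (m m' : List Bool) (T : ℕ) : Prop :=
  WRuns p Reg.zero (wk m [] [] []) Reg.zero (wk m' [] [] []) T

section Exec

variable {p q : Pr} {m m' m'' : List Bool} {T T' : ℕ}

theorem Exec.mono (h : Exec p m m' T) (hT : T ≤ T') : Exec p m m' T' := WRuns.mono h hT

theorem Exec.seq (hp : Exec p m m' T) (hq : Exec q m' m'' T') : Exec (.seq p q) m m'' (T + T') :=
  WRuns.seq hp hq

/-- Remove the topmost tree. -/
def drop : Pr := .seq moveTree drain

theorem exec_drop (x : D) (m : List Bool) : Exec drop (x.word ++ m) m (8 * x.word.length + 4) :=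
  ((wruns_moveTree x m []).seq (wruns_drain m _)).mono (by simp; omega)

theorem wruns_pour_to {src dst : Work} (h : src ≠ dst) {W W' : Work → List Bool} {T : ℕ}
    (hW : W' = Function.update (Function.update W src []) dst ((W src).reverse ++ W dst))
    (hT : 3 * (W src).length + 2 ≤ T) :
    WRuns (pour src dst) Reg.zero W Reg.zero W' T := by
  subst hW; exact (wruns_pour h W).mono hT

/-- Duplicate the topmost tree. -/
def dup : Pr := .seq moveTree (.seq pour₂ (.seq (pour .b .a) (pour .a .main)))

theorem exec_dup (x : D) (m : List Bool) :
    Exec dup (x.word ++ m) (x.word ++ (x.word ++ m)) (16 * x.word.length + 8) := by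
  have h1 : WRuns (pour .b .a) Reg.zero (wk (x.word ++ m) [] x.word []) Reg.zero
      (wk (x.word ++ m) x.word.reverse [] []) (3 * x.word.length + 2) :=
    wruns_pour_to (by decide) (by simp) (by simp)
  have h2 : WRuns (pour .a .main) Reg.zero (wk (x.word ++ m) x.word.reverse [] []) Reg.zero
      (wk (x.word ++ (x.word ++ m)) [] [] []) (3 * x.word.length + 2) :=
    wruns_pour_to (by decide) (by simp) (by simp)
  refine ((wruns_moveTree x m []).seq (((wruns_pour₂ _ _).congr rfl rfl rfl ?_).seq
    (h1.seq h2))).mono ?_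
  · simp
  · simp; omega

/-- Move the two topmost trees of the stack `main` onto the stacks `c` and `a`. -/
def split : Pr := .seq moveTree (.seq (pour .a .b) (.seq moveTree (pour .b .c)))

theorem wruns_split (x y : D) (m : List Bool) :
    WRuns split Reg.zero (wk (x.word ++ (y.word ++ m)) [] [] []) Reg.zero
      (wk m y.word.reverse [] x.word.reverse) (12 * x.word.length + 6 * y.word.length + 8) := by
  refine ((wruns_moveTree x _ []).seq ((wruns_pour_to (W' := wk (y.word ++ m) [] x.word [])
    (T := 3 * x.word.length + 2) (by decide) (by simp) (by simp)).seq
    ((wruns_moveTree y m x.word).seq (wruns_pour_to (T := 3 * x.word.length + 2)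
      (by decide) (by simp) (by simp))))).mono ?_
  omega

/-- Exchange the two topmost trees. -/
def swap : Pr := .seq split (.seq (pour .c .main) (pour .a .main))

theorem exec_swap (x y : D) (m : List Bool) :
    Exec swap (x.word ++ (y.word ++ m)) (y.word ++ (x.word ++ m))
      (16 * (x.word.length + y.word.length) + 12) := by
  refine ((wruns_split x y m).seq ((wruns_pour_to (W' := wk (x.word ++ m) y.word.reverse [] [])
    (T := 3 * x.word.length + 2) (by decide) (by simp) (by simp)).seq
      (wruns_pour_to (T := 3 * y.word.length + 2) (by decide) (by simp) (by simp)))).mono ?_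
  omega

/-- The loop of `compare`. -/
def compareLoop : Pr :=
  .loop (fun v => v.r.isSome || v.r'.isSome) (.seq (.load fun v => { v with f := v.f && v.r == v.r' })
    (.seq (get .a) (get' .c)))

/-- Compare the stacks `a` and `c`. -/
def compare : Pr := .seq (.load fun v => { v with f := true })
  (.seq (get .a) (.seq (get' .c) compareLoop))

theorem wruns_compare (m a c : List Bool) :
    WRuns compare Reg.zero (wk m a [] c) ⟨none, none, none, decide (a = c)⟩ (wk m [] [] [])
      (4 * (a.length + c.length) + 4) := by
  -- The flag `f` accumulates the verdict. Heads are compared as options, so a difference in length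
  -- is also detected.
  have key : ∀ (n : ℕ) (a c : List Bool) (f : Bool), a.length + c.length = n →
      WRuns compareLoop ⟨none, a.head?, c.head?, f⟩ (wk m a.tail [] c.tail)
        ⟨none, none, none, f && decide (a = c)⟩ (wk m [] [] []) (4 * n + 1) := by
    intro n
    induction n using Nat.strong_induction_on with
    | _ n ih =>
      intro a c f hn
      by_cases h : a = [] ∧ c = []
      · obtain ⟨rfl, rfl⟩ := h
        refine ((wruns_loop_false rfl).congr rfl rfl ?_ rfl).mono (by omega)
        simp
      · have hlt : a.tail.length + c.tail.length < n := by
          cases a <;> cases c <;> simp at * <;> omega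
        refine (WRuns.loop_true ?_ ((wruns_load _).seq ((wruns_pop _ _).seq (wruns_pop _ _)))
          ((ih _ hlt a.tail c.tail (f && a.head? == c.head?) rfl).congr ?_ ?_ ?_ rfl)).mono ?_
        · cases a <;> cases c <;> simp at *
        · simp
        · simp
        · rcases a with _ | ⟨x, a⟩ <;> rcases c with _ | ⟨y, c⟩ <;> simp
          cases x <;> cases y <;> simp <;> congr
        · omega
  refine ((wruns_load _).seq ((wruns_pop _ _).seq ((wruns_pop _ _).seq
    ((key _ a c true rfl).congr ?_ ?_ ?_ rfl)))).mono ?_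
  · simp [Reg.zero]
  · simp
  · simp
  · omega

/-- The tree that encodes a truth value. -/
def _root_.MajMaj.D.ofBool (x : Bool) : D := if x then .cons .nil .nil else .nil

/-- Replace the two topmost trees by the truth value of their equality. -/
def eqTop : Pr := .seq split (.seq compare (.seq (put .main false)
  (.ite (fun v => v.f) (.seq (put .main false) (.seq (put .main true) reset)) reset)))

/-- Polish notation is a prefix code; the arbitrary suffixes are needed for the induction. -/
theorem _root_.MajMaj.D.word_append_inj {x y : D} {u v : List Bool}
    (h : x.word ++ u = y.word ++ v) : x = y ∧ u = v := by
  induction x generalizing y u v with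
  | nil => cases y <;> simp_all [D.word]
  | cons x₁ x₂ ih₁ ih₂ =>
    cases y with
    | nil => simp [D.word] at h
    | cons y₁ y₂ =>
      simp only [D.word, List.cons_append, List.cons.injEq, true_and, List.append_assoc] at h
      obtain ⟨rfl, h'⟩ := ih₁ h
      obtain ⟨rfl, rfl⟩ := ih₂ h'
      exact ⟨rfl, rfl⟩

theorem _root_.MajMaj.D.word_injective : Function.Injective D.word := fun x y h =>
  (D.word_append_inj (u := []) (v := []) (by simpa using h)).1

theorem exec_eqTop (x y : D) (m : List Bool) :
    Exec eqTop (x.word ++ (y.word ++ m)) ((D.ofBool (decide (x = y))).word ++ m)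
      (16 * (x.word.length + y.word.length) + 20) := by
  have h : decide (y.word.reverse = x.word.reverse) = decide (x = y) := by
    simp [D.word_injective.eq_iff, eq_comm]
  refine ((wruns_split x y m).seq ((wruns_compare _ _ _).seq ((wruns_push _ _).seq
    (T' := 4) ?_))).mono ?_
  · rw [h]
    by_cases hxy : x = y
    · refine (WRuns.ite_true ?_ ((wruns_push _ _).seq ((wruns_push _ _).seq
        (wruns_load _)))).congr rfl rfl rfl ?_ <;> simp [hxy, D.ofBool, D.word]
    · refine ((WRuns.ite_false ?_ (wruns_load _)).congr rfl rfl rfl ?_).mono ?_ <;>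
        simp [hxy, D.ofBool, D.word]
  · simp; omega

/-- Continue with `p` or `q` according to the topmost symbol, which is removed. -/
def caseTop (p q : Pr) : Pr :=
  .seq (get .main) (.ite (fun v => v.r.getD false) (.seq reset p) (.seq reset q))

theorem exec_caseTop_true (h : Exec p m m' T) : Exec (caseTop p q) (true :: m) m' (T + 3) := by
  refine ((wruns_pop _ _).seq (WRuns.ite_true ?_ ((wruns_load _).seq (h.congr rfl ?_ rfl rfl)))).mono
    ?_
  · simp
  · simp
  · omega

theorem exec_caseTop_false (h : Exec q m m' T) : Exec (caseTop p q) (false :: m) m' (T + 3) := by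
  refine ((wruns_pop _ _).seq (WRuns.ite_false ?_ ((wruns_load _).seq (h.congr rfl ?_ rfl rfl)))).mono
    ?_
  · simp
  · simp
  · omega

theorem exec_put (x : Bool) : Exec (put .main x) m (x :: m) 1 :=
  (wruns_push _ _).congr rfl rfl rfl (by simp)

/-- Set the flag if the second symbol of `main` is `true`. -/
def check : Pr := .seq (get .main) (.seq (get' .main) (.seq (.push (.w .main) fun v => v.r'.getD false)
  (.seq (wr .main) (.load fun v => ⟨none, none, none, v.r'.getD false⟩))))

/-- The first symbol is the root of the pair, so the second is the root of `x`, which is `false`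
exactly for `nil`. Both symbols are pushed back. -/
theorem wruns_check (x : D) (y : D) (m : List Bool) :
    WRuns check Reg.zero (wk ((D.cons x y).word ++ m) [] [] []) ⟨none, none, none, decide (x ≠ .nil)⟩
      (wk ((D.cons x y).word ++ m) [] [] []) 5 := by
  refine (((wruns_pop _ _).seq ((wruns_pop _ _).seq ((wruns_push _ _).seq ((wruns_push _ _).seq
    (wruns_load _)))))).congr rfl rfl ?_ ?_ <;> cases x <;> simp [D.word]

/-- Repeat `p` as long as the first component of the topmost tree is not `nil`. -/
def whileCons (p : Pr) : Pr := .seq check (.loop (fun v => v.f) (.seq reset (.seq p check)))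

/-- The rule for iteration over a list: `l i` is the rest of the list and `s i` the other data after
`i` rounds. A round costs `T`, plus `5` for `check` and one each for the reset and the test. -/
theorem exec_whileCons {n : ℕ} {l s : ℕ → D} (hn : l n = .nil) (hl : ∀ i < n, l i ≠ .nil)
    (hp : ∀ i < n, Exec p ((D.cons (l i) (s i)).word ++ m)
      ((D.cons (l (i + 1)) (s (i + 1))).word ++ m) T) :
    Exec (whileCons p) ((D.cons (l 0) (s 0)).word ++ m) ((D.cons (l n) (s n)).word ++ m)
      (n * (T + 7) + 6) := by
  have key : WRuns (Prog.loop (fun v : Reg => v.f) (.seq reset (.seq p check)) : Pr)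
      ⟨none, none, none, decide (l 0 ≠ .nil)⟩ (wk ((D.cons (l 0) (s 0)).word ++ m) [] [] [])
      Reg.zero (wk ((D.cons (l n) (s n)).word ++ m) [] [] []) (n * (T + 7) + 1) := by
    induction n generalizing l s with
    | zero =>
      refine ((wruns_loop_false ?_).congr rfl rfl ?_ rfl).mono (by omega)
      · simp [hn]
      · simp [hn, Reg.zero]
    | succ n ih =>
      have h0 : WRuns p Reg.zero _ Reg.zero _ T := hp 0 (by omega)
      refine (WRuns.loop_true ?_ ((wruns_load _).seq (h0.seq (wruns_check _ _ _)))
        (ih (l := fun i => l (i + 1)) (s := fun i => s (i + 1)) hn (fun i hi => hl _ (by omega))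
          fun i hi => hp _ (by omega))).mono ?_
      · simpa using hl 0 (by omega)
      · ring_nf; omega
  exact ((wruns_check _ _ _).seq key).mono (by omega)

end Exec

end Pr
end MajMaj

/-! ### Tree encodings and functions computable in polynomial time. -/

namespace MajMaj

/-- Types whose elements are encoded as trees. The size of an element bounds the length of its
encoding, and may be larger. -/
class Enc (α : Type) where
  /-- the encoding -/
  enc : α → D
  /-- the size -/
  size : α → ℕ
  word_le : ∀ a, (enc a).word.length ≤ size a

open Enc

/-- The encoding of a list. -/
def D.ofList {α : Type} (e : α → D) : List α → D
  | [] => .nil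
  | a :: l => .cons (e a) (D.ofList e l)

/-- The encoding of a natural number in unary. -/
def D.ofNat : ℕ → D
  | 0 => .nil
  | n + 1 => .cons .nil (D.ofNat n)

instance : Enc Bool := ⟨D.ofBool, fun _ => 3, fun b => by cases b <;> decide⟩

instance : Enc ℕ := ⟨D.ofNat, fun n => 2 * n + 1, fun n => by
  induction n with
  | zero => decide
  | succ n ih => simp [D.ofNat, D.word] at *; omega⟩

instance {α β : Type} [Enc α] [Enc β] : Enc (α × β) :=
  ⟨fun p => .cons (enc p.1) (enc p.2), fun p => size p.1 + size p.2 + 1, fun p => by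
    have := word_le p.1
    have := word_le p.2
    simp [D.word]; omega⟩

/-- The size of a list. -/
def listSize {α : Type} [Enc α] : List α → ℕ
  | [] => 1
  | a :: l => size a + listSize l + 1

instance {α : Type} [Enc α] : Enc (List α) :=
  ⟨D.ofList enc, listSize, fun l => by
    induction l with
    | nil => simp [D.ofList, D.word, listSize]
    | cons a l ih =>
      have := word_le a
      simp [D.ofList, D.word, listSize] at *; omega⟩

section Size

variable {α β : Type} [Enc α] [Enc β]

@[simp] theorem size_bool (b : Bool) : size b = 3 := rfl
@[simp] theorem size_nat (n : ℕ) : size n = 2 * n + 1 := rfl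
@[simp] theorem size_prod (p : α × β) : size p = size p.1 + size p.2 + 1 := rfl
@[simp] theorem size_nil : size ([] : List α) = 1 := rfl
@[simp] theorem size_cons (a : α) (l : List α) : size (a :: l) = size a + size l + 1 := rfl

theorem size_pos (a : α) : 1 ≤ size a := by
  refine le_trans ?_ (word_le a)
  cases enc a <;> simp [D.word]

theorem size_append (l l' : List α) : size (l ++ l') + 1 = size l + size l' := by
  induction l with
  | nil => simp [Nat.add_comm]
  | cons a l ih => simp; omega

theorem size_reverse (l : List α) : size l.reverse = size l := by
  induction l with
  | nil => rfl
  | cons a l ih =>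
    have := size_append l.reverse [a]
    simp at *; omega

theorem size_drop_le (k : ℕ) (l : List α) : size (l.drop k) ≤ size l := by
  have := size_append (l.take k) (l.drop k)
  have := size_pos (l.take k)
  rw [List.take_append_drop] at *
  omega

theorem length_lt_size (l : List α) : l.length + 1 ≤ size l := by
  induction l with
  | nil => simp
  | cons a l ih => simp; omega

theorem size_lt_of_mem {a : α} {l : List α} (h : a ∈ l) : size a < size l := by
  induction l with
  | nil => simp at h
  | cons b l ih =>
    have := size_pos l
    rcases List.mem_cons.1 h with rfl | h
    · simp
    · have := ih h; simp; omega

theorem size_le_of_forall {l : List α} {B : ℕ} (h : ∀ a ∈ l, size a ≤ B) :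
    size l ≤ l.length * (B + 1) + 1 := by
  induction l with
  | nil => simp
  | cons a l ih =>
    have h1 := ih fun a ha => h a (List.mem_cons_of_mem _ ha)
    have h2 := h a List.mem_cons_self
    simp [add_mul]; omega

end Size

/-- Encodings that are injective. -/
class EncInj (α : Type) [Enc α] : Prop where
  inj : Function.Injective (enc : α → D)

theorem D.ofBool_injective : Function.Injective D.ofBool := by
  intro a b; cases a <;> cases b <;> simp [D.ofBool]

instance : EncInj Bool := ⟨D.ofBool_injective⟩

instance : EncInj ℕ := ⟨fun a => by
  induction a with
  | zero => intro b; cases b <;> simp [enc, D.ofNat]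
  | succ a ih =>
    intro b; cases b with
    | zero => simp [enc, D.ofNat]
    | succ b => intro h; simp only [enc, D.ofNat, D.cons.injEq, true_and] at h; rw [ih h]⟩

instance {α β : Type} [Enc α] [Enc β] [EncInj α] [EncInj β] : EncInj (α × β) := ⟨fun a b h => by
  simp only [enc, D.cons.injEq] at h
  exact Prod.ext (EncInj.inj h.1) (EncInj.inj h.2)⟩

instance {α : Type} [Enc α] [EncInj α] : EncInj (List α) := ⟨fun a => by
  induction a with
  | nil => intro b; cases b <;> simp [enc, D.ofList]
  | cons a l ih =>
    intro b; cases b with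
    | nil => simp [enc, D.ofList]
    | cons b l' =>
      intro h
      simp only [enc, D.ofList, D.cons.injEq] at h
      rw [EncInj.inj h.1, ih h.2]⟩

/-- The function is bounded by a polynomial in the size. -/
@[fun_prop]
def PB {α : Type} [Enc α] (T : α → ℕ) : Prop := ∃ c : ℕ, ∀ a, T a ≤ (size a + 2) ^ c

namespace PB

variable {α β : Type} [Enc α] [Enc β] {T T' : α → ℕ}

theorem mono (h : PB T) (hT : ∀ a, T' a ≤ T a) : PB T' :=
  let ⟨c, hc⟩ := h; ⟨c, fun a => (hT a).trans (hc a)⟩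

-- The summand `2` in the base keeps it at least `2`, so constants and sums are absorbed by raising
-- the exponent.
@[fun_prop]
theorem const (n : ℕ) : PB fun _ : α => n :=
  ⟨n, fun a => (Nat.lt_two_pow_self (n := n)).le.trans (Nat.pow_le_pow_left (by omega) n)⟩

@[fun_prop]
theorem size : PB (size : α → ℕ) := ⟨1, fun a => by simp⟩

@[fun_prop]
theorem add (h : PB T) (h' : PB T') : PB fun a => T a + T' a := by
  obtain ⟨c, hc⟩ := h
  obtain ⟨d, hd⟩ := h'
  refine ⟨c + d + 1, fun a => ?_⟩
  have h1 := (hc a).trans (Nat.pow_le_pow_right (by omega) (Nat.le_add_right c d))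
  have h2 := (hd a).trans (Nat.pow_le_pow_right (by omega) (Nat.le_add_left d c))
  have h3 : 0 < (Enc.size a + 2) ^ (c + d) := by positivity
  rw [pow_succ]
  nlinarith

@[fun_prop]
theorem mul (h : PB T) (h' : PB T') : PB fun a => T a * T' a := by
  obtain ⟨c, hc⟩ := h
  obtain ⟨d, hd⟩ := h'
  refine ⟨c + d, fun a => ?_⟩
  rw [pow_add]
  exact Nat.mul_le_mul (hc a) (hd a)

@[fun_prop]
theorem pow (h : PB T) (n : ℕ) : PB fun a => T a ^ n := by
  obtain ⟨c, hc⟩ := h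
  refine ⟨c * n, fun a => ?_⟩
  rw [pow_mul]
  exact Nat.pow_le_pow_left (hc a) n

theorem comp {f : α → β} {T : β → ℕ} (h : PB T) (hf : PB fun a => Enc.size (f a)) :
    PB fun a => T (f a) := by
  obtain ⟨c, hc⟩ := h
  have : PB fun a => (Enc.size (f a) + 2) ^ c := by fun_prop
  exact this.mono fun a => hc (f a)

end PB

open Pr

/-- The function is computed by a program in time polynomial in the size. -/
@[fun_prop]
def Poly {α β : Type} [Enc α] [Enc β] (f : α → β) : Prop :=
  (PB fun a => size (f a)) ∧ ∃ (p : Pr) (T : α → ℕ), PB T ∧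
    ∀ a m, Exec p ((enc a).word ++ m) ((enc (f a)).word ++ m) (T a)

namespace Poly

variable {α β γ δ : Type} [Enc α] [Enc β] [Enc γ] [Enc δ]

@[fun_prop]
theorem size {f : α → β} (h : Poly f) : PB fun a => size (f a) := h.1

/-- A map that does not change the tree costs nothing; only the size, which need not be the length
of the word, has to be controlled. -/
theorem of_enc {f : α → β} (h : ∀ a, enc (f a) = enc a) (hs : PB fun a => Enc.size (f a)) :
    Poly f :=
  ⟨hs, reset, fun _ => 1, PB.const 1, fun a m => by rw [h]; exact wruns_load _⟩

@[fun_prop]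
theorem id : Poly fun a : α => a := of_enc (fun _ => rfl) PB.size

@[fun_prop]
theorem const (b : β) : Poly fun _ : α => b := by
  refine ⟨PB.const _, ?_⟩
  have key : ∀ d : D, ∃ (p : Pr) (t : ℕ), ∀ m, Exec p m (d.word ++ m) t := by
    intro d
    induction d with
    | nil => exact ⟨_, _, fun m => exec_put false⟩
    | cons x y ihx ihy =>
      obtain ⟨p, t, hp⟩ := ihx
      obtain ⟨q, u, hq⟩ := ihy
      refine ⟨.seq q (.seq p (put .main true)), u + (t + 1), fun m => (hq m).seq ((hp _).seq ?_)⟩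
      simpa [D.word] using exec_put (m := x.word ++ (y.word ++ m)) true
  obtain ⟨p, t, hp⟩ := key (enc b)
  exact ⟨_, _, by fun_prop, fun a m => (exec_drop (enc a) m |>.mono
    (T' := 8 * Enc.size a + 4) (by have := word_le a; omega)).seq (hp m)⟩

-- The size bound for `f a`, the first component of `Poly`, is what turns the running time of `g`
-- into a polynomial in the size of `a`.
@[fun_prop]
theorem comp {g : β → γ} {f : α → β} (hg : Poly g) (hf : Poly f) : Poly fun a => g (f a) := by
  obtain ⟨hf1, p, T, hT, hp⟩ := hf
  obtain ⟨hg1, q, U, hU, hq⟩ := hg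
  have := hU.comp hf1
  exact ⟨hg1.comp hf1, _, _, hT.add this, fun a m => (hp a m).seq (hq (f a) m)⟩

@[fun_prop]
theorem pair {f : α → β} {g : α → γ} (hf : Poly f) (hg : Poly g) : Poly fun a => (f a, g a) := by
  obtain ⟨hf1, p, T, hT, hp⟩ := hf
  obtain ⟨hg1, q, U, hU, hq⟩ := hg
  refine ⟨by simp only [size_prod]; fun_prop, .seq dup (.seq q (.seq swap (.seq p (put .main true)))),
    fun a => (16 * Enc.size a + 8) + (U a + ((16 * (Enc.size (g a) + Enc.size a) + 12) + (T a + 1))),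
    by fun_prop, fun a m => ?_⟩
  have h1 := word_le a
  have h2 := word_le (g a)
  have h : Exec (put .main true) ((enc (f a)).word ++ ((enc (g a)).word ++ m))
    ((enc (f a, g a)).word ++ m) 1 := by
      have := exec_put (m := (enc (f a)).word ++ ((enc (g a)).word ++ m)) true
      simpa [enc, D.word] using this
  exact ((exec_dup _ m).seq ((hq a _).seq ((exec_swap _ _ m).seq ((hp a _).seq h)))).mono
    (by dsimp only; omega)

theorem fst' : Poly (Prod.fst : α × β → α) := by
  refine ⟨PB.size.mono fun a => by simp; omega, caseTop (.seq swap drop) reset,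
    fun a => 24 * Enc.size a + 19, by fun_prop, fun a m => ?_⟩
  have h1 := word_le a.1
  have h2 := word_le a.2
  have := exec_caseTop_true (q := reset)
    ((exec_swap (enc a.1) (enc a.2) m).seq (exec_drop (enc a.2) ((enc a.1).word ++ m)))
  exact (by simpa [enc, D.word] using this : Exec _ _ _ _).mono (by simp; omega)

theorem snd' : Poly (Prod.snd : α × β → β) := by
  refine ⟨PB.size.mono fun a => by simp; omega, caseTop drop reset,
    fun a => 24 * Enc.size a + 19, by fun_prop, fun a m => ?_⟩
  have h1 := word_le a.1
  have := exec_caseTop_true (q := reset) (exec_drop (enc a.1) ((enc a.2).word ++ m))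
  exact (by simpa [enc, D.word] using this : Exec _ _ _ _).mono (by simp; omega)

@[fun_prop]
theorem fst {f : α → β × γ} (h : Poly f) : Poly fun a => (f a).1 := fst'.comp h

@[fun_prop]
theorem snd {f : α → β × γ} (h : Poly f) : Poly fun a => (f a).2 := snd'.comp h

@[fun_prop]
theorem cond {c : α → Bool} {f g : α → β} (hc : Poly c) (hf : Poly f) (hg : Poly g) :
    Poly fun a => bif c a then f a else g a := by
  obtain ⟨hf1, p, T, hT, hp⟩ := hf
  obtain ⟨hg1, q, U, hU, hq⟩ := hg
  obtain ⟨-, r, V, hV, hr⟩ := hc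
  refine ⟨(hf1.add hg1).mono fun a => by cases h : c a <;> simp [h],
    -- The tree of `true` is `.cons .nil .nil`: after its root is removed, two copies of `nil` have
    -- to be dropped.
    .seq dup (.seq r (caseTop (.seq drop (.seq drop p)) q)),
    fun a => (16 * Enc.size a + 8) + (V a + (27 + T a + U a)), by fun_prop, fun a m => ?_⟩
  have h1 := word_le a
  refine ((exec_dup _ m).seq ((hr a _).seq (T' := 27 + T a + U a) ?_)).mono
    (by dsimp only; omega)
  cases h : c a with
  | true =>
    have := exec_caseTop_true (q := q) ((exec_drop .nil (D.nil.word ++ ((enc a).word ++ m))).seq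
      ((exec_drop .nil _).seq (hp a m)))
    exact (by simpa [h, enc, D.word, D.ofBool] using this : Exec _ _ _ _).mono (by omega)
  | false =>
    have := exec_caseTop_false (p := (.seq drop (.seq drop p))) (hq a m)
    exact (by simpa [h, enc, D.word, D.ofBool] using this : Exec _ _ _ _).mono (by omega)

@[fun_prop]
theorem beq [EncInj β] [DecidableEq β] {f g : α → β} (hf : Poly f) (hg : Poly g) :
    Poly fun a => decide (f a = g a) := by
  have : Poly fun p : β × β => decide (p.1 = p.2) := by
    refine ⟨PB.const 3, caseTop eqTop reset, fun a => 16 * Enc.size a + 23, by fun_prop,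
      fun a m => ?_⟩
    have h1 := word_le a.1
    have h2 := word_le a.2
    have := exec_caseTop_true (q := reset) (exec_eqTop (enc a.1) (enc a.2) m)
    simp only [EncInj.inj.eq_iff] at this
    exact (by simpa [enc, D.word] using this : Exec _ _ _ _).mono (by simp; omega)
  exact this.comp (hf.pair hg)

/-- Case distinction on a list. -/
theorem casesList {l : α → List β} {f : α → γ} {g : α → β → List β → γ} (hl : Poly l) (hf : Poly f)
    (hg : Poly fun p : α × β × List β => g p.1 p.2.1 p.2.2) :
    Poly fun a => match l a with
      | [] => f a
      | b :: t => g a b t := by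
  obtain ⟨hf1, p, T, hT, hp⟩ := hf
  obtain ⟨hg1, q, U, hU, hq⟩ := hg
  obtain ⟨hl1, r, V, hV, hr⟩ := hl
  have hg2 : ∃ G : α → ℕ, PB G ∧ ∀ a b t, l a = b :: t → Enc.size (g a b t) ≤ G a := by
    obtain ⟨c, hc⟩ := hg1
    refine ⟨fun a => (Enc.size a + Enc.size (l a) + 2 + 2) ^ c, by fun_prop, fun a b t h => ?_⟩
    refine (hc (a, b, t)).trans (Nat.pow_le_pow_left ?_ c)
    simp [h]
  have hU2 : ∃ G : α → ℕ, PB G ∧ ∀ a b t, l a = b :: t → U (a, b, t) ≤ G a := by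
    obtain ⟨c, hc⟩ := hU
    refine ⟨fun a => (Enc.size a + Enc.size (l a) + 2 + 2) ^ c, by fun_prop, fun a b t h => ?_⟩
    refine (hc (a, b, t)).trans (Nat.pow_le_pow_left ?_ c)
    simp [h]
  obtain ⟨G, hG, hG'⟩ := hg2
  obtain ⟨G₂, hG₂, hG₂'⟩ := hU2
  refine ⟨(hf1.add hG).mono fun a => ?_,
    -- In the `cons` case the removed root is put back, giving `b :: t`, which has the same tree as
    -- the pair `(b, t)`. After the swap, another root pairs it with `a`.
    .seq dup (.seq r (caseTop (.seq (put .main true) (.seq swap (.seq (put .main true) q))) p)),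
    fun a => (16 * Enc.size a + 8) + (V a + (17 + T a + 16 * (Enc.size a + Enc.size (l a)) + G₂ a)),
    by fun_prop, fun a m => ?_⟩
  · cases h : l a with
    | nil => simp [h]
    | cons b t => have := hG' a b t h; simp [h]; omega
  have h1 := word_le a
  refine ((exec_dup _ m).seq ((hr a _).seq
    (T' := 17 + T a + 16 * (Enc.size a + Enc.size (l a)) + G₂ a) ?_)).mono
    (by dsimp only; omega)
  cases h : l a with
  | nil =>
    have := exec_caseTop_false
      (p := .seq (put .main true) (.seq swap (.seq (put .main true) q))) (hp a m)
    exact (by simpa [h, enc, D.word, D.ofList] using this : Exec _ _ _ _).mono (by omega)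
  | cons b t =>
    have h2 := word_le (l a)
    have h3 := hG₂' a b t h
    rw [h] at h2
    have e1 := exec_put (m := (enc b).word ++ ((enc t).word ++ ((enc a).word ++ m))) true
    have e2 := exec_swap (enc (b :: t)) (enc a) m
    have e3 := exec_put (m := (enc a).word ++ ((enc (b :: t)).word ++ m)) true
    have e4 := hq (a, b, t) m
    have e2' : Exec swap (true :: ((enc b).word ++ ((enc t).word ++ ((enc a).word ++ m))))
      ((enc a).word ++ ((enc (b :: t)).word ++ m))
        (16 * ((enc (b :: t)).word.length + (enc a).word.length) + 12) := by
        simpa [enc, D.word, D.ofList] using e2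
    have e4' : Exec q (true :: ((enc a).word ++ ((enc (b :: t)).word ++ m)))
        ((enc (g a b t)).word ++ m) (U (a, b, t)) := by
      simpa [enc, D.word, D.ofList] using e4
    have := (exec_caseTop_true (q := p) (e1.seq (e2'.seq (e3.seq e4')))).mono
      (T' := 17 + T a + 16 * (Enc.size a + Enc.size (l a)) + G₂ a) (by rw [h]; omega)
    simpa [h, enc, D.word, D.ofList] using this

/-- Iterate over a list. -/
theorem foldl_of_bound {l : α → List β} {s : α → γ} {g : α → γ → β → γ} {B : α → ℕ} (hl : Poly l)
    (hs : Poly s) (hg : Poly fun p : α × γ × β => g p.1 p.2.1 p.2.2) (hB : PB B)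
    (h : ∀ a k, Enc.size (((l a).take k).foldl (g a) (s a)) ≤ B a) :
    Poly fun a => (l a).foldl (g a) (s a) := by
  -- The loop state is the rest of the list, the parameter `a`, and the accumulator; `a` is carried
  -- along because `g` depends on it.
  have hstep : Poly fun p : List β × α × γ => match p.1 with
      | [] => p
      | b :: t => (t, p.2.1, g p.2.1 p.2.2 b) := by
    have := hg.comp (f := fun q : (List β × α × γ) × β × List β => (q.1.2.1, q.1.2.2, q.2.1))
      (by fun_prop)
    exact casesList (by fun_prop) (by fun_prop) (by fun_prop)
  obtain ⟨-, p, T, ⟨c, hc⟩, hp⟩ := hstep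
  obtain ⟨-, q, U, hU, hq⟩ := (show Poly fun a => (l a, a, s a) by fun_prop)
  obtain ⟨-, r, V, ⟨d, hd⟩, hr⟩ := (show Poly fun p : List β × α × γ => p.2.2 by fun_prop)
  refine ⟨hB.mono fun a => by simpa using h a (l a).length, .seq q (.seq (whileCons p) r),
    fun a => U a + ((Enc.size (l a) * ((Enc.size (l a) + Enc.size a + B a + 4) ^ c + 7) + 6) +
      (Enc.size (l a) + Enc.size a + B a + 4) ^ d), ?_, fun a m => ?_⟩
  · fun_prop
  have hlen := length_lt_size (l a)
  -- Here the bound `B` on all intermediate accumulators is indispensable: iterating a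
  -- polynomial-time step may otherwise blow up exponentially.
  have hst : ∀ k, Enc.size ((l a).drop k, a, ((l a).take k).foldl (g a) (s a)) + 2 ≤
      Enc.size (l a) + Enc.size a + B a + 4 := fun k => by
    have h1 := h a k
    have h2 := size_drop_le k (l a)
    simp; omega
  have hloop := exec_whileCons (p := p) (m := m) (n := (l a).length)
    (T := (Enc.size (l a) + Enc.size a + B a + 4) ^ c)
    (l := fun k => enc ((l a).drop k)) (s := fun k => enc (a, ((l a).take k).foldl (g a) (s a)))
    (by simp [enc, D.ofList])
    (fun i hi => by rw [List.drop_eq_getElem_cons hi]; simp [enc, D.ofList])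
    (fun i hi => by
      have e := hp ((l a).drop i, a, ((l a).take i).foldl (g a) (s a)) m
      rw [List.drop_eq_getElem_cons hi] at e
      have h3 := (hc ((l a).drop i, a, ((l a).take i).foldl (g a) (s a))).trans
        (Nat.pow_le_pow_left (hst i) c)
      rw [List.drop_eq_getElem_cons hi] at h3
      refine Exec.mono ?_ h3
      rw [List.drop_eq_getElem_cons hi, ← List.take_concat_get' _ _ hi, List.foldl_append]
      exact e)
  have e := hr ((l a).drop (l a).length, a, ((l a).take (l a).length).foldl (g a) (s a)) m
  have e' := e.mono ((hd _).trans (Nat.pow_le_pow_left (hst _) d))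
  rw [List.take_length] at e'
  rw [List.take_length] at hloop
  refine ((hq a m).seq ((Exec.mono hloop ?_).seq e'))
  have := Nat.mul_le_mul_right ((Enc.size (l a) + Enc.size a + B a + 4) ^ c + 7) 
    (show (l a).length ≤ Enc.size (l a) by omega)
  omega

end Poly

end MajMaj

/-! ### List operations and unary arithmetic in polynomial time. -/

namespace MajMaj

open Enc

instance : Enc Unit := ⟨fun _ => .nil, fun _ => 1, fun _ => by simp [D.word]⟩

theorem take_iterate {β : Type} (k : ℕ) (l : List β) :
    (fun p : List β × List β => (p.1.tail, p.1.head?.toList ++ p.2))^[k] (l, []) =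
      (l.drop k, (l.take k).reverse) := by
  induction k with
  | zero => simp
  | succ k ih =>
    rw [Function.iterate_succ_apply', ih]
    cases h : l[k]? with
    | none => simp [List.take_add_one, h]
    | some b => simp [List.take_add_one, h]

namespace Poly

variable {α β γ δ : Type} [Enc α] [Enc β] [Enc γ] [Enc δ]

@[fun_prop]
theorem cons {f : α → β} {l : α → List β} (hf : Poly f) (hl : Poly l) : Poly fun a => f a :: l a :=
  have : Poly fun p : β × List β => p.1 :: p.2 :=
    of_enc (fun _ => rfl) (PB.size.mono fun _ => le_rfl)
  this.comp (hf.pair hl)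

theorem revAppend' {l l' : α → List β} (hl : Poly l) (hl' : Poly l') :
    Poly fun a => (l a).foldl (fun t b => b :: t) (l' a) := by
  refine foldl_of_bound (g := fun _ t b => b :: t)
    (B := fun a => Enc.size (l a) + Enc.size (l' a)) hl hl' (by fun_prop) (by fun_prop) ?_
  intro a k
  have h : ∀ t t' : List β, t.foldl (fun t b => b :: t) t' = t.reverse ++ t' := fun t => by
    induction t with
    | nil => simp
    | cons b t ih => intro t'; simp [ih]
  have h1 := size_append ((l a).take k) ((l a).drop k)
  have h2 := size_pos ((l a).drop k)
  have h3 := size_append ((l a).take k).reverse (l' a)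
  rw [size_reverse] at h3
  rw [List.take_append_drop] at h1
  rw [h]
  omega

theorem revAppend {l l' : α → List β} (hl : Poly l) (hl' : Poly l') :
    Poly fun a => (l a).reverse ++ l' a := by
  have := revAppend' hl hl'
  convert this using 2 with a
  generalize l' a = t
  induction l a generalizing t with
  | nil => simp
  | cons b s ih => simp [← ih]

@[fun_prop]
theorem reverse {l : α → List β} (hl : Poly l) : Poly fun a => (l a).reverse := by
  simpa using revAppend hl (const ([] : List β))

@[fun_prop]
theorem append {l l' : α → List β} (hl : Poly l) (hl' : Poly l') : Poly fun a => l a ++ l' a := by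
  simpa using revAppend hl.reverse hl'

/-- Every element of `l a` is smaller than the list, so one polynomial in the sizes of `a` and `l a`
bounds all values of `g a`. -/
theorem exists_bound {l : α → List β} {g : α → β → γ} (hl : Poly l)
    (hg : PB fun p : α × β => Enc.size (g p.1 p.2)) :
    ∃ B : α → ℕ, PB B ∧ ∀ a, ∀ b ∈ l a, Enc.size (g a b) ≤ B a := by
  obtain ⟨c, hc⟩ := hg
  refine ⟨fun a => (Enc.size a + Enc.size (l a) + 1 + 2) ^ c, by fun_prop, fun a b hb => ?_⟩
  refine (hc (a, b)).trans (Nat.pow_le_pow_left ?_ c)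
  have := size_lt_of_mem hb
  simp; omega

@[fun_prop]
theorem flatMap {l : α → List β} {g : α → β → List γ} (hl : Poly l)
    (hg : Poly fun p : α × β => g p.1 p.2) : Poly fun a => (l a).flatMap (g a) := by
  obtain ⟨B, hB, hB'⟩ := exists_bound hl hg.1
  have h : ∀ (f : β → List γ) (t : List β) (t' : List γ),
      t.foldl (fun t b => (f b).reverse ++ t) t' = (t.flatMap f).reverse ++ t' := fun f t => by
    induction t with
    | nil => simp
    | cons b t ih => intro t'; simp [ih]
  have key : Poly fun a => (l a).foldl (fun t b => (g a b).reverse ++ t) [] := by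
    refine foldl_of_bound (g := fun a t b => (g a b).reverse ++ t)
      (B := fun a => Enc.size (l a) * (B a) + 1) hl (const _) ?_ (by fun_prop) ?_
    · have := hg.comp (f := fun p : α × List γ × β => (p.1, p.2.2)) (by fun_prop)
      exact revAppend this (by fun_prop)
    · intro a k
      have h1 : ∀ t : List β, (∀ b ∈ t, Enc.size (g a b) ≤ B a) →
          Enc.size (t.flatMap (g a)) ≤ t.length * B a + 1 := by
        intro t ht
        induction t with
        | nil => simp
        | cons b t ih =>
          have h2 := size_append (g a b) (t.flatMap (g a))
          have h3 := ih fun b hb => ht b (List.mem_cons_of_mem _ hb)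
          have h4 := ht b List.mem_cons_self
          simp [add_mul] at *; omega
      rw [h, List.append_nil, size_reverse]
      refine (h1 _ fun b hb => hB' a b (List.mem_of_mem_take hb)).trans ?_
      have h5 := length_lt_size (l a)
      refine Nat.add_le_add_right (Nat.mul_le_mul_right _ ?_) 1
      simp; omega
  have := key.reverse
  simpa [h] using this

@[fun_prop]
theorem map {l : α → List β} {g : α → β → γ} (hl : Poly l)
    (hg : Poly fun p : α × β => g p.1 p.2) : Poly fun a => (l a).map (g a) := by
  have : Poly fun a => (l a).flatMap fun b => [g a b] := by fun_prop
  convert this using 2 with a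
  induction l a <;> simp_all

@[fun_prop]
theorem ite {c : α → Bool} {f g : α → β} (hc : Poly c) (hf : Poly f) (hg : Poly g) :
    Poly fun a => if c a = true then f a else g a := by
  simpa [Bool.cond_eq_ite] using hc.cond hf hg

@[fun_prop]
theorem not {c : α → Bool} (hc : Poly c) : Poly fun a => !(c a) := by
  have : Poly fun a => bif c a then false else true := by fun_prop
  convert this using 2 with a
  cases c a <;> rfl

@[fun_prop]
theorem and {c d : α → Bool} (hc : Poly c) (hd : Poly d) : Poly fun a => c a && d a := by
  have : Poly fun a => bif c a then d a else false := by fun_prop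
  convert this using 2 with a
  cases c a <;> rfl

@[fun_prop]
theorem or {c d : α → Bool} (hc : Poly c) (hd : Poly d) : Poly fun a => c a || d a := by
  have : Poly fun a => bif c a then true else d a := by fun_prop
  convert this using 2 with a
  cases c a <;> rfl

@[fun_prop]
theorem filter {l : α → List β} {c : α → β → Bool} (hl : Poly l)
    (hc : Poly fun p : α × β => c p.1 p.2) : Poly fun a => (l a).filter (c a) := by
  have : Poly fun a => (l a).flatMap fun b => bif c a b then [b] else [] := by fun_prop
  convert this using 2 with a
  induction l a with
  | nil => rfl
  | cons b t ih => cases h : c a b <;> simp [h, ih]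

@[fun_prop]
theorem isEmpty {l : α → List β} (hl : Poly l) : Poly fun a => (l a).isEmpty := by
  have := casesList (f := fun _ => true) (g := fun _ _ _ => false) hl (by fun_prop) (by fun_prop)
  convert this using 2 with a
  cases l a <;> rfl

@[fun_prop]
theorem any {l : α → List β} {c : α → β → Bool} (hl : Poly l)
    (hc : Poly fun p : α × β => c p.1 p.2) : Poly fun a => (l a).any (c a) := by
  have : Poly fun a => !((l a).filter (c a)).isEmpty := by fun_prop
  convert this using 2 with a
  induction l a with
  | nil => rfl
  | cons b t ih => cases h : c a b <;> simp_all

@[fun_prop]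
theorem all {l : α → List β} {c : α → β → Bool} (hl : Poly l)
    (hc : Poly fun p : α × β => c p.1 p.2) : Poly fun a => (l a).all (c a) := by
  have : Poly fun a => !(l a).any fun b => !(c a b) := by fun_prop
  convert this using 2 with a
  simp [List.not_any_eq_all_not]

@[fun_prop]
theorem tail {l : α → List β} (hl : Poly l) : Poly fun a => (l a).tail := by
  have := casesList (f := fun _ => []) (g := fun _ _ t => t) hl (by fun_prop) (by fun_prop)
  convert this using 2 with a
  cases l a <;> rfl

@[fun_prop]
theorem headD {l : α → List β} {f : α → β} (hl : Poly l) (hf : Poly f) :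
    Poly fun a => (l a).headD (f a) := by
  have := casesList (f := f) (g := fun _ b _ => b) hl (by fun_prop) (by fun_prop)
  convert this using 2 with a
  cases l a <;> rfl

@[fun_prop]
theorem succ {f : α → ℕ} (hf : Poly f) : Poly fun a => f a + 1 :=
  have h : Poly fun p : Unit × ℕ => p.2 + 1 :=
    of_enc (fun _ => rfl) (PB.mono (T := fun p => 2 * Enc.size p + 1) (by fun_prop)
      fun p => by simp; omega)
  h.comp ((const ()).pair hf)

/-- A unary number and a list of that many units are the same tree. This turns iteration over a list
into iteration a given number of times. -/
theorem replicate_unit {n : α → ℕ} (hn : Poly n) : Poly fun a => List.replicate (n a) () := by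
  have h : Poly fun n : ℕ => List.replicate n () := by
    refine of_enc (fun n => ?_) (PB.mono (T := fun p => 2 * Enc.size p + 1) (by fun_prop) fun n => ?_)
    · induction n with
      | zero => rfl
      | succ n ih => simpa [enc, List.replicate_succ, D.ofList, D.ofNat] using ih
    · refine (size_le_of_forall (B := 1) fun a _ => le_rfl).trans ?_
      simp; omega
  exact h.comp hn

@[fun_prop]
theorem replicate {n : α → ℕ} {f : α → β} (hn : Poly n) (hf : Poly f) :
    Poly fun a => List.replicate (n a) (f a) := by
  have : Poly fun a => (List.replicate (n a) ()).map fun _ => f a := by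
    have := replicate_unit hn
    fun_prop
  simpa using this

@[fun_prop]
theorem length {l : α → List β} (hl : Poly l) : Poly fun a => (l a).length := by
  have h : ∀ (t : List β) (n : ℕ), t.foldl (fun n _ => n + 1) n = n + t.length := fun t => by
    induction t with
    | nil => simp
    | cons b t ih => intro n; simp [ih]; omega
  have := foldl_of_bound (s := fun _ => 0) (g := fun _ n _ => n + 1)
    (B := fun a => 2 * Enc.size (l a) + 1) hl (by fun_prop) (by fun_prop) (by fun_prop)
    fun a k => by
      have := length_lt_size (l a)
      simp [h]; omega
  simpa [h] using this

/-- Iterate a function. -/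
theorem iterate_of_bound {n : α → ℕ} {s : α → γ} {g : α → γ → γ} {B : α → ℕ} (hn : Poly n)
    (hs : Poly s) (hg : Poly fun p : α × γ => g p.1 p.2) (hB : PB B)
    (h : ∀ a k, k ≤ n a → Enc.size ((g a)^[k] (s a)) ≤ B a) :
    Poly fun a => (g a)^[n a] (s a) := by
  have e : ∀ (a : α) (k : ℕ) (t : γ), (List.replicate k ()).foldl (fun t _ => g a t) t = (g a)^[k] t :=
    fun a k => by
      induction k with
      | zero => intro t; rfl
      | succ k ih => intro t; simp [List.replicate_succ, ih]
  have := foldl_of_bound (g := fun a t _ => g a t) (B := B) (replicate_unit hn) hs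
    (hg.comp (f := fun p : α × γ × Unit => (p.1, p.2.1)) (by fun_prop)) hB
    fun a k => by
      rw [List.take_replicate, e]
      exact h a _ (by omega)
  simpa [e] using this

-- Truncated subtraction of unary numbers is removal of a prefix; comparison is derived from it.
@[fun_prop]
theorem sub {m n : α → ℕ} (hm : Poly m) (hn : Poly n) : Poly fun a => m a - n a := by
  have h : ∀ (k : ℕ) (t : List Unit), (List.tail)^[k] t = t.drop k := fun k => by
    induction k with
    | zero => intro t; rfl
    | succ k ih => intro t; simp [ih]
  have : Poly fun a => ((List.tail)^[n a] (List.replicate (m a) ())).length := by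
    refine length (iterate_of_bound (B := fun a => Enc.size (List.replicate (m a) ())) hn
      (by fun_prop) (by fun_prop) (by fun_prop) fun a k _ => ?_)
    rw [h]
    exact size_drop_le _ _
  simpa [h] using this

@[fun_prop]
theorem lt {m n : α → ℕ} (hm : Poly m) (hn : Poly n) : Poly fun a => decide (m a < n a) := by
  have : Poly fun a => !decide (n a - m a = 0) := by fun_prop
  convert this using 2 with a
  by_cases h : m a < n a
  · have : n a - m a ≠ 0 := by omega
    simp [h, this]
  · have : n a - m a = 0 := by omega
    simp [h, this]

@[fun_prop]
theorem add {m n : α → ℕ} (hm : Poly m) (hn : Poly n) : Poly fun a => m a + n a := by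
  have : Poly fun a => (List.replicate (m a) () ++ List.replicate (n a) ()).length := by fun_prop
  simpa using this

@[fun_prop]
theorem mul {m n : α → ℕ} (hm : Poly m) (hn : Poly n) : Poly fun a => m a * n a := by
  have : Poly fun a => ((List.replicate (m a) ()).flatMap fun _ => List.replicate (n a) ()).length := by
    fun_prop
  simpa using this

theorem range_iterate (k : ℕ) :
    (fun p : ℕ × List ℕ => (p.1 + 1, p.1 :: p.2))^[k] (0, []) = (k, (List.range k).reverse) := by
  induction k with
  | zero => rfl
  | succ k ih => rw [Function.iterate_succ_apply', ih]; simp [List.range_succ]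

@[fun_prop]
theorem range {n : α → ℕ} (hn : Poly n) : Poly fun a => List.range (n a) := by
  have : Poly fun a => ((fun p : ℕ × List ℕ => (p.1 + 1, p.1 :: p.2))^[n a] (0, [])).2.reverse := by
    refine reverse (snd (iterate_of_bound (B := fun a => 2 * n a + 1 + (n a * (2 * n a + 1 + 1) + 1) + 1)
      hn (by fun_prop) (by fun_prop) ?_ fun a k hk => ?_))
    · have : PB n := hn.1.mono fun a => by simp; omega
      fun_prop
    · rw [range_iterate, size_prod, size_reverse]
      have h1 := size_le_of_forall (l := List.range k) (B := 2 * n a + 1) fun b hb => by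
        simp at *; omega
      have h2 := Nat.mul_le_mul_right (2 * n a + 1 + 1) hk
      rw [List.length_range] at h1
      simp only [size_nat]
      omega
  simpa [range_iterate] using this

@[fun_prop]
theorem take {n : α → ℕ} {l : α → List β} (hn : Poly n) (hl : Poly l) :
    Poly fun a => (l a).take (n a) := by
  have h : Poly fun p : α × List β × List β => p.2.1.head?.toList ++ p.2.2 := by
    have := casesList (l := fun p : α × List β × List β => p.2.1) (f := fun p => p.2.2)
      (g := fun p b _ => b :: p.2.2) (by fun_prop) (by fun_prop) (by fun_prop)
    convert this using 2 with p
    cases p.2.1 <;> rfl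
  have : Poly fun a => ((fun p : List β × List β => (p.1.tail, p.1.head?.toList ++ p.2))^[n a]
      (l a, [])).2.reverse := by
    refine reverse (snd (iterate_of_bound (B := fun a => 2 * Enc.size (l a) + 1)
      hn (by fun_prop) (by fun_prop) (by fun_prop) fun a k hk => ?_))
    rw [take_iterate, size_prod, size_reverse]
    have h1 := size_append ((l a).take k) ((l a).drop k)
    have h2 := size_pos ((l a).drop k)
    have h3 := size_drop_le k (l a)
    rw [List.take_append_drop] at h1
    simp; omega
  simpa [take_iterate] using this

end Poly

/-! ### Binary numbers -/

/-- The number with the given binary digits, least significant digit first. -/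
def bval : List Bool → ℕ
  | [] => 0
  | b :: l => b.toNat + 2 * bval l

/-- One step of the addition of binary numbers. The state consists of the summands, the carry, and
the reversed sum. -/
def addStep (s : List Bool × List Bool × Bool × List Bool) :
    List Bool × List Bool × Bool × List Bool :=
  (s.1.tail, s.2.1.tail,
    (s.1.headD false && s.2.1.headD false) || ((s.1.headD false || s.2.1.headD false) && s.2.2.1),
    (bif s.1.headD false then (bif s.2.1.headD false then s.2.2.1 else !s.2.2.1) else
      (bif s.2.1.headD false then !s.2.2.1 else s.2.2.1)) :: s.2.2.2)

/-- Addition of binary numbers. -/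
def badd (l l' : List Bool) : List Bool :=
  (addStep^[l.length + l'.length + 1] (l, l', false, [])).2.2.2.reverse

theorem addStep_iterate_length (k : ℕ) (s : List Bool × List Bool × Bool × List Bool) :
    (addStep^[k] s).2.2.2.length = s.2.2.2.length + k ∧ (addStep^[k] s).1 = s.1.drop k ∧
      (addStep^[k] s).2.1 = s.2.1.drop k := by
  induction k with
  | zero => simp
  | succ k ih =>
    rw [Function.iterate_succ_apply']
    generalize addStep^[k] s = t at *
    simp [addStep, ih]
    omega

@[simp] theorem length_badd (l l' : List Bool) : (badd l l').length = l.length + l'.length + 1 := by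
  rw [badd, List.length_reverse, (addStep_iterate_length _ _).1]
  simp

theorem bval_append (l l' : List Bool) : bval (l ++ l') = bval l + 2 ^ l.length * bval l' := by
  induction l with
  | nil => simp [bval]
  | cons b l ih => simp [bval, ih, pow_succ]; ring

/-- The invariant of school addition: the digits already written, plus the remaining summands and
the carry at the current position, keep their total value. -/
theorem addStep_iterate_bval (k : ℕ) (s : List Bool × List Bool × Bool × List Bool) :
    bval (addStep^[k] s).2.2.2.reverse + 2 ^ (addStep^[k] s).2.2.2.length *
      (bval (addStep^[k] s).1 + bval (addStep^[k] s).2.1 + (addStep^[k] s).2.2.1.toNat) =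
    bval s.2.2.2.reverse + 2 ^ s.2.2.2.length * (bval s.1 + bval s.2.1 + s.2.2.1.toNat) := by
  induction k with
  | zero => rfl
  | succ k ih =>
    rw [Function.iterate_succ_apply', ← ih]
    generalize addStep^[k] s = t
    obtain ⟨l, l', c, r⟩ := t
    cases c <;> rcases l with _ | ⟨_ | _, l⟩ <;> rcases l' with _ | ⟨_ | _, l'⟩ <;>
      simp [addStep, bval, bval_append, pow_succ] <;> ring

theorem bval_badd (l l' : List Bool) : bval (badd l l') = bval l + bval l' := by
  have h1 := addStep_iterate_bval (l.length + l'.length + 1) (l, l', false, [])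
  have h2 := addStep_iterate_length (l.length + l'.length + 1) (l, l', false, [])
  have h3 := addStep_iterate_length (l.length + l'.length) (l, l', false, [])
  -- Both summands are exhausted before the last step, so that step writes the carry as a digit and
  -- leaves none.
  have h4 : (addStep^[l.length + l'.length + 1] (l, l', false, [])).2.2.1 = false := by
    rw [Function.iterate_succ_apply']
    generalize addStep^[l.length + l'.length] (l, l', false, []) = t at *
    simp [addStep, h3]
  rw [h2.2.1, h2.2.2, h4, List.drop_of_length_le (by dsimp only; omega),
    List.drop_of_length_le (by dsimp only; omega)] at h1
  rw [badd]
  simpa [bval, -Function.iterate_succ] using h1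

theorem size_bits (l : List Bool) : size l = 4 * l.length + 1 := by
  induction l with
  | nil => rfl
  | cons b l ih => simp [ih]; omega

namespace Poly

variable {α : Type} [Enc α]

theorem of_length {l : α → List Bool} (hl : Poly l) : PB fun a => (l a).length :=
  hl.1.mono fun a => by rw [size_bits]; omega

@[fun_prop]
theorem badd {l l' : α → List Bool} (hl : Poly l) (hl' : Poly l') :
    Poly fun a => badd (l a) (l' a) := by
  have h1 := hl.of_length
  have h2 := hl'.of_length
  unfold MajMaj.badd
  refine reverse (snd (snd (snd (iterate_of_bound (g := fun _ => addStep)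
    (B := fun a => 8 * (l a).length + 8 * (l' a).length + 40)
    (by fun_prop) (by fun_prop) ?_ (by fun_prop) fun a k hk => ?_))))
  · unfold addStep; fun_prop
  · have := addStep_iterate_length k (l a, l' a, false, [])
    simp [size_bits, this]
    omega

end Poly

end MajMaj

namespace MajMaj

open Enc

/-- One step of the comparison of binary numbers. -/
def leStep (s : List Bool × List Bool × Bool) : List Bool × List Bool × Bool :=
  (s.1.tail, s.2.1.tail,
    if decide (s.1.headD false = s.2.1.headD false) then s.2.2 else s.2.1.headD false)

/-- Comparison of binary numbers. -/
def ble (l l' : List Bool) : Bool := (leStep^[l.length + l'.length] (l, l', true)).2.2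

/-- Digits come least significant first, so a later difference overrides all earlier ones; `r` is
the verdict if the remaining digits agree. -/
theorem leStep_iterate (k : ℕ) : ∀ (l l' : List Bool) (r : Bool), l.length ≤ k → l'.length ≤ k →
    (leStep^[k] (l, l', r)).2.2 =
      decide (bval l < bval l' ∨ (bval l = bval l' ∧ r = true)) := by
  induction k with
  | zero => intro l l' r h h'; cases l <;> cases l' <;> simp_all
  | succ k ih =>
    intro l l' r h h'
    rw [Function.iterate_succ_apply, leStep, ih _ _ _ (by simp; omega) (by simp; omega)]
    rcases l with _ | ⟨_ | _, l⟩ <;> rcases l' with _ | ⟨_ | _, l'⟩ <;>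
      simp [bval] <;> grind

theorem ble_eq (l l' : List Bool) : ble l l' = decide (bval l ≤ bval l') := by
  rw [ble, leStep_iterate _ _ _ _ (by omega) (by omega)]
  simp [le_iff_lt_or_eq]

/-- Multiplication of binary numbers. -/
def bmul (l l' : List Bool) : List Bool :=
  l.reverse.foldl (fun s b => badd (bif b then l' else []) (false :: s)) []

/-- Horner's scheme, from the most significant digit of `l`; prepending `false` doubles the
accumulator. -/
theorem bval_bmul (l l' : List Bool) : bval (bmul l l') = bval l * bval l' := by
  rw [bmul, List.foldl_reverse]
  induction l with
  | nil => simp [bval]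
  | cons b l ih =>
    rw [List.foldr_cons, bval_badd]
    cases b <;> simp [bval, ih] <;> ring

/-- The sum of binary numbers. -/
def bsum (L : List (List Bool)) : List Bool := L.foldl badd []

theorem bval_bsum (L : List (List Bool)) : bval (bsum L) = (L.map bval).sum := by
  have h : ∀ s, bval (L.foldl badd s) = bval s + (L.map bval).sum := by
    induction L with
    | nil => simp
    | cons l L ih => intro s; simp [ih, bval_badd]; ring
  rw [bsum, h]
  simp [bval]

/-- The binary digits of a power of two. -/
def bpow (n : ℕ) : List Bool := List.replicate n false ++ [true]

theorem bval_bpow (n : ℕ) : bval (bpow n) = 2 ^ n := by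
  induction n with
  | zero => rfl
  | succ n ih => simp [bpow, List.replicate_succ, bval, pow_succ] at *; omega

/-- Remove the leading zeros of a binary number. -/
def bstrip (l : List Bool) : List Bool :=
  l.reverse.foldl (fun s b => bif s.isEmpty && !b then [] else b :: s) []

theorem bval_bits (n : ℕ) : bval n.bits = n := by
  induction n using Nat.binaryRec' with
  | zero => simp [bval]
  | bit b n h ih =>
    rw [Nat.bits_append_bit _ _ h]
    simp only [bval, ih]
    cases b <;> simp [Nat.bit]; omega

/-- The arithmetic leaves leading zeros, whereas the required output is the canonical `Nat.bits`. -/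
theorem bstrip_eq (l : List Bool) : bstrip l = (bval l).bits := by
  rw [bstrip, List.foldl_reverse]
  induction l with
  | nil => simp [bval]
  | cons b l ih =>
    rw [List.foldr_cons, ih]
    have h : bval (b :: l) = Nat.bit b (bval l) := by cases b <;> simp [bval, Nat.bit]; omega
    rw [h]
    by_cases h0 : bval l = 0
    · cases b <;> simp [h0]
    · rw [Nat.bits_append_bit _ _ fun h => absurd h h0]
      have : (bval l).bits ≠ [] := fun h => h0 (by rw [← bval_bits (bval l), h]; rfl)
      cases h1 : (bval l).bits <;> simp_all

namespace Poly

variable {α : Type} [Enc α]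

@[fun_prop]
theorem ble {l l' : α → List Bool} (hl : Poly l) (hl' : Poly l') :
    Poly fun a => ble (l a) (l' a) := by
  have h1 := hl.of_length
  have h2 := hl'.of_length
  have h : ∀ (k : ℕ) (l l' : List Bool) (r : Bool), (leStep^[k] (l, l', r)).1 = l.drop k ∧
      (leStep^[k] (l, l', r)).2.1 = l'.drop k := fun k l l' r => by
    induction k with
    | zero => simp
    | succ k ih =>
      rw [Function.iterate_succ_apply']
      generalize leStep^[k] (l, l', r) = t at *
      simp [leStep, ih]
  unfold MajMaj.ble
  refine snd (snd (iterate_of_bound (g := fun _ => leStep)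
    (B := fun a => 4 * (l a).length + 4 * (l' a).length + 40)
    (by fun_prop) (by fun_prop) ?_ (by fun_prop) fun a k hk => ?_))
  · unfold leStep; fun_prop
  · have := h k (l a) (l' a) true
    simp [size_bits, this]
    omega

@[fun_prop]
theorem bmul {l l' : α → List Bool} (hl : Poly l) (hl' : Poly l') :
    Poly fun a => bmul (l a) (l' a) := by
  have h1 := hl.of_length
  have h2 := hl'.of_length
  have h : ∀ l l' s : List Bool, (l.foldl (fun s b => MajMaj.badd (bif b then l' else []) (false :: s))
      s).length ≤ s.length + l.length * (l'.length + 2) := fun l l' => by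
    induction l with
    | nil => simp
    | cons b l ih =>
      intro s
      refine (ih _).trans ?_
      cases b <;> simp [add_mul] <;> omega
  unfold MajMaj.bmul
  refine foldl_of_bound (g := fun a s b => MajMaj.badd (bif b then l' a else []) (false :: s))
    (B := fun a => 4 * ((l a).length * ((l' a).length + 2)) + 1) (by fun_prop) (by fun_prop)
    (by fun_prop) (by fun_prop) fun a k => ?_
  rw [size_bits]
  have h3 := h ((l a).reverse.take k) (l' a) []
  have h4 : ((l a).reverse.take k).length ≤ (l a).length := by simp
  have h5 := Nat.mul_le_mul_right ((l' a).length + 2) h4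
  simp only [List.length_nil] at h3
  omega

@[fun_prop]
theorem bsum {L : α → List (List Bool)} (hL : Poly L) : Poly fun a => bsum (L a) := by
  have h : ∀ (L : List (List Bool)) (s : List Bool), Enc.size (L.foldl MajMaj.badd s) ≤
      Enc.size s + 4 * Enc.size L := fun L => by
    induction L with
    | nil => simp
    | cons l L ih =>
      intro s
      refine (ih _).trans ?_
      simp [size_bits]; omega
  unfold MajMaj.bsum
  refine foldl_of_bound (g := fun _ => MajMaj.badd) (B := fun a => 1 + 4 * Enc.size (L a)) (by fun_prop)
    (by fun_prop) (by fun_prop) (by fun_prop) fun a k => ?_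
  have h1 := size_append ((L a).take k) ((L a).drop k)
  have h2 := size_pos ((L a).drop k)
  rw [List.take_append_drop] at h1
  have := h ((L a).take k) []
  simp only [size_nil] at *
  omega

@[fun_prop]
theorem bpow {n : α → ℕ} (hn : Poly n) : Poly fun a => bpow (n a) := by
  unfold MajMaj.bpow; fun_prop

@[fun_prop]
theorem bstrip {l : α → List Bool} (hl : Poly l) : Poly fun a => bstrip (l a) := by
  have h1 := hl.of_length
  have h : ∀ l s : List Bool, (l.foldl (fun s b => bif s.isEmpty && !b then [] else b :: s)
      s).length ≤ s.length + l.length := fun l => by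
    induction l with
    | nil => simp
    | cons b l ih =>
      intro s
      refine (ih _).trans ?_
      cases b <;> cases s <;> simp <;> omega
  unfold MajMaj.bstrip
  refine foldl_of_bound (g := fun a s b => bif s.isEmpty && !b then [] else b :: s)
    (B := fun a => 4 * (l a).length + 1) (by fun_prop) (by fun_prop)
    (by fun_prop) (by fun_prop) fun a k => ?_
  rw [size_bits]
  have h3 := h ((l a).reverse.take k) []
  have h4 : ((l a).reverse.take k).length ≤ (l a).length := by simp
  simp only [List.length_nil] at h3
  omega

end Poly

/-! ### The algorithm -/

/-- A literal over the variables `0, 1, 2, …`. -/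
abbrev Lit : Type := ℕ × Bool

/-- The negation of a literal. -/
def neg (l : Lit) : Lit := (l.1, !l.2)

/-- Membership of a literal in a list. -/
def mem (l : Lit) (c : List Lit) : Bool := c.any fun k => decide (k = l)

/-- The list does not contain a literal together with its negation. -/
def consistent (c : List Lit) : Bool := c.all fun l => !mem (neg l) c

/-- The number of assignments to `n` variables that satisfy all literals of a list, in binary. -/
def cnt (n : ℕ) (c : List Lit) : List Bool :=
  if consistent c = true then
    bpow ((List.range n).filter fun i => !c.any fun l => decide (l.1 = i)).length
  else []

/-- Split the assignments that satisfy all literals of `c` and the clause `C` into disjoint cubes. -/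
def dnfStep (c : List Lit) (C : Lit × Lit) : List (List Lit) :=
  bif mem C.1 c || mem C.2 c then [c] else
  bif mem (neg C.1) c then [C.2 :: c] else
  bif mem (neg C.2) c then [C.1 :: c] else
  [C.1 :: C.2 :: c, C.1 :: neg C.2 :: c, neg C.1 :: C.2 :: c]

/-- Process a clause whose first literal is over `x` and whose second literal is over `y`: if the first
literal is false, then the second one is added to the list of literals that have to hold. -/
def mixStep (r : ℕ) (s : List Lit × List Lit) (C : Lit × Lit) : List (List Lit × List Lit) :=
  bif mem C.2 s.1 then [s] else
  bif decide (s.1.length < r) then [(s.1, C.1 :: s.2), (C.2 :: s.1, neg C.1 :: s.2)] else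
  [(s.1, C.1 :: s.2)]

/-- Process all elements of `G`, keeping at most `M` states. -/
def tfold {σ κ : Type} (M : ℕ) (step : σ → κ → List σ) (G : List κ) (init : List σ) : List σ :=
  G.foldl (fun s C => (s.flatMap fun c => step c C).take M) init

/-- Test whether a `q`-fraction (`q` a quotient of binary numbers) of the `2 ^ n` assignments is at
most a given number. -/
def atLeast (q : List Bool × List Bool) (n : ℕ) (m : List Bool) : Bool :=
  ble (bmul q.1 (bpow n)) (bmul q.2 m)

/-- The number of good assignments of a formula that consists of clauses `XX` over `x`, clauses `XY`
over `x` and `y`, and clauses `YY` over `y`. -/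
def count (n n' : ℕ) (XX XY YY : List (Lit × Lit)) (M M' r : ℕ) (q : List Bool × List Bool) :
    List Bool :=
  bsum ((tfold (M * M') (mixStep r) XY ((tfold M dnfStep XX [[]]).map fun c => ([], c))).map fun s =>
    bif atLeast q n' (bsum ((tfold M' dnfStep YY [[]]).map fun c => cnt n' (c ++ s.1)))
    then cnt n s.2 else [])

namespace Poly

variable {α β γ : Type} [Enc α] [Enc β] [Enc γ]

@[fun_prop]
theorem neg {l : α → Lit} (hl : Poly l) : Poly fun a => neg (l a) := by
  unfold MajMaj.neg; fun_prop

@[fun_prop]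
theorem mem {l : α → Lit} {c : α → List Lit} (hl : Poly l) (hc : Poly c) :
    Poly fun a => mem (l a) (c a) := by
  unfold MajMaj.mem; fun_prop

@[fun_prop]
theorem consistent {c : α → List Lit} (hc : Poly c) : Poly fun a => consistent (c a) := by
  unfold MajMaj.consistent; fun_prop

@[fun_prop]
theorem cnt {n : α → ℕ} {c : α → List Lit} (hn : Poly n) (hc : Poly c) :
    Poly fun a => cnt (n a) (c a) := by
  unfold MajMaj.cnt; fun_prop

theorem dnfStep {c : α → List Lit} {C : α → Lit × Lit} (hc : Poly c) (hC : Poly C) :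
    Poly fun a => dnfStep (c a) (C a) := by
  unfold MajMaj.dnfStep; fun_prop

theorem mixStep {r : α → ℕ} {s : α → List Lit × List Lit} {C : α → Lit × Lit} (hr : Poly r)
    (hs : Poly s) (hC : Poly C) : Poly fun a => mixStep (r a) (s a) (C a) := by
  unfold MajMaj.mixStep; fun_prop

/-- Truncation bounds the number of states by the unary number `M`, and by `h` the size of a state
grows only additively with each element of `G`. Hence all intermediate lists of states stay
polynomial. -/
theorem tfold {M : α → ℕ} {step : α → β → γ → List β} {G : α → List γ} {init : α → List β}
    (hM : Poly M) (hstep : Poly fun p : α × β × γ => step p.1 p.2.1 p.2.2) (hG : Poly G)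
    (hinit : Poly init)
    (h : ∀ a s C, ∀ s' ∈ step a s C, Enc.size s' ≤ Enc.size s + 2 * Enc.size C + 10) :
    Poly fun a => tfold (M a) (step a) (G a) (init a) := by
  have hsize : ∀ (a : α) (B : ℕ) (G : List γ) (init : List β), (∀ s ∈ init, Enc.size s ≤ B) →
      ∀ s ∈ MajMaj.tfold (M a) (step a) G init, Enc.size s ≤ B + 12 * Enc.size G := fun a B G => by
    induction G generalizing B with
    | nil => intro init hi s hs; exact (hi s hs).trans (by omega)
    | cons C G ih =>
      intro init hi s hs
      -- `2 * size C + 10 ≤ 12 * size C`, because sizes are positive.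
      refine (ih (B + 12 * Enc.size C) _ (fun t ht => ?_) s hs).trans (by simp; omega)
      obtain ⟨u, hu, ht⟩ := List.mem_flatMap.1 (List.mem_of_mem_take ht)
      have h1 := h a u C t ht
      have h2 := hi u hu
      have h3 := size_pos C
      omega
  have hlen : ∀ (a : α) (G : List γ) (init : List β),
      (MajMaj.tfold (M a) (step a) G init).length ≤ init.length + M a := fun a G => by
    induction G with
    | nil => intro init; simp [MajMaj.tfold]
    | cons C G ih =>
      intro init
      suffices h : ∀ (G : List γ) (init : List β), init.length ≤ M a →
          (MajMaj.tfold (M a) (step a) G init).length ≤ M a from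
        (h G _ (by simp)).trans (by omega)
      intro G
      induction G with
      | nil => exact fun _ h => h
      | cons C G ih => exact fun init _ => ih _ (by simp)
  refine foldl_of_bound (g := fun a s C => (s.flatMap fun c => step a c C).take (M a))
    (B := fun a => (Enc.size (init a) + M a) * (Enc.size (init a) + 12 * Enc.size (G a) + 1) + 1)
    hG hinit ?_ ?_ fun a k => ?_
  · have := hstep.comp (f := fun p : (α × List β × γ) × β => (p.1.1, p.2, p.1.2.2)) (by fun_prop)
    fun_prop
  · have : PB M := hM.1.mono fun a => by simp; omega
    fun_prop
  have h1 := size_append ((G a).take k) ((G a).drop k)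
  have h2 := size_pos ((G a).drop k)
  rw [List.take_append_drop] at h1
  refine (size_le_of_forall (B := Enc.size (init a) + 12 * Enc.size (G a)) fun s hs => ?_).trans ?_
  · refine (hsize a (Enc.size (init a)) _ (init a) (fun s hs => (size_lt_of_mem hs).le) s hs).trans ?_
    omega
  · have h3 := hlen a ((G a).take k) (init a)
    have h4 := length_lt_size (init a)
    exact Nat.add_le_add_right (Nat.mul_le_mul_right _ (by unfold MajMaj.tfold at h3; omega)) 1

@[fun_prop]
theorem atLeast {q : α → List Bool × List Bool} {n : α → ℕ} {m : α → List Bool} (hq : Poly q)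
    (hn : Poly n) (hm : Poly m) : Poly fun a => atLeast (q a) (n a) (m a) := by
  unfold MajMaj.atLeast; fun_prop

theorem size_dnfStep (c : List Lit) (C : Lit × Lit) :
    ∀ c' ∈ MajMaj.dnfStep c C, Enc.size c' ≤ Enc.size c + 2 * Enc.size C + 10 := by
  intro c' h
  unfold MajMaj.dnfStep at h
  cases h1 : MajMaj.mem C.1 c || MajMaj.mem C.2 c <;> cases h2 : MajMaj.mem (MajMaj.neg C.1) c <;>
    cases h3 : MajMaj.mem (MajMaj.neg C.2) c <;> simp [h1, h2, h3] at h <;>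
    first
    | (subst h; simp; done)
    | (subst h; simp; omega)
    | (rcases h with rfl | rfl | rfl <;> simp [MajMaj.neg] <;> omega)

theorem size_mixStep (r : ℕ) (s : List Lit × List Lit) (C : Lit × Lit) :
    ∀ s' ∈ MajMaj.mixStep r s C, Enc.size s' ≤ Enc.size s + 2 * Enc.size C + 10 := by
  intro s' h
  unfold MajMaj.mixStep at h
  cases h1 : MajMaj.mem C.2 s.1 <;> cases h2 : decide (s.1.length < r) <;> simp only [h1, h2, cond_true,
    cond_false, List.mem_cons, List.not_mem_nil, or_false] at h <;>
    first
    | (subst h; simp; omega)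
    | (rcases h with rfl | rfl <;> simp [MajMaj.neg] <;> omega)

@[fun_prop]
theorem count {n n' M M' r : α → ℕ} {XX XY YY : α → List (Lit × Lit)} {q : α → List Bool × List Bool}
    (hn : Poly n) (hn' : Poly n') (hXX : Poly XX) (hXY : Poly XY) (hYY : Poly YY) (hM : Poly M)
    (hM' : Poly M') (hr : Poly r) (hq : Poly q) :
    Poly fun a => count (n a) (n' a) (XX a) (XY a) (YY a) (M a) (M' a) (r a) (q a) := by
  have h1 : Poly fun a => MajMaj.tfold (M a) MajMaj.dnfStep (XX a) [[]] :=
    tfold (step := fun _ => MajMaj.dnfStep) hM (dnfStep (by fun_prop) (by fun_prop)) hXX (by fun_prop)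
      fun a => size_dnfStep
  have h2 : Poly fun a => MajMaj.tfold (M' a) MajMaj.dnfStep (YY a) [[]] :=
    tfold (step := fun _ => MajMaj.dnfStep) hM' (dnfStep (by fun_prop) (by fun_prop)) hYY (by fun_prop)
      fun a => size_dnfStep
  have h3 := tfold (M := fun a => M a * M' a) (step := fun a => MajMaj.mixStep (r a)) (G := XY)
    (init := fun a => (MajMaj.tfold (M a) MajMaj.dnfStep (XX a) [[]]).map fun c => (([] : List Lit), c))
    (by fun_prop) (mixStep (by fun_prop) (by fun_prop) (by fun_prop)) hXY (by fun_prop)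
      fun a => size_mixStep (r a)
  have h4 : ∀ {Y : α → List (List Lit)} {S : α → List (List Lit × List Lit)}, Poly Y → Poly S →
      Poly fun a => MajMaj.bsum ((S a).map fun s =>
        bif MajMaj.atLeast (q a) (n' a) (MajMaj.bsum ((Y a).map fun c => MajMaj.cnt (n' a) (c ++ s.1)))
        then MajMaj.cnt (n a) s.2 else []) := by
    intro Y S hY hS
    fun_prop
  exact h4 h2 h3

end Poly

end MajMaj

/-! ### Counting assignments. -/

namespace MajMaj

/-- Extend an assignment by `false`. -/
def ext {n : ℕ} (a : Fin n → Bool) (i : ℕ) : Bool := if h : i < n then a ⟨i, h⟩ else false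

/-- The number of assignments to `n` variables with a given property. -/
def num (n : ℕ) (p : (ℕ → Bool) → Bool) : ℕ := ∑ a : Fin n → Bool, (p (ext a)).toNat

/-- All literals of the list are true. -/
def satB (c : List Lit) (v : ℕ → Bool) : Bool := c.all fun l => v l.1 == l.2

/-- One of the literals is true. -/
def clB (C : Lit × Lit) (v : ℕ → Bool) : Bool := v C.1.1 == C.1.2 || v C.2.1 == C.2.2

/-- All clauses are true. -/
def cnfB (G : List (Lit × Lit)) (v : ℕ → Bool) : Bool := G.all fun C => clB C v

section Num

variable {n : ℕ} {p q : (ℕ → Bool) → Bool}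

theorem num_mono (h : ∀ v, p v = true → q v = true) : num n p ≤ num n q :=
  Finset.sum_le_sum fun a _ => by
    have := h (ext a)
    cases hp : p (ext a) <;> cases hq : q (ext a) <;> simp_all

theorem num_congr (h : ∀ v, p v = q v) : num n p = num n q := by
  rw [funext h]

theorem num_true : num n (fun _ => true) = 2 ^ n := by simp [num]

theorem num_eq_card : num n p = (Finset.univ.filter fun a : Fin n → Bool => p (ext a) = true).card := by
  rw [Finset.card_filter]
  exact Finset.sum_congr rfl fun a _ => by cases p (ext a) <;> simp

theorem sum_map_num {α : Type} (L : List α) (p : α → (ℕ → Bool) → Bool) :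
    (L.map fun c => num n (p c)).sum =
      ∑ a : Fin n → Bool, (L.map fun c => (p c (ext a)).toNat).sum := by
  induction L with
  | nil => simp
  | cons c L ih => rw [List.map_cons, List.sum_cons, ih, num, ← Finset.sum_add_distrib]; rfl

theorem ext_update (a : Fin n → Bool) (i : Fin n) (b : Bool) :
    ext (Function.update a i b) = Function.update (ext a) i b := by
  funext j
  by_cases h : j = i
  · subst h; simp [ext]
  · rw [Function.update_of_ne h]
    unfold ext
    split_ifs with hj
    · rw [Function.update_of_ne]
      intro h'; exact h (by rw [← h'])
    · rfl

/-- Flipping the variable `i` is an involution that preserves `p` and exchanges the two values of `v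
i`. -/
theorem two_mul_num_and {i : ℕ} (hi : i < n) (s : Bool)
    (hp : ∀ v b, p (Function.update v i b) = p v) :
    2 * num n (fun v => p v && v i == s) = num n p := by
  have h1 : num n (fun v => p v && v i == s) = num n (fun v => p v && v i == !s) := by
    refine Finset.sum_bij' (fun a _ => Function.update a ⟨i, hi⟩ (!(a ⟨i, hi⟩)))
      (fun a _ => Function.update a ⟨i, hi⟩ (!(a ⟨i, hi⟩))) (by simp) (by simp) (by simp) (by simp) ?_
    intro a _
    beta_reduce
    rw [ext_update, hp]
    simp only [ext, hi, dite_true, Function.update_self]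
    cases p (ext a) <;> cases a ⟨i, hi⟩ <;> cases s <;> rfl
  have h2 : num n p = num n (fun v => p v && v i == s) + num n (fun v => p v && v i == !s) := by
    unfold num
    rw [← Finset.sum_add_distrib]
    refine Finset.sum_congr rfl fun a _ => ?_
    beta_reduce
    cases p (ext a) <;> cases ext a i <;> cases s <;> rfl
  omega

theorem satB_update {c : List Lit} {i : ℕ} (h : ∀ l ∈ c, l.1 ≠ i) (v : ℕ → Bool) (b : Bool) :
    satB c (Function.update v i b) = satB c v := by
  induction c with
  | nil => rfl
  | cons l c ih =>
    have := ih fun l hl => h l (List.mem_cons_of_mem _ hl)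
    unfold satB at *
    rw [List.all_cons, List.all_cons, this, Function.update_of_ne (h l List.mem_cons_self)]

theorem cnfB_update {G : List (Lit × Lit)} {i : ℕ} (h : ∀ C ∈ G, C.1.1 ≠ i ∧ C.2.1 ≠ i)
    (v : ℕ → Bool) (b : Bool) : cnfB G (Function.update v i b) = cnfB G v := by
  induction G with
  | nil => rfl
  | cons C G ih =>
    have h1 := ih fun C hC => h C (List.mem_cons_of_mem _ hC)
    have h2 := h C List.mem_cons_self
    unfold cnfB clB at *
    rw [List.all_cons, List.all_cons, h1, Function.update_of_ne h2.1, Function.update_of_ne h2.2]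

theorem mem_iff {l : Lit} {c : List Lit} : mem l c = true ↔ l ∈ c := by simp [mem]

theorem consistent_iff {c : List Lit} : consistent c = true ↔ ∀ l ∈ c, neg l ∉ c := by
  rw [consistent, List.all_eq_true]
  refine forall₂_congr fun l _ => ?_
  rw [Bool.not_eq_true', Bool.eq_false_iff, Ne, mem_iff]

theorem lit_eq_or_neg {l k : Lit} (h : l.1 = k.1) : l = k ∨ l = neg k := by
  obtain ⟨i, s⟩ := l
  obtain ⟨j, t⟩ := k
  cases s <;> cases t <;> simp_all [neg]

theorem satB_eq_true {c : List Lit} {v : ℕ → Bool} : satB c v = true ↔ ∀ l ∈ c, v l.1 = l.2 := by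
  simp [satB]

theorem satB_append (c d : List Lit) (v : ℕ → Bool) : satB (c ++ d) v = (satB c v && satB d v) := by
  simp [satB]

theorem satB_cons (l : Lit) (c : List Lit) (v : ℕ → Bool) :
    satB (l :: c) v = (v l.1 == l.2 && satB c v) := rfl

/-- Distinct literals either include a complementary pair, and then nothing satisfies them, or have
distinct variables, and then each one halves the count. -/
theorem num_satB_mul_le {c : List Lit} (hc : c.Nodup) (hn : ∀ l ∈ c, l.1 < n) :
    num n (satB c) * 2 ^ c.length ≤ 2 ^ n := by
  induction c with
  | nil => exact (by simpa using num_true.le : num n (fun _ => true) * 2 ^ 0 ≤ 2 ^ n)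
  | cons l c ih =>
    have ih' := ih (List.nodup_cons.1 hc).2 fun l hl => hn l (List.mem_cons_of_mem _ hl)
    by_cases h : neg l ∈ c
    · have h0 : num n (satB (l :: c)) = 0 := by
        refine Finset.sum_eq_zero fun a _ => ?_
        rw [Bool.toNat_eq_zero, Bool.eq_false_iff]
        intro h1
        rw [satB_eq_true] at h1
        have h2 := h1 l List.mem_cons_self
        have h3 := h1 _ (List.mem_cons_of_mem _ h)
        simp [neg, h2] at h3
      rw [h0]; simp
    · have h1 := two_mul_num_and (n := n) (p := satB c) (hn l List.mem_cons_self) l.2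
        (satB_update fun k hk h' => by
          rcases lit_eq_or_neg h' with rfl | rfl
          · exact (List.nodup_cons.1 hc).1 hk
          · exact h hk)
      rw [← h1] at ih'
      have h2 : num n (satB (l :: c)) = num n (fun v => satB c v && v l.1 == l.2) :=
        num_congr fun v => by rw [satB_cons, Bool.and_comm]
      rw [h2, List.length_cons, pow_succ]
      linarith

theorem bval_cnt {c : List Lit} (hn : ∀ l ∈ c, l.1 < n) : bval (cnt n c) = num n (satB c) := by
  rw [num_eq_card]
  by_cases hc : consistent c = true
  · have hcons := consistent_iff.1 hc
    rw [cnt, if_pos hc, bval_bpow]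
    -- A cube is a product over the coordinates: by consistency a mentioned variable has exactly one
    -- allowed value, any other variable has two.
    have h1 : (Finset.univ.filter fun a : Fin n → Bool => satB c (ext a) = true) =
        Fintype.piFinset fun i : Fin n => Finset.univ.filter fun b => ∀ l ∈ c, l.1 = i → b = l.2 := by
      ext a
      simp only [Finset.mem_filter, Finset.mem_univ, true_and, satB_eq_true, Fintype.mem_piFinset]
      constructor
      · intro h i l hl hi
        have := h l hl
        simpa [ext, hi] using this
      · intro h l hl
        have := h ⟨l.1, hn l hl⟩ l hl rfl
        simpa [ext, hn l hl] using this
    rw [h1, Fintype.card_piFinset]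
    have h2 : ∀ i : Fin n, (Finset.univ.filter fun b => ∀ l ∈ c, l.1 = i → b = l.2).card =
        if (!c.any fun l => decide (l.1 = i)) = true then 2 else 1 := by
      intro i
      have key : (!c.any fun l => decide (l.1 = i)) = true ↔ ¬ ∃ l ∈ c, decide (l.1 = i.1) = true := by
        rw [Bool.not_eq_true', Bool.eq_false_iff, Ne, List.any_eq_true]
      split_ifs with h <;> rw [key] at h
      · have h' : ∀ l ∈ c, l.1 ≠ i := fun l hl hi => h ⟨l, hl, by simpa using hi⟩
        rw [Finset.filter_true_of_mem fun b _ l hl hi => absurd hi (h' l hl)]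
        simp
      · obtain ⟨l, hl, hi⟩ := not_not.1 h
        replace hi : l.1 = i := by simpa using hi
        rw [Finset.card_eq_one]
        refine ⟨l.2, ?_⟩
        ext b
        simp only [Finset.mem_filter, Finset.mem_univ, true_and, Finset.mem_singleton]
        refine ⟨fun h => h l hl hi, ?_⟩
        rintro rfl k hk hki
        rcases lit_eq_or_neg (hki.trans hi.symm) with rfl | rfl
        · rfl
        · exact absurd hk (hcons l hl)
    rw [Finset.prod_congr rfl fun i _ => h2 i,
      Fin.prod_univ_eq_prod_range (fun i => if (!c.any fun l => decide (l.1 = i)) = true then 2 else 1)]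
    change _ = ((List.range n).map _).prod
    induction List.range n with
    | nil => rfl
    | cons i t ih =>
      rw [List.map_cons, List.prod_cons, ← ih, List.filter_cons]
      split_ifs <;> simp [pow_succ, mul_comm]
  · rw [cnt, if_neg hc, bval, eq_comm, Finset.card_eq_zero, Finset.filter_eq_empty_iff]
    intro a _ h
    rw [satB_eq_true] at h
    refine hc (consistent_iff.2 fun l hl hl' => ?_)
    have h1 := h _ hl'
    simp [neg, h l hl] at h1

/-! ### Disjoint clauses -/

/-- The variables of a clause. -/
def cvars (C : Lit × Lit) : List ℕ := [C.1.1, C.2.1]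

/-- The clause is not a tautology. -/
def nontaut (C : Lit × Lit) : Bool := !decide (C.2 = neg C.1)

/-- A clause on two variables that `p` ignores is violated by exactly a quarter of the assignments
in `p`. If both variables coincide, non-tautology makes the clause a single literal, and even half
of them violate it. -/
theorem four_mul_num_le {C : Lit × Lit} (hC : nontaut C = true) (hn : ∀ i ∈ cvars C, i < n)
    (hp : ∀ i ∈ cvars C, ∀ v b, p (Function.update v i b) = p v) :
    4 * num n (fun v => clB C v && p v) ≤ 3 * num n p := by
  obtain ⟨⟨i, s⟩, ⟨j, t⟩⟩ := C
  have hi := hn i (by simp [cvars])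
  have hj := hn j (by simp [cvars])
  have hpi := hp i (by simp [cvars])
  have hpj := hp j (by simp [cvars])
  by_cases hij : i = j
  · subst hij
    have hst : s = t := by cases s <;> cases t <;> simp_all [nontaut, neg]
    subst hst
    have h1 := two_mul_num_and hi s hpi
    have h2 : num n (fun v => clB ((i, s), (i, s)) v && p v) = num n (fun v => p v && v i == s) :=
      num_congr fun v => by simp [clB, Bool.and_comm]
    omega
  · have h1 := two_mul_num_and hi (!s) hpi
    have h2 := two_mul_num_and (p := fun v => p v && v i == !s) hj (!t) fun v b => by
      rw [hpj, Function.update_of_ne hij]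
    have h3 : num n p = num n (fun v => clB ((i, s), (j, t)) v && p v) +
        num n (fun v => (p v && v i == !s) && v j == !t) := by
      unfold num
      rw [← Finset.sum_add_distrib]
      refine Finset.sum_congr rfl fun a _ => ?_
      simp only [clB]
      cases p (ext a) <;> cases ext a i <;> cases ext a j <;> cases s <;> cases t <;> rfl
    omega

theorem four_pow_mul_num_le {G : List (Lit × Lit)} (hG : ∀ C ∈ G, nontaut C = true)
    (hn : ∀ C ∈ G, ∀ i ∈ cvars C, i < n)
    (hd : G.Pairwise fun C D => List.Disjoint (cvars C) (cvars D)) :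
    4 ^ G.length * num n (cnfB G) ≤ 3 ^ G.length * 2 ^ n := by
  induction G with
  | nil => exact (by simpa using num_true.le : 4 ^ 0 * num n (fun _ => true) ≤ 3 ^ 0 * 2 ^ n)
  | cons C G ih =>
    have h1 := ih (fun D hD => hG D (List.mem_cons_of_mem _ hD))
      (fun D hD => hn D (List.mem_cons_of_mem _ hD)) (List.pairwise_cons.1 hd).2
    have h2 := four_mul_num_le (n := n) (p := cnfB G) (hG C List.mem_cons_self)
      (hn C List.mem_cons_self) fun i hi => cnfB_update fun D hD => by
        have := (List.pairwise_cons.1 hd).1 D hD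
        constructor <;> rintro rfl <;> exact this hi (by simp [cvars])
    have h3 : num n (cnfB (C :: G)) = num n (fun v => clB C v && cnfB G v) := rfl
    rw [h3, List.length_cons, pow_succ, pow_succ]
    nlinarith [Nat.mul_le_mul_left (4 ^ G.length) h2]

/-- Since `27 * 2 ≤ 64`, more than `3 * r` disjoint clauses would push the fraction of satisfying
assignments down to `2 ^ (-r)` or less. -/
theorem length_le_of_num {G : List (Lit × Lit)} {r : ℕ} (hG : ∀ C ∈ G, nontaut C = true)
    (hn : ∀ C ∈ G, ∀ i ∈ cvars C, i < n)
    (hd : G.Pairwise fun C D => List.Disjoint (cvars C) (cvars D))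
    (h : 2 ^ n < 2 ^ r * num n (cnfB G)) : G.length ≤ 3 * r := by
  by_contra! hlt
  obtain ⟨k, hk⟩ := Nat.exists_eq_add_of_lt hlt
  have h1 := four_pow_mul_num_le hG hn hd
  have h2 : 3 ^ G.length * 2 ^ r ≤ 4 ^ G.length := by
    rw [hk, add_assoc, pow_add, pow_add 4, pow_mul, pow_mul]
    have h3 : (3 : ℕ) ^ (k + 1) ≤ 4 ^ (k + 1) := Nat.pow_le_pow_left (by norm_num) _
    have h4 : ((3 : ℕ) ^ 3) ^ r * 2 ^ r ≤ (4 ^ 3) ^ r := by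
      rw [← mul_pow]; exact Nat.pow_le_pow_left (by norm_num) _
    calc (3 ^ 3) ^ r * 3 ^ (k + 1) * 2 ^ r = ((3 ^ 3) ^ r * 2 ^ r) * 3 ^ (k + 1) := by ring
      _ ≤ _ := Nat.mul_le_mul h4 h3
  have h5 : 0 < 3 ^ G.length := by positivity
  have h6 : 3 ^ G.length * 2 ^ n < 3 ^ G.length * (2 ^ r * num n (cnfB G)) :=
    Nat.mul_lt_mul_of_pos_left h h5
  have h7 := Nat.mul_le_mul_right (num n (cnfB G)) h2
  rw [← mul_assoc] at h6
  omega

end Num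

end MajMaj

namespace MajMaj

/-! ### Branching processes -/

section Fold

variable {σ κ : Type} {step : σ → κ → List σ} {M : ℕ}

/-- The untruncated version of `tfold`. -/
def ufold (step : σ → κ → List σ) (G : List κ) (init : List σ) : List σ :=
  G.foldl (fun s C => s.flatMap fun c => step c C) init

theorem ufold_eq_flatMap (G : List κ) : ∀ init : List σ,
    ufold step G init = init.flatMap fun s => ufold step G [s] := by
  induction G with
  | nil => intro init; simp [ufold]
  | cons C G ih =>
    intro init
    change ufold step G (init.flatMap fun c => step c C) = init.flatMap fun s =>
      ufold step G ([s].flatMap fun c => step c C)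
    rw [ih, List.flatMap_assoc]
    refine congrArg₂ _ (funext fun s => ?_) rfl
    rw [← ih]; simp

theorem ufold_cons (C : κ) (G : List κ) (s : σ) :
    ufold step (C :: G) [s] = (step s C).flatMap fun s' => ufold step G [s'] := by
  rw [← ufold_eq_flatMap]
  simp [ufold]

/-- Truncation only loses states, so any sum of non-negative weights over the truncated list is an
underestimate. This one-sidedness keeps NO answers correct without any assumption on the number of
states. -/
theorem tfold_sublist (G : List κ) : ∀ {init init' : List σ}, init.Sublist init' →
    (tfold M step G init).Sublist (ufold step G init') := by
  induction G with
  | nil => exact fun h => h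
  | cons C G ih => exact fun h => ih ((List.take_sublist _ _).trans (h.flatMap _))

theorem length_tfold_le (G : List κ) : ∀ init : List σ, init.length ≤ M →
    (tfold M step G init).length ≤ M := by
  induction G with
  | nil => exact fun _ h => h
  | cons C G ih => exact fun init _ => ih _ (by simp)

/-- The list is cut after every element of `G`, so the bound has to hold for all prefixes. -/
theorem tfold_eq_ufold {init : List σ} (G : List κ)
    (h : ∀ G' : List κ, G' <+: G → (ufold step G' init).length ≤ M) :
    tfold M step G init = ufold step G init := by
  induction G using List.reverseRecOn with
  | nil => rfl
  | append_singleton G C ih =>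
    have h1 := ih fun G' hG' => h G' (hG'.trans (List.prefix_append _ _))
    have h2 := h _ List.prefix_rfl
    unfold tfold ufold at *
    rw [List.foldl_append] at h2
    rw [List.foldl_append, List.foldl_append, h1]
    exact List.take_of_length_le h2

end Fold

theorem sum_map_flatMap {α β : Type} (L : List α) (f : α → List β) (w : β → ℕ) :
    ((L.flatMap f).map w).sum = (L.map fun a => ((f a).map w).sum).sum := by
  induction L with
  | nil => rfl
  | cons a L ih => simp [ih]

/-! ### Disjoint normal forms -/

/-- Summing indicator functions expresses at once that the new cubes are disjoint and that they
cover exactly the part of `c` where `C` holds. -/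
theorem sum_dnfStep (c : List Lit) (C : Lit × Lit) (v : ℕ → Bool) :
    ((dnfStep c C).map fun c' => (satB c' v).toNat).sum = (satB c v && clB C v).toNat := by
  cases hs : satB c v with
  | false =>
    unfold dnfStep
    cases mem C.1 c || mem C.2 c <;> cases mem (neg C.1) c <;> cases mem (neg C.2) c <;>
      simp [satB_cons, hs]
  | true =>
    have key : ∀ l, mem l c = true → v l.1 = l.2 := fun l hl =>
      satB_eq_true.1 hs l (mem_iff.1 hl)
    obtain ⟨⟨i, s⟩, ⟨j, t⟩⟩ := C
    unfold dnfStep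
    cases e1 : mem (i, s) c with
    | true => simp [hs, clB, key _ e1]
    | false =>
    cases e2 : mem (j, t) c with
    | true => simp [hs, clB, key _ e2]
    | false =>
    cases e3 : mem (neg (i, s)) c with
    | true =>
      have : v i = !s := key _ e3
      simp [hs, clB, satB_cons, this]
    | false =>
    cases e4 : mem (neg (j, t)) c with
    | true =>
      have : v j = !t := key _ e4
      simp [hs, clB, satB_cons, this]
    | false =>
      simp only [Bool.or_self, cond_false, List.map_cons, List.map_nil, List.sum_cons, List.sum_nil,
        hs, clB, satB_cons, neg]
      cases v i <;> cases v j <;> cases s <;> cases t <;> rfl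

theorem sum_ufold_dnfStep (G : List (Lit × Lit)) (v : ℕ → Bool) : ∀ c : List Lit,
    ((ufold dnfStep G [c]).map fun c' => (satB c' v).toNat).sum = (satB c v && cnfB G v).toNat := by
  induction G with
  | nil => intro c; simp [ufold, cnfB]
  | cons C G ih =>
    intro c
    rw [ufold_cons, sum_map_flatMap, List.map_congr_left fun c' _ => ih c']
    have h := sum_dnfStep c C v
    have h2 : cnfB (C :: G) v = (clB C v && cnfB G v) := rfl
    rw [h2, ← Bool.and_assoc]
    cases cnfB G v <;> simp [h]

/-- Three-way branching happens only at a clause both of whose variables are new to `c`. So the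
branching clauses of a path are variable-disjoint from each other and from `c`, and `k` bounds how
many of them can still occur. -/
theorem length_ufold_dnfStep (G : List (Lit × Lit)) : ∀ (c : List Lit) (k : ℕ),
    (∀ L : List (Lit × Lit), L.Sublist G →
      L.Pairwise (fun C D => List.Disjoint (cvars C) (cvars D)) →
      (∀ C ∈ L, List.Disjoint (cvars C) (c.map Prod.fst)) → L.length ≤ k) →
    (ufold dnfStep G [c]).length ≤ 3 ^ k := by
  induction G with
  | nil => intro c k _; simpa [ufold] using Nat.one_le_pow k 3 (by norm_num)
  | cons C G ih =>
    intro c k h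
    rw [ufold_cons]
    -- Without branching the cube can only gain variables, so fewer families are admissible and the
    -- same `k` works.
    have hone : ∀ c', c.Sublist c' → (ufold dnfStep G [c']).length ≤ 3 ^ k := fun c' hc => by
      refine ih c' k fun L hL hd hc' => h L (hL.cons _) hd fun D hD i hi hi' => ?_
      exact hc' D hD hi ((hc.map _).subset hi')
    rw [dnfStep]
    cases e1 : mem C.1 c with
    | true => simpa using hone c (List.Sublist.refl c)
    | false =>
    cases e2 : mem C.2 c with
    | true => simpa using hone c (List.Sublist.refl c)
    | false =>
    cases e3 : mem (neg C.1) c with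
    | true => simpa using hone _ (List.sublist_cons_self C.2 c)
    | false =>
    cases e4 : mem (neg C.2) c with
    | true => simpa using hone _ (List.sublist_cons_self C.1 c)
    | false =>
    -- Neither literal of `C` nor its negation lies in `c`, so both variables are fresh.
    have hC : List.Disjoint (cvars C) (c.map Prod.fst) := by
      intro i hi hi'
      obtain ⟨l, hl, rfl⟩ := List.mem_map.1 hi'
      rw [Bool.eq_false_iff, Ne, mem_iff] at e1 e2 e3 e4
      simp only [cvars, List.mem_cons, List.not_mem_nil, or_false] at hi
      rcases hi with hi | hi <;> rcases lit_eq_or_neg hi with rfl | rfl <;> contradiction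
    have hk : 1 ≤ k := h [C] (by simp) (by simp) (by simpa using hC)
    obtain ⟨k, rfl⟩ := Nat.exists_eq_add_of_le' hk
    have hthree : ∀ l m : Lit, l.1 = C.1.1 → m.1 = C.2.1 →
        (ufold dnfStep G [l :: m :: c]).length ≤ 3 ^ k := fun l m hl hm => by
      refine ih _ k fun L hL hd hc' => ?_
      -- A family that avoids the enlarged cube can be extended by `C`; this lowers the bound from
      -- `k + 1` to `k` and pays for the factor `3`.
      have := h (C :: L) (hL.cons_cons C) (List.pairwise_cons.2 ⟨fun D hD i hi hi' => ?_, hd⟩) ?_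
      · simpa using this
      · refine hc' D hD hi' ?_
        simp only [cvars, List.mem_cons, List.not_mem_nil, or_false] at hi
        rcases hi with rfl | rfl <;> simp [hl, hm]
      · intro D hD i hi hi'
        rcases List.mem_cons.1 hD with rfl | hD
        · exact hC hi hi'
        · exact hc' D hD hi (by simp at hi' ⊢; tauto)
    have h1 := hthree C.1 C.2 rfl rfl
    have h2 := hthree C.1 (neg C.2) rfl rfl
    have h3 := hthree (neg C.1) C.2 rfl rfl
    simp [pow_succ]
    omega

/-- The truncated disjoint normal form. -/
theorem tfold_dnfStep_eq {n r M : ℕ} {G : List (Lit × Lit)} (hG : ∀ C ∈ G, nontaut C = true)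
    (hn : ∀ C ∈ G, ∀ i ∈ cvars C, i < n) (h : 2 ^ n < 2 ^ r * num n (cnfB G)) (hM : 27 ^ r ≤ M) :
    tfold M dnfStep G [[]] = ufold dnfStep G [[]] := by
  refine tfold_eq_ufold G fun G' hG' => ?_
  refine (length_ufold_dnfStep G' [] (3 * r) fun L hL hd _ => ?_).trans ?_
  · have hLG : L.Sublist G := hL.trans hG'.sublist
    refine length_le_of_num (n := n) (fun C hC => hG C (hLG.subset hC))
      (fun C hC => hn C (hLG.subset hC)) hd (h.trans_le (Nat.mul_le_mul_left _ (num_mono fun v hv => ?_)))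
    rw [cnfB, List.all_eq_true] at *
    exact fun C hC => hv C (hLG.subset hC)
  · rw [pow_mul]; exact hM

theorem sum_tfold_dnfStep_le (M : ℕ) (G : List (Lit × Lit)) (v : ℕ → Bool) :
    ((tfold M dnfStep G [[]]).map fun c => (satB c v).toNat).sum ≤ (cnfB G v).toNat := by
  have h := sum_ufold_dnfStep G v []
  rw [show satB [] v = true from rfl, Bool.true_and] at h
  rw [← h]
  exact ((tfold_sublist G (List.Sublist.refl _)).map _).sum_le_sum fun _ _ => Nat.zero_le _

/-! ### Clauses over both kinds of variables -/

/-- Process the mixed clauses under an assignment to `x`, and apply `f` to the list of literals over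
`y` that have to hold. The result is `0` if there are more than `r` of them. -/
def mixVal (v : ℕ → Bool) (r : ℕ) (f : List Lit → ℕ) : List (Lit × Lit) → List Lit → ℕ
  | [], U => f U
  | C :: G, U =>
    if mem C.2 U = true ∨ v C.1.1 = C.1.2 then mixVal v r f G U
    else if U.length < r then mixVal v r f G (C.2 :: U) else 0

/-- The branches differ in the value of the `x`-literal, so for a fixed `v` at most one of them
survives. The sum over states therefore collapses to the single deterministic path followed by
`mixVal`. -/
theorem sum_ufold_mixStep (v : ℕ → Bool) (r : ℕ) (f : List Lit → ℕ) (G : List (Lit × Lit)) :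
    ∀ s : List Lit × List Lit,
      ((ufold (mixStep r) G [s]).map fun s' => (satB s'.2 v).toNat * f s'.1).sum =
        (satB s.2 v).toNat * mixVal v r f G s.1 := by
  induction G with
  | nil => intro s; simp [ufold, mixVal]
  | cons C G ih =>
    intro s
    rw [ufold_cons, sum_map_flatMap, List.map_congr_left fun c' _ => ih c']
    rw [mixStep, mixVal]
    cases e1 : mem C.2 s.1 <;> by_cases e2 : s.1.length < r <;> by_cases e3 : v C.1.1 = C.1.2 <;>
      cases e4 : satB s.2 v <;> simp [e2, e3, e4, satB_cons, neg]
    simp [Bool.eq_not.2 e3]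

/-- A state is determined by the at most `r - s.1.length` clauses that force a literal. The
induction is `(m + 1) ^ (k + 1) + (m + 1) ^ k ≤ (m + 2) ^ (k + 1)`. -/
theorem length_ufold_mixStep (r : ℕ) (G : List (Lit × Lit)) : ∀ s : List Lit × List Lit,
    (ufold (mixStep r) G [s]).length ≤ (G.length + 1) ^ (r - s.1.length) := by
  induction G with
  | nil => intro s; simp [ufold]
  | cons C G ih =>
    intro s
    rw [ufold_cons]
    have h1 : ∀ d, (ufold (mixStep r) G [(s.1, d)]).length ≤ (G.length + 1) ^ (r - s.1.length) :=
      fun d => ih (s.1, d)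
    have h2 : (G.length + 1) ^ (r - s.1.length) ≤ (G.length + 1 + 1) ^ (r - s.1.length) :=
      Nat.pow_le_pow_left (by omega) _
    rw [mixStep]
    cases e1 : mem C.2 s.1 with
    | true => simpa using (h1 s.2).trans h2
    | false =>
      by_cases e2 : s.1.length < r
      · have h3 := ih (C.2 :: s.1, neg C.1 :: s.2)
        obtain ⟨k, hk⟩ := Nat.exists_eq_add_of_lt e2
        have h4 : r - s.1.length = k + 1 := by omega
        have h5 : r - (s.1.length + 1) = k := by omega
        have h6 := h1 (C.1 :: s.2)
        rw [h4] at h6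
        simp only [List.length_cons, h5] at h3
        have h7 : (G.length + 1) ^ k ≤ (G.length + 1 + 1) ^ k := Nat.pow_le_pow_left (by omega) _
        simp [e2, h4]
        rw [pow_succ] at *
        nlinarith
      · simpa [e2] using (h1 _).trans h2

theorem tfold_mixStep_eq {r M M' : ℕ} {G : List (Lit × Lit)} {init : List (List Lit × List Lit)}
    (hinit : ∀ s ∈ init, s.1 = []) (hM : init.length ≤ M) (hM' : (G.length + 1) ^ r ≤ M') :
    tfold (M * M') (mixStep r) G init = ufold (mixStep r) G init := by
  refine tfold_eq_ufold G fun G' hG' => ?_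
  rw [ufold_eq_flatMap, List.length_flatMap]
  refine (List.sum_le_card_nsmul _ M' ?_).trans ?_
  · intro k hk
    obtain ⟨s, hs, rfl⟩ := List.mem_map.1 hk
    refine (length_ufold_mixStep r G' s).trans (le_trans ?_ hM')
    rw [hinit s hs]
    exact Nat.pow_le_pow_left (Nat.add_le_add_right hG'.length_le 1) _
  · simpa using Nat.mul_le_mul_right M' hM

/-- All clauses hold, where the first literals are evaluated by `v` and the second ones by `u`. -/
def mixB (G : List (Lit × Lit)) (v u : ℕ → Bool) : Bool :=
  G.all fun C => v C.1.1 == C.1.2 || u C.2.1 == C.2.2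

/-- The threshold `s / t` exceeds `2 ^ (-r)` by `hst`, so giving up when more than `r` literals are
forced agrees with the true answer, which is then negative. -/
theorem mixVal_eq {n r s t : ℕ} (v : ℕ → Bool) (p : (ℕ → Bool) → Bool) (hst : t < s * 2 ^ r)
    (G : List (Lit × Lit)) : ∀ U : List Lit, U.Nodup → U.length ≤ r → (∀ l ∈ U, l.1 < n) →
      (∀ C ∈ G, C.2.1 < n) →
      mixVal v r (fun U => (decide (s * 2 ^ n ≤ t * num n fun u => p u && satB U u)).toNat) G U =
        (decide (s * 2 ^ n ≤ t * num n fun u => p u && (satB U u && mixB G v u))).toNat := by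
  induction G with
  | nil => intro U _ _ _ _; simp [mixVal, mixB]
  | cons C G ih =>
    intro U hU hr hn hG
    have hG' : ∀ C ∈ G, C.2.1 < n := fun D hD => hG D (List.mem_cons_of_mem _ hD)
    rw [mixVal]
    split_ifs with h1 h2
    · rw [ih U hU hr hn hG']
      congr 5
      funext u
      by_cases hu : satB U u = true
      · have : (v C.1.1 == C.1.2 || u C.2.1 == C.2.2) = true := by
          rcases h1 with h1 | h1
          · simp [satB_eq_true.1 hu _ (mem_iff.1 h1)]
          · simp [h1]
        simp [mixB, this]
      · simp [hu]
    · rw [not_or, mem_iff] at h1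
      rw [ih (C.2 :: U) (List.nodup_cons.2 ⟨h1.1, hU⟩) h2
        (by simpa [hG C List.mem_cons_self] using hn) hG']
      congr 5
      funext u
      have : (v C.1.1 == C.1.2) = false := by simpa using h1.2
      simp [mixB, this, satB_cons, Bool.and_assoc, Bool.and_left_comm]
    -- Here `U` is full and yet another new literal is forced: all literals of `C.2 :: U` must hold,
    -- which leaves at most `2 ^ (n - r)` assignments.
    · rw [not_or, mem_iff] at h1
      have h3 := num_satB_mul_le (n := n) (c := C.2 :: U) (List.nodup_cons.2 ⟨h1.1, hU⟩)
        (by simpa [hG C List.mem_cons_self] using hn)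
      have h4 : num n (fun u => p u && (satB U u && mixB (C :: G) v u)) ≤ num n (satB (C.2 :: U)) := by
        refine num_mono fun u hu => ?_
        have : (v C.1.1 == C.1.2) = false := by simpa using h1.2
        simp only [mixB, List.all_cons, this, Bool.false_or, Bool.and_eq_true] at hu
        simp [satB_cons, hu.2.1, hu.2.2.1]
      symm
      rw [Bool.toNat_eq_zero, decide_eq_false_iff_not, not_le]
      have h5 : 2 ^ r ≤ 2 ^ (C.2 :: U).length := Nat.pow_le_pow_right (by norm_num) (by simp; omega)
      have h6 := (Nat.mul_le_mul h4 h5).trans h3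
      have h7 : 0 < 2 ^ r := by positivity
      have h8 : 0 < 2 ^ n := by positivity
      refine lt_of_mul_lt_mul_right (a := 2 ^ r) ?_ (Nat.zero_le _)
      calc t * (num n fun u => p u && (satB U u && mixB (C :: G) v u)) * 2 ^ r
          = t * ((num n fun u => p u && (satB U u && mixB (C :: G) v u)) * 2 ^ r) := by ring
        _ ≤ t * 2 ^ n := Nat.mul_le_mul_left _ h6
        _ < s * 2 ^ r * 2 ^ n := Nat.mul_lt_mul_of_pos_right hst h8
        _ = _ := by ring

end MajMaj

/-! ### Correctness of the count. -/

namespace MajMaj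

theorem forall_ufold {σ κ : Type} {step : σ → κ → List σ} {P : σ → Prop} (G : List κ)
    (hstep : ∀ s, P s → ∀ C ∈ G, ∀ s' ∈ step s C, P s') : ∀ init : List σ, (∀ s ∈ init, P s) →
      ∀ s ∈ ufold step G init, P s := by
  induction G with
  | nil => exact fun _ h => h
  | cons C G ih =>
    intro init hi
    refine ih (fun s hs D hD => hstep s hs D (List.mem_cons_of_mem _ hD)) _ fun s hs => ?_
    obtain ⟨t, ht, hs⟩ := List.mem_flatMap.1 hs
    exact hstep t (hi t ht) C List.mem_cons_self s hs

theorem vars_ufold_dnfStep {n : ℕ} {G : List (Lit × Lit)} (hn : ∀ C ∈ G, ∀ i ∈ cvars C, i < n) :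
    ∀ c ∈ ufold dnfStep G [[]], ∀ l ∈ c, l.1 < n := by
  refine forall_ufold (P := fun c : List Lit => ∀ l ∈ c, l.1 < n) G (fun c hc C hC c' hc' => ?_) _ (by simp)
  have h1 : C.1.1 < n := hn C hC _ (by simp [cvars])
  have h2 : C.2.1 < n := hn C hC _ (by simp [cvars])
  have hadd : ∀ (l : Lit) (d : List Lit), l.1 < n → (∀ k ∈ d, k.1 < n) → ∀ k ∈ l :: d, k.1 < n :=
    fun l d hl hd k hk => by
      rcases List.mem_cons.1 hk with rfl | hk
      · exact hl
      · exact hd k hk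
  have h3 : (neg C.1).1 < n := h1
  have h4 : (neg C.2).1 < n := h2
  rw [dnfStep] at hc'
  cases e1 : (mem C.1 c || mem C.2 c) <;> cases e3 : mem (neg C.1) c <;>
    cases e4 : mem (neg C.2) c <;> simp only [e1, e3, e4, cond_true, cond_false, List.mem_cons,
      List.not_mem_nil, or_false] at hc' <;>
    first
    | (subst hc'; exact hc)
    | (subst hc'; exact hadd _ _ h1 hc)
    | (subst hc'; exact hadd _ _ h2 hc)
    | (rcases hc' with rfl | rfl | rfl
       · exact hadd _ _ h1 (hadd _ _ h2 hc)
       · exact hadd _ _ h1 (hadd _ _ h4 hc)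
       · exact hadd _ _ h3 (hadd _ _ h2 hc))

theorem vars_ufold_mixStep {n n' r : ℕ} {G : List (Lit × Lit)}
    (hn : ∀ C ∈ G, C.1.1 < n ∧ C.2.1 < n') {init : List (List Lit × List Lit)}
    (hi : ∀ s ∈ init, (∀ l ∈ s.1, l.1 < n') ∧ ∀ l ∈ s.2, l.1 < n) :
    ∀ s ∈ ufold (mixStep r) G init, (∀ l ∈ s.1, l.1 < n') ∧ ∀ l ∈ s.2, l.1 < n := by
  refine forall_ufold (P := fun s : List Lit × List Lit => (∀ l ∈ s.1, l.1 < n') ∧ ∀ l ∈ s.2, l.1 < n) G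
    (fun s hs C hC s' hs' => ?_) _ hi
  obtain ⟨h1, h2⟩ := hn C hC
  have h3 : (neg C.1).1 < n := h1
  rw [mixStep] at hs'
  cases e1 : mem C.2 s.1 <;> cases e2 : decide (s.1.length < r) <;> simp only [e1, e2, cond_true,
    cond_false, List.mem_cons, List.not_mem_nil, or_false] at hs' <;>
    first
    | (subst hs'; exact hs)
    | (subst hs'
       exact ⟨hs.1, List.forall_mem_cons.2 ⟨h1, hs.2⟩⟩)
    | (rcases hs' with rfl | rfl
       · exact ⟨hs.1, List.forall_mem_cons.2 ⟨h1, hs.2⟩⟩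
       · exact ⟨List.forall_mem_cons.2 ⟨h2, hs.1⟩, List.forall_mem_cons.2 ⟨h3, hs.2⟩⟩)

theorem bval_atLeast (q : List Bool × List Bool) (n : ℕ) (m : List Bool) :
    atLeast q n m = decide (bval q.1 * 2 ^ n ≤ bval q.2 * bval m) := by
  rw [atLeast, ble_eq, bval_bmul, bval_bmul, bval_bpow]

/-- The assignments for which all clauses of `YY` and all literals of `U` hold are counted correctly
by the truncated disjoint normal form, if there are sufficiently many of them. -/
theorem atLeast_tfold {n r M : ℕ} {q : List Bool × List Bool} {YY : List (Lit × Lit)}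
    (hq : bval q.2 < bval q.1 * 2 ^ r) (hY : ∀ C ∈ YY, nontaut C = true)
    (hn : ∀ C ∈ YY, ∀ i ∈ cvars C, i < n) (hM : 27 ^ r ≤ M) {U : List Lit} (hU : ∀ l ∈ U, l.1 < n) :
    atLeast q n (bsum ((tfold M dnfStep YY [[]]).map fun c => cnt n (c ++ U))) =
      decide (bval q.1 * 2 ^ n ≤ bval q.2 * num n fun u => cnfB YY u && satB U u) := by
  have hsub : (tfold M dnfStep YY [[]]).Sublist (ufold dnfStep YY [[]]) :=
    tfold_sublist YY (List.Sublist.refl _)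
  have hval : bval (bsum ((tfold M dnfStep YY [[]]).map fun c => cnt n (c ++ U))) =
      ∑ a : Fin n → Bool, ((tfold M dnfStep YY [[]]).map fun c => (satB c (ext a)).toNat).sum *
        (satB U (ext a)).toNat := by
    rw [bval_bsum, List.map_map]
    refine (congrArg List.sum (List.map_congr_left (g := fun c => num n (satB (c ++ U)))
      fun c hc => bval_cnt fun l hl => ?_)).trans ?_
    · rcases List.mem_append.1 hl with hl | hl
      · exact vars_ufold_dnfStep hn c (hsub.subset hc) l hl
      · exact hU l hl
    · rw [sum_map_num]
      refine Finset.sum_congr rfl fun a _ => ?_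
      rw [← List.sum_map_mul_right]
      congr 2
      funext c
      rw [satB_append]
      cases satB c (ext a) <;> simp
  rw [bval_atLeast, hval]
  -- If the clauses `YY` are satisfied often enough, the normal form is complete. Otherwise both the
  -- true and the computed number are at most `num n (cnfB YY)`, too small for the threshold, and
  -- both tests fail.
  by_cases h : 2 ^ n < 2 ^ r * num n (cnfB YY)
  · rw [tfold_dnfStep_eq hY hn h hM]
    congr 3
    refine Finset.sum_congr rfl fun a _ => ?_
    rw [sum_ufold_dnfStep, show satB [] (ext a) = true from rfl, Bool.true_and]
    beta_reduce
    cases cnfB YY (ext a) <;> simp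
  · have h1 : (∑ a : Fin n → Bool, ((tfold M dnfStep YY [[]]).map fun c => (satB c (ext a)).toNat).sum *
        (satB U (ext a)).toNat) ≤ num n (cnfB YY) := by
      refine Finset.sum_le_sum fun a _ => ?_
      refine (Nat.mul_le_mul (sum_tfold_dnfStep_le M YY _) (Bool.toNat_le _)).trans (by simp)
    have h2 : (num n fun u => cnfB YY u && satB U u) ≤ num n (cnfB YY) :=
      num_mono fun u hu => by simp at hu; exact hu.1
    have key : ∀ k, k ≤ num n (cnfB YY) → ¬ bval q.1 * 2 ^ n ≤ bval q.2 * k := by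
      intro k hk
      have h3 : 2 ^ r * k ≤ 2 ^ n := (Nat.mul_le_mul_left _ hk).trans (not_lt.1 h)
      rw [not_le]
      have h7 : 0 < 2 ^ r := by positivity
      have h8 : 0 < 2 ^ n := by positivity
      refine lt_of_mul_lt_mul_right (a := 2 ^ r) ?_ (Nat.zero_le _)
      calc bval q.2 * k * 2 ^ r = bval q.2 * (2 ^ r * k) := by ring
        _ ≤ bval q.2 * 2 ^ n := Nat.mul_le_mul_left _ h3
        _ < bval q.1 * 2 ^ r * 2 ^ n := Nat.mul_lt_mul_of_pos_right hq h8
        _ = _ := by ring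
    rw [decide_eq_false (key _ h1), decide_eq_false (key _ h2)]

/-- The assignment `v` to `x` is good. -/
def goodB (n' : ℕ) (XX XY YY : List (Lit × Lit)) (s t : ℕ) (v : ℕ → Bool) : Bool :=
  cnfB XX v && decide (s * 2 ^ n' ≤ t * num n' fun u => cnfB YY u && mixB XY v u)

section Count

variable {n n' r M M' : ℕ} {q : List Bool × List Bool} {XX XY YY : List (Lit × Lit)}

/-- Without truncation, the total weight of the states compatible with a given `v` is the indicator
of `v` being good: disjointness of the `x`-cubes handles `XX`, and `mixVal_eq` handles the rest. -/
theorem sum_ufold (hq : bval q.2 < bval q.1 * 2 ^ r) (hXY : ∀ C ∈ XY, C.1.1 < n ∧ C.2.1 < n')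
    (v : ℕ → Bool) :
    ((ufold (mixStep r) XY ((ufold dnfStep XX [[]]).map fun c => ([], c))).map fun s =>
      (satB s.2 v).toNat * (decide (bval q.1 * 2 ^ n' ≤ bval q.2 * num n' fun u =>
        cnfB YY u && satB s.1 u)).toNat).sum =
      (goodB n' XX XY YY (bval q.1) (bval q.2) v).toNat := by
  rw [ufold_eq_flatMap, sum_map_flatMap, List.map_congr_left fun s _ =>
    sum_ufold_mixStep v r (fun U => (decide (bval q.1 * 2 ^ n' ≤ bval q.2 * num n' fun u =>
        cnfB YY u && satB U u)).toNat) XY s, List.map_map]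
  have h1 := sum_ufold_dnfStep XX v []
  have h2 := mixVal_eq v (cnfB YY) hq XY [] List.nodup_nil (Nat.zero_le _) (by simp)
    fun C hC => (hXY C hC).2
  rw [show satB [] v = true from rfl, Bool.true_and] at h1
  change ((ufold dnfStep XX [[]]).map fun c => (satB c v).toNat * mixVal v r _ XY []).sum = _
  rw [List.sum_map_mul_right, h1, h2, goodB]
  simp only [show ∀ u, satB [] u = true from fun _ => rfl, Bool.true_and]
  cases cnfB XX v <;> simp

/-- Exchanges the sum over states with the sum over assignments. The tests on `y` are already exact
here, so only the truncation of the states remains to be compared. -/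
theorem bval_count (hq : bval q.2 < bval q.1 * 2 ^ r) (hX : ∀ C ∈ XX, ∀ i ∈ cvars C, i < n)
    (hXY : ∀ C ∈ XY, C.1.1 < n ∧ C.2.1 < n') (hY : ∀ C ∈ YY, nontaut C = true)
    (hn : ∀ C ∈ YY, ∀ i ∈ cvars C, i < n') (hM' : 27 ^ r ≤ M') :
    bval (count n n' XX XY YY M M' r q) = ∑ a : Fin n → Bool,
      ((tfold (M * M') (mixStep r) XY ((tfold M dnfStep XX [[]]).map fun c => ([], c))).map fun s =>
        (satB s.2 (ext a)).toNat * (decide (bval q.1 * 2 ^ n' ≤ bval q.2 * num n' fun u =>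
          cnfB YY u && satB s.1 u)).toNat).sum := by
  have hvars : ∀ s ∈ tfold (M * M') (mixStep r) XY ((tfold M dnfStep XX [[]]).map fun c => ([], c)),
      (∀ l ∈ s.1, l.1 < n') ∧ ∀ l ∈ s.2, l.1 < n := fun s hs => by
    refine vars_ufold_mixStep (r := r) hXY (init := (ufold dnfStep XX [[]]).map fun c => ([], c)) ?_ s
      ((tfold_sublist XY ((tfold_sublist XX (List.Sublist.refl _)).map _)).subset hs)
    intro s hs
    obtain ⟨c, hc, rfl⟩ := List.mem_map.1 hs
    exact ⟨by simp, vars_ufold_dnfStep hX c hc⟩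
  rw [count, bval_bsum, List.map_map]
  generalize tfold (M * M') (mixStep r) XY ((tfold M dnfStep XX [[]]).map fun c => ([], c)) = S at *
  induction S with
  | nil => simp
  | cons s S ih =>
    have h := hvars s List.mem_cons_self
    rw [List.map_cons, List.sum_cons, ih fun s hs => hvars s (List.mem_cons_of_mem _ hs)]
    simp only [List.map_cons, List.sum_cons, Finset.sum_add_distrib]
    congr 1
    rw [Function.comp_apply, atLeast_tfold hq hY hn hM' h.1, ← Finset.sum_mul]
    cases decide (bval q.1 * 2 ^ n' ≤ bval q.2 * num n' fun u => cnfB YY u && satB s.1 u)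
    · simp [bval]
    · simpa [num] using bval_cnt h.2

theorem bval_count_le (hq : bval q.2 < bval q.1 * 2 ^ r) (hX : ∀ C ∈ XX, ∀ i ∈ cvars C, i < n)
    (hXY : ∀ C ∈ XY, C.1.1 < n ∧ C.2.1 < n') (hY : ∀ C ∈ YY, nontaut C = true)
    (hn : ∀ C ∈ YY, ∀ i ∈ cvars C, i < n') (hM' : 27 ^ r ≤ M') :
    bval (count n n' XX XY YY M M' r q) ≤ num n (goodB n' XX XY YY (bval q.1) (bval q.2)) := by
  rw [bval_count hq hX hXY hY hn hM']
  refine Finset.sum_le_sum fun a _ => ?_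
  rw [← sum_ufold hq hXY]
  refine List.Sublist.sum_le_sum ?_ fun _ _ => Nat.zero_le _
  exact (tfold_sublist XY ((tfold_sublist XX (List.Sublist.refl _)).map _)).map _

/-- If the clauses `XX` have more than `2 ^ (n - k)` satisfying assignments, neither truncation
takes effect, and the underestimate becomes an equality. -/
theorem bval_count_eq {k : ℕ} (hq : bval q.2 < bval q.1 * 2 ^ r) (hX : ∀ C ∈ XX, ∀ i ∈ cvars C, i < n)
    (hXY : ∀ C ∈ XY, C.1.1 < n ∧ C.2.1 < n') (hY : ∀ C ∈ YY, nontaut C = true)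
    (hn : ∀ C ∈ YY, ∀ i ∈ cvars C, i < n') (hM' : 27 ^ r ≤ M') (hX' : ∀ C ∈ XX, nontaut C = true)
    (h : 2 ^ n < 2 ^ k * num n (cnfB XX)) (hM : 27 ^ k ≤ M) (hM₂ : (XY.length + 1) ^ r ≤ M') :
    bval (count n n' XX XY YY M M' r q) = num n (goodB n' XX XY YY (bval q.1) (bval q.2)) := by
  rw [bval_count hq hX hXY hY hn hM']
  refine Finset.sum_congr rfl fun a _ => ?_
  rw [← sum_ufold hq hXY, tfold_mixStep_eq (by simp) ?_ hM₂, tfold_dnfStep_eq hX' hX h hM]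
  rw [List.length_map]
  exact length_tfold_le _ _ (le_trans (by simpa using Nat.one_le_pow k 27 (by norm_num)) hM)

end Count

end MajMaj

namespace MajMaj

/-! ### Formulas as lists -/

/-- A clause: a list of literals, each with the kind of its variable. -/
abbrev Clause : Type := List (Bool × Lit)

/-- The truth value of a list of clauses. -/
def clausesB (L : List Clause) (v u : ℕ → Bool) : Bool :=
  L.all fun C => C.any fun l => (bif l.1 then u l.2.1 else v l.2.1) == l.2.2

/-- The first literal and the last literal of a clause of width at most two. -/
def ends (C : Clause) : (Bool × Lit) × (Bool × Lit) :=
  (C.headD (false, 0, false), C.tail.headD (C.headD (false, 0, false)))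

/-- The clauses all of whose literals are of the given kind, without the tautologies. -/
def pure (k : Bool) (L : List Clause) : List (Lit × Lit) :=
  (((L.map ends).filter fun C => decide (C.1.1 = k) && decide (C.2.1 = k)).map fun C =>
    (C.1.2, C.2.2)).filter fun C => nontaut C

/-- The clauses with literals of both kinds. -/
def mixed (L : List Clause) : List (Lit × Lit) :=
  ((L.map ends).filter fun C => !decide (C.1.1 = C.2.1)).map fun C =>
    bif C.1.1 then (C.2.2, C.1.2) else (C.1.2, C.2.2)

theorem clB_of_nontaut_eq_false {C : Lit × Lit} (h : nontaut C = false) (v : ℕ → Bool) :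
    clB C v = true := by
  have : C.2 = neg C.1 := by simpa [nontaut] using h
  unfold clB
  rw [this, neg]
  cases v C.1.1 <;> cases C.1.2 <;> rfl

theorem cnfB_pure_cons (k : Bool) (C : Clause) (L : List Clause) (v : ℕ → Bool) :
    cnfB (pure k (C :: L)) v = ((bif decide ((ends C).1.1 = k) && decide ((ends C).2.1 = k) then
      clB ((ends C).1.2, (ends C).2.2) v else true) && cnfB (pure k L) v) := by
  unfold pure
  rw [List.map_cons, List.filter_cons]
  cases decide ((ends C).1.1 = k) && decide ((ends C).2.1 = k) with
  | false => simp
  | true =>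
    rw [if_pos rfl, List.map_cons, List.filter_cons]
    cases hn : nontaut ((ends C).1.2, (ends C).2.2) with
    | false => simp [clB_of_nontaut_eq_false hn]
    | true => simp [cnfB]

theorem mixB_mixed_cons (C : Clause) (L : List Clause) (v u : ℕ → Bool) :
    mixB (mixed (C :: L)) v u = ((bif !decide ((ends C).1.1 = (ends C).2.1) then
      bif (ends C).1.1 then v (ends C).2.2.1 == (ends C).2.2.2 || u (ends C).1.2.1 == (ends C).1.2.2
      else v (ends C).1.2.1 == (ends C).1.2.2 || u (ends C).2.2.1 == (ends C).2.2.2 else true) && mixB (mixed L) v u) := by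
  unfold mixed
  rw [List.map_cons, List.filter_cons]
  cases !decide ((ends C).1.1 = (ends C).2.1) with
  | false => simp
  | true =>
    rw [if_pos rfl, List.map_cons]
    cases (ends C).1.1 <;> simp [mixB]

/-- A unit clause is treated as its literal repeated, and tautologies are harmless to drop. Empty
clauses must be excluded, since `ends` would replace them by a default literal. -/
theorem clausesB_eq {L : List Clause} (h0 : ∀ C ∈ L, C ≠ []) (h2 : ∀ C ∈ L, C.length ≤ 2)
    (v u : ℕ → Bool) :
    clausesB L v u = (cnfB (pure false L) v && (cnfB (pure true L) u && mixB (mixed L) v u)) := by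
  induction L with
  | nil => rfl
  | cons C L ih =>
    have ih' := ih (fun C hC => h0 C (List.mem_cons_of_mem _ hC))
      fun C hC => h2 C (List.mem_cons_of_mem _ hC)
    have hC : C.any (fun l => (bif l.1 then u l.2.1 else v l.2.1) == l.2.2) =
        (((bif (ends C).1.1 then u (ends C).1.2.1 else v (ends C).1.2.1) == (ends C).1.2.2) ||
        ((bif (ends C).2.1 then u (ends C).2.2.1 else v (ends C).2.2.1) == (ends C).2.2.2)) := by
      have hC0 := h0 C List.mem_cons_self
      have hC2 := h2 C List.mem_cons_self
      rcases C with _ | ⟨l, _ | ⟨l', _ | ⟨l'', C⟩⟩⟩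
      · exact absurd rfl hC0
      · simp [ends]
      · simp [ends]
      · simp at hC2
    have hs : clausesB (C :: L) v u =
      (C.any (fun l => (bif l.1 then u l.2.1 else v l.2.1) == l.2.2) && clausesB L v u) := rfl
    rw [hs, hC, ih']
    rw [cnfB_pure_cons, cnfB_pure_cons, mixB_mixed_cons]
    unfold clB
    generalize cnfB (pure false L) v = p
    generalize cnfB (pure true L) u = q
    generalize mixB (mixed L) v u = r
    cases p <;> cases q <;> cases r <;> cases (ends C).1.1 <;> cases (ends C).2.1 <;> simp [Bool.or_comm]

theorem nontaut_of_mem_pure {k : Bool} {L : List Clause} : ∀ C ∈ pure k L, nontaut C = true :=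
  fun _ hC => (List.mem_filter.1 hC).2

theorem ends_mem {C : Clause} (h : C ≠ []) : (ends C).1 ∈ C ∧ (ends C).2 ∈ C := by
  rcases C with _ | ⟨l, _ | ⟨l', C⟩⟩
  · exact absurd rfl h
  · simp [ends]
  · simp [ends]

theorem vars_pure {L : List Clause} {k : Bool} {n : ℕ} (h0 : ∀ C ∈ L, C ≠ [])
    (h : ∀ C ∈ L, ∀ l ∈ C, l.1 = k → l.2.1 < n) : ∀ C ∈ pure k L, ∀ i ∈ cvars C, i < n := by
  intro C hC i hi
  simp only [pure, List.mem_filter, List.mem_map, Bool.and_eq_true, decide_eq_true_eq] at hC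
  obtain ⟨⟨E, ⟨⟨C, hC, rfl⟩, h1, h2⟩, rfl⟩, -⟩ := hC
  have hm := ends_mem (h0 C hC)
  have e1 := h C hC _ hm.1 h1
  have e2 := h C hC _ hm.2 h2
  simp only [cvars, List.mem_cons, List.not_mem_nil, or_false] at hi
  rcases hi with rfl | rfl <;> assumption

theorem vars_mixed {L : List Clause} {n n' : ℕ} (h0 : ∀ C ∈ L, C ≠ [])
    (h : ∀ C ∈ L, ∀ l ∈ C, l.2.1 < bif l.1 then n' else n) :
    ∀ C ∈ mixed L, C.1.1 < n ∧ C.2.1 < n' := by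
  intro C hC
  simp only [mixed, List.mem_filter, List.mem_map] at hC
  obtain ⟨E, ⟨⟨C, hC, rfl⟩, h1⟩, rfl⟩ := hC
  have hm := ends_mem (h0 C hC)
  have e1 := h C hC _ hm.1
  have e2 := h C hC _ hm.2
  revert h1 e1 e2
  cases (ends C).1.1 <;> cases (ends C).2.1 <;> simp <;> tauto

theorem length_mixed_le (L : List Clause) : (mixed L).length ≤ L.length := by
  unfold mixed
  rw [List.length_map]
  exact (List.length_filter_le _ _).trans (by simp)

/-- A literal, with the kind of its variable. -/
def Literal.flat {n n' : ℕ} (l : Literal (Fin n ⊕ Fin n')) : Bool × Lit :=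
  match l.var with
  | Sum.inl i => (false, i.val, l.sign)
  | Sum.inr j => (true, j.val, l.sign)

/-- The clauses of a formula, as lists. -/
def Formula.list (F : Formula) : List Clause := F.clauses.map fun C => C.map Literal.flat

theorem Formula.eval_eq (F : Formula) (a : Fin F.n → Bool) (b : Fin F.n' → Bool) :
    F.eval a b = clausesB F.list (ext a) (ext b) := by
  unfold Formula.eval clausesB Formula.list
  rw [List.all_map]
  congr 1
  funext C
  rw [Function.comp_apply, List.any_map]
  congr 1
  funext l
  obtain ⟨i | j, s⟩ := l
  · cases s <;> simp [Literal.eval, Literal.flat, ext]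
  · cases s <;> simp [Literal.eval, Literal.flat, ext]

theorem Formula.lt_of_mem_list (F : Formula) :
    ∀ C ∈ F.list, ∀ l ∈ C, l.2.1 < bif l.1 then F.n' else F.n := by
  intro C hC l hl
  obtain ⟨C, -, rfl⟩ := List.mem_map.1 hC
  obtain ⟨⟨i | j, s⟩, -, rfl⟩ := List.mem_map.1 hl
  · exact i.2
  · exact j.2

theorem prob_eq {n : ℕ} (p : (Fin n → Bool) → Bool) (q : (ℕ → Bool) → Bool)
    (h : ∀ a, p a = q (ext a)) : prob p = (num n q : ℚ) / 2 ^ n := by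
  rw [prob, num_eq_card]
  simp [h]

theorem le_prob_iff {n : ℕ} {p : (Fin n → Bool) → Bool} {q : (ℕ → Bool) → Bool}
    (h : ∀ a, p a = q (ext a)) {σ : ℚ} (hσ : 0 < σ) :
    σ ≤ prob p ↔ σ.num.natAbs * 2 ^ n ≤ σ.den * num n q := by
  have h1 : ((σ.num.natAbs : ℤ)) = σ.num := Int.natAbs_of_nonneg (Rat.num_nonneg.2 hσ.le)
  have h2 : (σ.num.natAbs : ℚ) = σ.num := by rw [← Int.cast_natCast, h1]
  have h3 : (0 : ℚ) < σ.den := by exact_mod_cast σ.den_pos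
  have h4 : (0 : ℚ) < 2 ^ n := by positivity
  rw [prob_eq p q h, le_div_iff₀ h4, ← Nat.cast_le (α := ℚ)]
  push_cast
  rw [h2]
  conv_lhs => rw [← Rat.num_div_den σ]
  rw [div_mul_eq_mul_div, div_le_iff₀ h3, mul_comm (num n q : ℚ)]

/-- The clauses over `x` alone do not depend on `b`: if one fails, the probability is `0`, which is
below `σ` because `σ` is positive. -/
theorem Formula.good_eq (F : Formula) (h0 : ∀ C ∈ F.list, C ≠ []) (h2 : F.IsKCNF 2) {σ : ℚ}
    (hσ : 0 < σ) (a : Fin F.n → Bool) :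
    F.good σ a = goodB F.n' (pure false F.list) (mixed F.list) (pure true F.list) σ.num.natAbs σ.den
      (ext a) := by
  have h2' : ∀ C ∈ F.list, C.length ≤ 2 := fun C hC => by
    obtain ⟨C, hC', rfl⟩ := List.mem_map.1 hC
    simpa using h2 C hC'
  rw [Formula.good, goodB, Bool.eq_iff_iff]
  rw [decide_eq_true_iff, le_prob_iff (fun b => F.eval_eq a b) hσ, Bool.and_eq_true,
    decide_eq_true_iff]
  cases hX : cnfB (pure false F.list) (ext a) with
  | true =>
    rw [num_congr (q := fun u => cnfB (pure true F.list) u && mixB (mixed F.list) (ext a) u)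
      fun u => by rw [clausesB_eq h0 h2', hX, Bool.true_and]]
    simp
  | false =>
    rw [num_congr (q := fun _ => false) fun u => by rw [clausesB_eq h0 h2', hX, Bool.false_and]]
    simpa [num] using hσ.ne'

/-- The number `r` is such that `2 ^ (-r)` is less than the quotient `q` of binary numbers. -/
def slack (q : List Bool × List Bool) : ℕ := q.2.length - q.1.length + 1

/-- The numerator and the denominator in binary. -/
def ratBits (q : ℚ) : List Bool × List Bool := (q.num.natAbs.bits, q.den.bits)

/-- A number with `j` binary digits is less than `2 ^ j` and, if positive, at least `2 ^ (j - 1)`;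
the summand `1` in `slack` makes up for the loss in the numerator. -/
theorem lt_slack {q : ℚ} (hq : 0 < q) :
    bval (ratBits q).2 < bval (ratBits q).1 * 2 ^ slack (ratBits q) := by
  have h0 : q.num.natAbs ≠ 0 := by simpa using hq.ne'
  rw [slack, ratBits, bval_bits, bval_bits, Nat.size_eq_bits_len, Nat.size_eq_bits_len]
  have h1 : q.den < 2 ^ q.den.size := Nat.lt_size_self _
  have h2 : 2 ^ (q.num.natAbs.size - 1) ≤ q.num.natAbs := by
    have := Nat.size_pos.2 (Nat.pos_of_ne_zero h0)
    exact Nat.lt_size.1 (by omega)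
  calc q.den < 2 ^ q.den.size := h1
    _ ≤ 2 ^ ((q.num.natAbs.size - 1) + (q.den.size - q.num.natAbs.size + 1)) :=
      Nat.pow_le_pow_right (by norm_num) (by omega)
    _ ≤ _ := by rw [pow_add]; exact Nat.mul_le_mul_right _ h2

/-- The answer, given the clauses, the bounds for the number of states, and the thresholds. -/
def solve (n n' : ℕ) (L : List Clause) (M M' : ℕ) (ρ σ : List Bool × List Bool) : List Bool :=
  bif L.any fun C => C.isEmpty then [false] else
  bif atLeast ρ n (count n n' (pure false L) (mixed L) (pure true L) M M' (slack σ) σ) then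
    true :: bstrip (count n n' (pure false L) (mixed L) (pure true L) M M' (slack σ) σ)
  else [false]

theorem Formula.aboveThreshold_iff (F : Formula) {ρ σ : ℚ} (hρ : 0 < ρ) :
    F.AboveThreshold ρ σ ↔ ρ.num.natAbs * 2 ^ F.n ≤ ρ.den * F.goodCount σ := by
  have h1 : ((ρ.num.natAbs : ℤ)) = ρ.num := Int.natAbs_of_nonneg (Rat.num_nonneg.2 hρ.le)
  have h2 : (ρ.num.natAbs : ℚ) = ρ.num := by rw [← Int.cast_natCast, h1]
  have h3 : (0 : ℚ) < ρ.den := by exact_mod_cast ρ.den_pos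
  have h4 : (0 : ℚ) < 2 ^ F.n := by positivity
  rw [Formula.AboveThreshold, prob, ← Formula.goodCount]
  rw [show ((Fintype.card (Fin F.n → Bool) : ℕ) : ℚ) = 2 ^ F.n by simp, le_div_iff₀ h4,
    ← Nat.cast_le (α := ℚ)]
  push_cast
  rw [h2]
  conv_lhs => rw [← Rat.num_div_den ρ]
  rw [div_mul_eq_mul_div, div_le_iff₀ h3, mul_comm (F.goodCount σ : ℚ)]

theorem Formula.solve_eq (F : Formula) {ρ σ : ℚ} {M M' : ℕ} (h2 : F.IsKCNF 2) (hρ : 0 < ρ) (hσ : 0 < σ)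
    (hM : 27 ^ slack (ratBits ρ) ≤ M) (hM' : (27 * (F.clauses.length + 1)) ^ slack (ratBits σ) ≤ M') :
    solve F.n F.n' F.list M M' (ratBits ρ) (ratBits σ) = encodeAnswer (F.answer ρ σ) := by
  have hρ0 : ρ.num.natAbs ≠ 0 := by simpa using hρ.ne'
  have above := F.aboveThreshold_iff (σ := σ) hρ
  rw [solve, Formula.answer]
  cases he : F.list.any fun C => C.isEmpty with
  | true =>
    -- An empty clause makes the formula false, so no assignment reaches the positive threshold `σ`.
    have h : F.goodCount σ = 0 := by
      rw [Formula.goodCount, Finset.card_eq_zero, Finset.filter_eq_empty_iff]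
      intro a _
      rw [Formula.good, decide_eq_true_iff, le_prob_iff (fun b => F.eval_eq a b) hσ]
      rw [num_congr (q := fun _ => false) fun u => ?_]
      · simpa [num] using hσ.ne'
      · obtain ⟨C, hC, hC0⟩ := List.any_eq_true.1 he
        rw [clausesB, List.all_eq_false]
        refine ⟨C, hC, ?_⟩
        rw [List.isEmpty_iff.1 hC0]
        simp
    rw [if_neg]
    · rfl
    · rw [above, h]
      simpa using hρ.ne'
  | false =>
    have h0 : ∀ C ∈ F.list, C ≠ [] := fun C hC hC0 => by
      rw [List.any_eq_false] at he
      exact he C hC (by simp [hC0])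
    have hgood := F.good_eq h0 h2 hσ
    have hcount : F.goodCount σ = num F.n
        (goodB F.n' (pure false F.list) (mixed F.list) (pure true F.list) σ.num.natAbs σ.den) := by
      rw [num_eq_card, Formula.goodCount]
      simp only [hgood]
    have hvars := F.lt_of_mem_list
    have hX : ∀ C ∈ pure false F.list, ∀ i ∈ cvars C, i < F.n :=
      vars_pure h0 fun C hC l hl h => by simpa [h] using hvars C hC l hl
    have hY : ∀ C ∈ pure true F.list, ∀ i ∈ cvars C, i < F.n' :=
      vars_pure h0 fun C hC l hl h => by simpa [h] using hvars C hC l hl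
    have hXY := vars_mixed h0 hvars
    have h27 : 27 ^ slack (ratBits σ) ≤ M' :=
      (Nat.pow_le_pow_left (by omega) _).trans hM'
    have hlen : ((mixed F.list).length + 1) ^ slack (ratBits σ) ≤ M' := by
      refine (Nat.pow_le_pow_left ?_ _).trans hM'
      have h := length_mixed_le F.list
      rw [show F.list.length = F.clauses.length by simp [Formula.list]] at h
      omega
    have hle := bval_count_le (M := M) (lt_slack hσ) hX hXY nontaut_of_mem_pure hY h27
    have heq := fun h => bval_count_eq (lt_slack hσ) hX hXY nontaut_of_mem_pure hY h27
      nontaut_of_mem_pure h hM hlen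
    rw [show bval (ratBits σ).1 = σ.num.natAbs from bval_bits _,
      show bval (ratBits σ).2 = σ.den from bval_bits _, ← hcount] at hle heq
    rw [bval_atLeast, bstrip_eq]
    rw [show bval (ratBits ρ).1 = ρ.num.natAbs from bval_bits _,
      show bval (ratBits ρ).2 = ρ.den from bval_bits _]
    -- Good assignments satisfy the `x`-clauses, so a YES instance has enough satisfying assignments
    -- for the count to be exact.
    have key : F.AboveThreshold ρ σ → 2 ^ F.n <
        2 ^ slack (ratBits ρ) * num F.n (cnfB (pure false F.list)) := by
      intro h
      rw [above] at h
      have h1 : F.goodCount σ ≤ num F.n (cnfB (pure false F.list)) := by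
        rw [hcount]
        exact num_mono fun v hv => (Bool.and_eq_true _ _ ▸ hv : _ ∧ _).1
      have h3 := lt_slack hρ
      rw [show bval (ratBits ρ).1 = ρ.num.natAbs from bval_bits _,
        show bval (ratBits ρ).2 = ρ.den from bval_bits _] at h3
      have h4 : 0 < F.goodCount σ := by
        rcases Nat.eq_zero_or_pos (F.goodCount σ) with h5 | h5
        · rw [h5] at h
          simp at h
          exact absurd h hρ.ne'
        · exact h5
      refine lt_of_lt_of_le ?_ (Nat.mul_le_mul_left _ h1)
      refine lt_of_mul_lt_mul_left (a := ρ.num.natAbs) ?_ (Nat.zero_le _)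
      calc ρ.num.natAbs * 2 ^ F.n ≤ ρ.den * F.goodCount σ := h
        _ < ρ.num.natAbs * 2 ^ slack (ratBits ρ) * F.goodCount σ := Nat.mul_lt_mul_of_pos_right h3 h4
        _ = _ := by ring
    by_cases h : F.AboveThreshold ρ σ
    · rw [heq (key h), if_pos h, decide_eq_true (above.1 h)]
      rfl
    -- On a NO instance the count may be too small, but never too large.
    · rw [if_neg h, decide_eq_false]
      · rfl
      · intro h'
        exact h (above.2 (h'.trans (Nat.mul_le_mul_left _ hle)))

namespace Poly

variable {α : Type} [Enc α]

@[fun_prop]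
theorem pure {k : Bool} {L : α → List Clause} (hL : Poly L) : Poly fun a => pure k (L a) := by
  unfold MajMaj.pure ends nontaut; fun_prop

@[fun_prop]
theorem mixed {L : α → List Clause} (hL : Poly L) : Poly fun a => mixed (L a) := by
  unfold MajMaj.mixed ends; fun_prop

@[fun_prop]
theorem slack {q : α → List Bool × List Bool} (hq : Poly q) : Poly fun a => slack (q a) := by
  unfold MajMaj.slack; fun_prop

@[fun_prop]
theorem solve {n n' M M' : α → ℕ} {L : α → List Clause} {ρ σ : α → List Bool × List Bool}
    (hn : Poly n) (hn' : Poly n') (hL : Poly L) (hM : Poly M) (hM' : Poly M') (hρ : Poly ρ)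
    (hσ : Poly σ) : Poly fun a => solve (n a) (n' a) (L a) (M a) (M' a) (ρ a) (σ a) := by
  unfold MajMaj.solve; fun_prop

end Poly

end MajMaj

namespace MajMaj

open Enc

/-! ### Parsing -/

/-- The number of a symbol. -/
def Sym.code : Sym → ℕ
  | .xvar => 0
  | .yvar => 1
  | .clause => 2
  | .tick => 3
  | .sep => 4
  | .bit false => 5
  | .bit true => 6
  | .lit false false => 7
  | .lit false true => 8
  | .lit true false => 9
  | .lit true true => 10

theorem Sym.code_injective : Function.Injective Sym.code := by
  unfold Function.Injective; decide

/-- The largest code is `10`, whose unary encoding has `2 * 10 + 1` symbols; one constant size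
serves all symbols. -/
instance : Enc Sym := ⟨fun s => enc s.code, fun _ => 21, by decide⟩

instance : EncInj Sym := ⟨fun _ _ h => Sym.code_injective (EncInj.inj h)⟩

@[simp] theorem size_sym (s : Sym) : size s = 21 := rfl

theorem size_word (w : List Sym) : size w = 22 * w.length + 1 := by
  induction w with
  | nil => rfl
  | cons s w ih => simp [ih]; omega

/-- The state of the parser: the numbers, the number of variables `x`, the number of variables `y`,
the clauses, the literals of the current clause, and the index of the current literal. -/
abbrev Parse : Type := List (List Bool) × ℕ × ℕ × List Clause × Clause × ℕ

/-- Read a symbol; the input is read from the right. -/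
def Parse.step (p : Parse) : Sym → Parse
  | .xvar => (p.1, p.2.1 + 1, p.2.2)
  | .yvar => (p.1, p.2.1, p.2.2.1 + 1, p.2.2.2)
  | .clause => (p.1, p.2.1, p.2.2.1, p.2.2.2.2.1 :: p.2.2.2.1, [], p.2.2.2.2.2)
  | .lit y s => (p.1, p.2.1, p.2.2.1, p.2.2.2.1, (y, p.2.2.2.2.2, s) :: p.2.2.2.2.1, 0)
  | .tick => (p.1, p.2.1, p.2.2.1, p.2.2.2.1, p.2.2.2.2.1, p.2.2.2.2.2 + 1)
  | .bit b => ((b :: p.1.headD []) :: p.1.tail, p.2)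
  | .sep => ([] :: p.1, p.2)

/-- Read the reversed input. -/
def parse (w : List Sym) : Parse := w.foldl Parse.step ([], 0, 0, [], [], 0)

theorem size_step (p : Parse) (s : Sym) : size (p.step s) ≤ size p + 20 := by
  obtain ⟨n, x, y, L, C, t⟩ := p
  cases s
  case bit b => cases n <;> simp [Parse.step] <;> omega
  all_goals simp [Parse.step]; try omega

theorem foldl_replicate_tick (k : ℕ) (p : List (List Bool)) (x y : ℕ) (L : List Clause) (C : Clause)
    (t : ℕ) : (List.replicate k Sym.tick).foldl Parse.step (p, x, y, L, C, t) =
      (p, x, y, L, C, t + k) := by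
  induction k generalizing t with
  | zero => rfl
  | succ k ih =>
    rw [List.replicate_succ, List.foldl_cons, Parse.step, ih]
    simp [add_comm, add_left_comm]

theorem foldl_replicate_xvar (k : ℕ) (p : List (List Bool)) (x : ℕ) (q : ℕ × List Clause × Clause × ℕ) :
    (List.replicate k Sym.xvar).foldl Parse.step (p, x, q) = (p, x + k, q) := by
  induction k generalizing x with
  | zero => rfl
  | succ k ih =>
    rw [List.replicate_succ, List.foldl_cons, Parse.step, ih]
    simp [add_comm, add_left_comm]

theorem foldl_replicate_yvar (k : ℕ) (p : List (List Bool)) (x y : ℕ) (q : List Clause × Clause × ℕ) :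
    (List.replicate k Sym.yvar).foldl Parse.step (p, x, y, q) = (p, x, y + k, q) := by
  induction k generalizing y with
  | zero => rfl
  | succ k ih =>
    rw [List.replicate_succ, List.foldl_cons, Parse.step, ih]
    simp [add_comm, add_left_comm]

/-- The word of a literal. -/
def litWord (l : Bool × Lit) : List Sym := Sym.lit l.1 l.2.2 :: List.replicate l.2.1 Sym.tick

/-- The word of a list of clauses. -/
def clausesWord (L : List Clause) : List Sym := L.flatMap fun C => Sym.clause :: C.flatMap litWord

/-- The word of a formula. -/
def formulaWord (x y : ℕ) (L : List Clause) : List Sym :=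
  List.replicate x Sym.xvar ++ List.replicate y Sym.yvar ++ clausesWord L

/-- Reading from the right, the ticks of an index arrive before their literal symbol, which consumes
the counter and resets it to `0`. Lists are then built by prepending, in the right order. -/
theorem foldl_clause (C : Clause) (p : List (List Bool)) (x y : ℕ) (L : List Clause) :
    (C.flatMap litWord).reverse.foldl Parse.step (p, x, y, L, [], 0) = (p, x, y, L, C, 0) := by
  induction C with
  | nil => rfl
  | cons l C ih =>
    rw [List.flatMap_cons, List.reverse_append, List.foldl_append, ih, litWord, List.reverse_cons,
      List.reverse_replicate, List.foldl_append, foldl_replicate_tick]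
    simp [Parse.step]

theorem foldl_clausesWord (L : List Clause) (p : List (List Bool)) (x y : ℕ) :
    (clausesWord L).reverse.foldl Parse.step (p, x, y, [], [], 0) = (p, x, y, L, [], 0) := by
  induction L with
  | nil => rfl
  | cons C L ih =>
    rw [clausesWord, List.flatMap_cons, List.reverse_append, List.foldl_append, ← clausesWord, ih,
      List.reverse_cons, List.foldl_append, foldl_clause]
    rfl

theorem parse_formulaWord (x y : ℕ) (L : List Clause) :
    parse (formulaWord x y L).reverse = ([], x, y, L, [], 0) := by
  rw [parse, formulaWord, List.reverse_append, List.reverse_append, List.foldl_append,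
    List.foldl_append, foldl_clausesWord, List.reverse_replicate, List.reverse_replicate,
    foldl_replicate_yvar, foldl_replicate_xvar]
  simp

theorem foldl_encodeBin (m : ℕ) (p : List (List Bool)) (q : ℕ × ℕ × List Clause × Clause × ℕ) :
    (encodeBin m).reverse.foldl Parse.step (p, q) = (m.bits :: p, q) := by
  have h : ∀ l : List Bool, (l.map Sym.bit).reverse.foldl Parse.step ([] :: p, q) = (l :: p, q) := by
    intro l
    induction l with
    | nil => rfl
    | cons b l ih =>
      rw [List.map_cons, List.reverse_cons, List.foldl_append, ih]
      rfl
  rw [encodeBin, List.reverse_append, List.foldl_append]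
  exact h _

theorem Formula.encode_eq (F : Formula) : F.encode = formulaWord F.n F.n' F.list := by
  unfold Formula.encode formulaWord clausesWord Formula.list
  rw [List.flatMap_map]
  congr 2
  funext C
  rw [List.flatMap_map]
  congr 2
  funext l
  obtain ⟨i | j, s⟩ := l <;> rfl

theorem parse_encode (F : Formula) : parse F.encode.reverse = ([], F.n, F.n', F.list, [], 0) := by
  rw [F.encode_eq, parse_formulaWord]

theorem parse_encodeInput (F : Formula) (ρ σ : ℚ) :
    parse (encodeInput F ρ σ).reverse =
      ([(ratBits ρ).1, (ratBits ρ).2, (ratBits σ).1, (ratBits σ).2], F.n, F.n', F.list, [], 0) := by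
  have h := parse_encode F
  unfold parse at h ⊢
  rw [encodeInput, List.reverse_append, List.foldl_append, h, encodeRat, encodeRat,
    List.reverse_append, List.reverse_append, List.reverse_append, List.foldl_append,
    List.foldl_append, List.foldl_append, foldl_encodeBin, foldl_encodeBin, foldl_encodeBin,
    foldl_encodeBin]
  rfl

/-- The word is the word of a formula in which all clauses have width at most two. -/
def valid (w : List Sym) : Bool :=
  decide (w.reverse = formulaWord (parse w).2.1 (parse w).2.2.1 (parse w).2.2.2.1) &&
    ((parse w).2.2.2.1.all fun C => decide (C.length < 3) && C.all fun l =>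
      decide (l.2.1 < bif l.1 then (parse w).2.2.1 else (parse w).2.1))

theorem exists_formula {n n' : ℕ} {L : List Clause} (h : ∀ C ∈ L, ∀ l ∈ C, l.2.1 < bif l.1 then n' else n) :
    ∃ F : Formula, F.n = n ∧ F.n' = n' ∧ F.list = L := by
  have hl : ∀ l : Bool × Lit, (l.2.1 < bif l.1 then n' else n) → ∃ k : Literal (Fin n ⊕ Fin n'),
      k.flat = l := by
    rintro ⟨_ | _, i, s⟩ hi
    · exact ⟨⟨Sum.inl ⟨i, hi⟩, s⟩, rfl⟩
    · exact ⟨⟨Sum.inr ⟨i, hi⟩, s⟩, rfl⟩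
  have hC : ∀ C : Clause, (∀ l ∈ C, l.2.1 < bif l.1 then n' else n) →
      ∃ K : List (Literal (Fin n ⊕ Fin n')), K.map Literal.flat = C := by
    intro C hC
    induction C with
    | nil => exact ⟨[], rfl⟩
    | cons l C ih =>
      obtain ⟨K, rfl⟩ := ih fun l hl => hC l (List.mem_cons_of_mem _ hl)
      obtain ⟨k, rfl⟩ := hl l (hC l List.mem_cons_self)
      exact ⟨k :: K, rfl⟩
  suffices hL : ∃ K : List (List (Literal (Fin n ⊕ Fin n'))), (K.map fun C => C.map Literal.flat) = L by
    obtain ⟨K, rfl⟩ := hL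
    exact ⟨⟨n, n', K⟩, rfl, rfl, rfl⟩
  induction L with
  | nil => exact ⟨[], rfl⟩
  | cons C L ih =>
    obtain ⟨K, rfl⟩ := ih fun C hC => h C (List.mem_cons_of_mem _ hC)
    obtain ⟨k, rfl⟩ := hC C (h C List.mem_cons_self)
    exact ⟨k :: K, rfl⟩

/-- The parser is total and accepts any word; malformed words are recognised because encoding the
parsed data again does not give them back. The range check then allows the indices to be read as
elements of `Fin`. -/
theorem valid_iff (w : List Sym) :
    valid w = true ↔ ∃ F : Formula, F.IsKCNF 2 ∧ F.encode.reverse = w := by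
  constructor
  · intro h
    simp only [valid, Bool.and_eq_true, decide_eq_true_eq, List.all_eq_true] at h
    obtain ⟨F, h1, h2, h3⟩ := exists_formula fun C hC => (h.2 C hC).2
    refine ⟨F, fun C hC => ?_, ?_⟩
    · have := (h.2 (C.map Literal.flat) (h3 ▸ List.mem_map_of_mem hC)).1
      rw [List.length_map] at this
      omega
    · rw [F.encode_eq, h1, h2, h3, ← h.1, List.reverse_reverse]
  · rintro ⟨F, h, rfl⟩
    rw [valid, parse_encode]
    simp only [Bool.and_eq_true, decide_eq_true_eq, List.all_eq_true, List.reverse_reverse]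
    refine ⟨F.encode_eq, fun C hC => ⟨?_, F.lt_of_mem_list C hC⟩⟩
    obtain ⟨C, hC', rfl⟩ := List.mem_map.1 hC
    have := h C hC'
    simp
    omega

/-- The decision procedure for the threshold `1 / 2`; the input is reversed. -/
def decideHalf (w : List Sym) : Bool :=
  valid w && (solve (parse w).2.1 (parse w).2.2.1 (parse w).2.2.2.1 (27 ^ 2)
    ((27 * ((parse w).2.2.2.1.length + 1)) * (27 * ((parse w).2.2.2.1.length + 1)))
    ([true], [false, true]) ([true], [false, true])).headD false

theorem ratBits_half : ratBits (1 / 2) = ([true], [false, true]) := by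
  have h1 : (1 / 2 : ℚ).num.natAbs = 1 := by norm_num
  have h2 : (1 / 2 : ℚ).den = 2 := by norm_num
  rw [ratBits, h1, h2]
  exact Prod.ext (bstrip_eq [true]).symm (bstrip_eq [false, true]).symm

/-- For the threshold `1 / 2` the slack is `2`, so the truncation bounds `27 ^ 2` and `(27 * (m +
1)) ^ 2` suffice, which are polynomial in the length of the input. -/
theorem decideHalf_iff (w : List Sym) : decideHalf w.reverse = true ↔ w ∈ MAJMAJkSAT 2 := by
  have key : ∀ F : Formula, F.IsKCNF 2 →
      (decideHalf F.encode.reverse = true ↔ F.AboveThreshold (1 / 2) (1 / 2)) := by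
    intro F hF
    have h := F.solve_eq (ρ := 1 / 2) (σ := 1 / 2) (M := 27 ^ 2)
      (M' := (27 * (F.list.length + 1)) * (27 * (F.list.length + 1))) hF (by norm_num)
      (by norm_num) (by rw [ratBits_half]; exact le_rfl)
      (by rw [ratBits_half, ← pow_two, show F.list.length = F.clauses.length by simp [Formula.list]]
          exact le_rfl)
    rw [ratBits_half] at h
    rw [decideHalf, parse_encode, h, (valid_iff _).2 ⟨F, hF, rfl⟩, Formula.answer]
    by_cases ha : F.AboveThreshold (1 / 2) (1 / 2)
    · rw [if_pos ha]; simpa [encodeAnswer] using ha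
    · rw [if_neg ha]; simpa [encodeAnswer] using ha
  constructor
  · intro h
    have hv : valid w.reverse = true := (Bool.and_eq_true _ _ ▸ h : _ ∧ _).1
    obtain ⟨F, hF, hw⟩ := (valid_iff _).1 hv
    refine ⟨F, hF, List.reverse_injective hw, ?_⟩
    rwa [← hw, key F hF] at h
  · rintro ⟨F, hF, rfl, h⟩
    exact (key F hF).2 h

/-- The thresholds of the input. -/
def rhoOf (w : List Sym) : List Bool × List Bool :=
  ((parse w).1.headD [], (parse w).1.tail.headD [])

/-- The second threshold of the input. -/
def sigmaOf (w : List Sym) : List Bool × List Bool :=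
  ((parse w).1.tail.tail.headD [], (parse w).1.tail.tail.tail.headD [])

/-- The bound for the number of cubes in the variables `x`. -/
def boundX (w : List Sym) : ℕ := 27 ^ slack (rhoOf w)

/-- The bound for the number of cubes in the variables `y`. -/
def boundY (w : List Sym) : ℕ := (27 * ((parse w).2.2.2.1.length + 1)) ^ slack (sigmaOf w)

/-- The answer for the reversed input. -/
def answerOf (w : List Sym) : List Bool :=
  solve (parse w).2.1 (parse w).2.2.1 (parse w).2.2.2.1 (boundX w) (boundY w) (rhoOf w) (sigmaOf w)

theorem answerOf_encodeInput {F : Formula} {ρ σ : ℚ} (hF : F.IsKCNF 2) (hρ : 0 < ρ) (hσ : 0 < σ) :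
    answerOf (encodeInput F ρ σ).reverse = encodeAnswer (F.answer ρ σ) := by
  rw [← F.solve_eq (M := 27 ^ slack (ratBits ρ))
    (M' := (27 * (F.clauses.length + 1)) ^ slack (ratBits σ)) hF hρ hσ le_rfl le_rfl]
  rw [answerOf, boundX, boundY, rhoOf, sigmaOf, parse_encodeInput]
  simp [Formula.list]

end MajMaj

/-! ### The decision procedures in polynomial time. -/

namespace MajMaj

open Enc

namespace Poly

variable {α β : Type} [Enc α] [Enc β]

/-- The alphabet is finite, so a case distinction is a chain of equality tests, and only fixed
symbols remain to be treated. -/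
theorem casesSym {s : α → Sym} {f : α → Sym → β} (hs : Poly s) (h : ∀ c, Poly fun a => f a c) :
    Poly fun a => f a (s a) := by
  have e : ∀ c, Poly fun a => decide (s a = c) := fun c => hs.beq (const c)
  have : Poly fun a =>
      bif decide (s a = .xvar) then f a .xvar else
      bif decide (s a = .yvar) then f a .yvar else
      bif decide (s a = .clause) then f a .clause else
      bif decide (s a = .tick) then f a .tick else
      bif decide (s a = .sep) then f a .sep else
      bif decide (s a = .bit false) then f a (.bit false) else
      bif decide (s a = .bit true) then f a (.bit true) else
      bif decide (s a = .lit false false) then f a (.lit false false) else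
      bif decide (s a = .lit false true) then f a (.lit false true) else
      bif decide (s a = .lit true false) then f a (.lit true false) else f a (.lit true true) :=
    cond (e _) (h _) <| cond (e _) (h _) <| cond (e _) (h _) <| cond (e _) (h _) <| cond (e _) (h _) <|
      cond (e _) (h _) <| cond (e _) (h _) <| cond (e _) (h _) <| cond (e _) (h _) <|
      cond (e _) (h _) (h _)
  convert this using 2 with a
  rcases s a with _ | _ | _ | ⟨_ | _, _ | _⟩ | _ | ⟨_ | _⟩ | _ <;> rfl

@[fun_prop]
theorem lit {y s : α → Bool} (hy : Poly y) (hs : Poly s) : Poly fun a => Sym.lit (y a) (s a) := by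
  have : Poly fun a => bif y a then (bif s a then Sym.lit true true else .lit true false) else
      (bif s a then Sym.lit false true else .lit false false) := by fun_prop
  convert this using 2 with a
  cases y a <;> cases s a <;> rfl

@[fun_prop]
theorem step {p : α → Parse} {s : α → Sym} (hp : Poly p) (hs : Poly s) :
    Poly fun a => (p a).step (s a) := by
  refine casesSym hs fun c => ?_
  cases c <;> simp only [Parse.step] <;> fun_prop

@[fun_prop]
theorem parse {w : α → List Sym} (hw : Poly w) : Poly fun a => parse (w a) := by
  have h : ∀ (l : List Sym) (p : Parse), Enc.size (l.foldl Parse.step p) ≤ Enc.size p + Enc.size l := by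
    intro l
    induction l with
    | nil => intro p; simp
    | cons s l ih =>
      intro p
      have h1 := ih (p.step s)
      have h2 := size_step p s
      rw [List.foldl_cons, size_cons, size_sym]
      omega
  unfold MajMaj.parse
  refine foldl_of_bound (g := fun _ => Parse.step)
    (B := fun a => Enc.size (([], 0, 0, [], [], 0) : Parse) + Enc.size (w a)) hw (by fun_prop) (by fun_prop)
    (by fun_prop) fun a k => (h _ _).trans (Nat.add_le_add_left ?_ _)
  rw [size_word, size_word, List.length_take]
  omega

@[fun_prop]
theorem valid {w : α → List Sym} (hw : Poly w) : Poly fun a => valid (w a) := by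
  unfold MajMaj.valid formulaWord clausesWord litWord; fun_prop

@[fun_prop]
theorem decideHalf {w : α → List Sym} (hw : Poly w) : Poly fun a => decideHalf (w a) := by
  unfold MajMaj.decideHalf; fun_prop

/-- A power in unary is not polynomial in general; it is as soon as its value is bounded by a
polynomial in the declared size. The base being positive, all intermediate powers stay below the
final one. -/
theorem pow_of_bound {b n : α → ℕ} (hb : Poly b) (hn : Poly n) (h : PB fun a => b a ^ n a)
    (h1 : ∀ a, 1 ≤ b a) : Poly fun a => b a ^ n a := by
  have h2 : ∀ b k : ℕ, (fun t => b * t)^[k] 1 = b ^ k := fun b k => by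
    induction k with
    | zero => rfl
    | succ k ih => rw [Function.iterate_succ_apply', ih, pow_succ']
  have := iterate_of_bound (s := fun _ => 1) (g := fun a t => b a * t) (B := fun a => 2 * b a ^ n a + 1)
    hn (by fun_prop) (by fun_prop) (by fun_prop) fun a k hk => by
      rw [h2, size_nat]
      have := Nat.pow_le_pow_right (h1 a) hk
      omega
  simpa only [h2] using this

end Poly

/-- The reversed inputs, with a size that accounts for the bounds of the number of cubes. -/
structure Input where
  /-- the reversed input -/
  word : List Sym

instance : Enc Input :=
  ⟨fun I => enc I.word, fun I => size I.word + boundX I.word + boundY I.word, fun I =>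
    (word_le I.word).trans (by omega)⟩

theorem size_input (I : Input) : size I = size I.word + boundX I.word + boundY I.word := rfl

/-- The size of an `Input` includes both truncation bounds, so computing them is polynomial by
convention, and the closure properties do the rest. -/
theorem poly_answerOf : Poly fun I : Input => answerOf I.word := by
  have h : Poly Input.word :=
    Poly.of_enc (fun _ => rfl) (PB.size.mono fun I => by rw [size_input]; omega)
  have h1 : Poly fun I : Input => boundX I.word := by
    refine Poly.pow_of_bound (b := fun _ => 27) (by fun_prop) (by unfold rhoOf; fun_prop)
      (PB.size.mono fun I => ?_) fun _ => by norm_num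
    rw [size_input, boundX]
    omega
  have h2 : Poly fun I : Input => boundY I.word := by
    refine Poly.pow_of_bound (by fun_prop) (by unfold sigmaOf; fun_prop)
      (PB.size.mono fun I => ?_) fun _ => by omega
    rw [size_input, boundY]
    omega
  unfold answerOf rhoOf sigmaOf
  fun_prop

end MajMaj

/-! ### Reading the input, writing the output, and the resulting machine. -/

namespace MajMaj

open Enc Prog

namespace Pr

/-- Push the first `n` symbols of a word that depends on the register. -/
def pushWord (f : Reg → List Bool) : ℕ → Pr
  | 0 => .load id
  | n + 1 => .seq (pushWord f n) (.ite (fun v => decide (n < (f v).length))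
      (.push (.w .main) fun v => (f v).getD n false) (.load id))

/-- The length of the word depends on the register, but a fixed bound `n` on it allows a program
without loops: `n` conditional pushes. -/
theorem wruns_pushWord (f : Reg → List Bool) (n : ℕ) (v : Reg) (m : List Bool) :
    WRuns (pushWord f n) v (wk m [] [] []) v (wk (((f v).take n).reverse ++ m) [] [] []) (2 * n + 1) := by
  induction n with
  | zero => exact (wruns_load id).congr rfl rfl rfl rfl
  | succ n ih =>
    by_cases h : n < (f v).length
    · refine (ih.seq (WRuns.ite_true (by simpa using h)
        ((wruns_push _ _).congr rfl rfl rfl ?_))).mono (by omega)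
      rw [wk_main, update_main, ← List.take_concat_get' _ _ h, List.reverse_append,
        List.getD_eq_getElem _ _ h]
      rfl
    · refine (ih.seq (WRuns.ite_false (by simpa using h)
        ((wruns_load id).congr rfl rfl rfl ?_))).mono (by omega)
      rw [List.take_of_length_le (by omega), List.take_of_length_le (by omega)]

/-- Pop a symbol of the input into the register. -/
def getInp : Pr := .pop .inp fun v x => { v with s := x }

/-- The loop of `read`. -/
def readLoop : Pr :=
  .loop (fun v => v.s.isSome) (.seq (pushWord (fun v => ((enc (v.s.getD .sep)).word).reverse) 21)
    (.seq (put .main true) getInp))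

/-- Move the input onto the stack `main`, in reverse order. -/
def read : Pr := .seq (put .main false) (.seq getInp readLoop)

theorem runs_getInp (v : Reg) (i : List Sym) (o : List Bool) (W : Work → List Bool) :
    getInp.Runs v (stk i o W) { v with s := i.head? } (stk i.tail o W) 1 := by
  have := runs_pop (v := v) (S := stk i o W) Stk.inp fun v x => { v with s := x }
  rwa [update_inp] at this

theorem runs_readLoop (l : List Sym) : ∀ (s : Sym) (t : List Sym) (o : List Bool),
    readLoop.Runs ⟨some s, none, none, false⟩ (stk l o (wk (enc t).word [] [] []))
      Reg.zero (stk [] o (wk (enc (l.reverse ++ s :: t)).word [] [] [])) (50 * l.length + 50) := by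
  -- `45 = (2 * 21 + 1) + 1 + 1`: the tree of the symbol, the root of the new list cell, and the
  -- next input symbol.
  have body : ∀ (l : List Sym) (s : Sym) (t : List Sym) (o : List Bool),
      (Prog.seq (pushWord (fun v => ((enc (v.s.getD .sep)).word).reverse) 21)
        (.seq (put .main true) getInp) : Pr).Runs ⟨some s, none, none, false⟩
        (stk l o (wk (enc t).word [] [] [])) ⟨l.head?, none, none, false⟩
        (stk l.tail o (wk (enc (s :: t)).word [] [] [])) 45 := by
    intro l s t o
    have h1 := wruns_pushWord (fun v => ((enc (v.s.getD .sep)).word).reverse) 21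
      ⟨some s, none, none, false⟩ (enc t).word l o
    have h2 : (enc s).word.length ≤ 21 := word_le s
    rw [List.take_of_length_le (by simpa using h2), List.reverse_reverse] at h1
    have h3 := wruns_push (v := ⟨some s, none, none, false⟩)
      (W := wk ((enc s).word ++ (enc t).word) [] [] []) .main (fun _ => true) l o
    rw [update_main] at h3
    exact h1.seq (h3.seq (runs_getInp _ _ _ _))
  induction l with
  | nil =>
    intro s t o
    exact (Runs.loop_true rfl (body [] s t o) (runs_loop_false rfl)).mono (by norm_num)
  | cons s' l ih =>
    intro s t o
    refine (Runs.loop_true rfl (body (s' :: l) s t o) (T' := 50 * l.length + 50) ?_).mono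
      (by simp; omega)
    rw [List.reverse_cons, List.append_assoc]
    exact ih s' (s :: t) o

theorem runs_read (i : List Sym) (o : List Bool) :
    read.Runs Reg.zero (stk i o (wk [] [] [] [])) Reg.zero (stk [] o (wk (enc i.reverse).word [] [] []))
      (50 * i.length + 3) := by
  have h1 : (put .main false).Runs Reg.zero (stk i o (wk [] [] [] [])) Reg.zero
    (stk i o (wk [false] [] [] [])) 1 := exec_put (m := []) false i o
  cases i with
  | nil =>
    exact (h1.seq ((runs_getInp _ _ _ _).seq (runs_loop_false rfl))).mono (by simp)
  | cons s l =>
    refine (h1.seq ((runs_getInp _ _ _ _).seq (T' := 50 * l.length + 50) ?_)).mono (by simp; omega)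
    rw [List.reverse_cons]
    exact runs_readLoop l s [] o

/-- The loop of `write`. -/
def writeLoop : Pr :=
  .loop (fun v => v.r.getD false) (.seq (get .main) (.seq (.ite (fun v => v.r.getD false)
    (.seq (get .main) (.seq (get .main) (.push .out fun _ => true))) (.push .out fun _ => false))
    (get .main)))

/-- Move the list of bits on the stack `main` onto the output, in reverse order. -/
def write : Pr := .seq (get .main) (.seq writeLoop reset)

/-- Invariant: the root of the remaining list is in the register, and `false` ends the loop. After
the root of a list element equal to `true`, its two `nil` subtrees have to be removed as well. -/
theorem runs_writeLoop (l : List Bool) : ∀ (i : List Sym) (o : List Bool),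
    writeLoop.Runs ⟨none, (enc l).word.head?, none, false⟩ (stk i o (wk (enc l).word.tail [] [] []))
      ⟨none, some false, none, false⟩ (stk i (l.reverse ++ o) (wk [] [] [] []))
      (10 * l.length + 1) := by
  have hget : ∀ (i : List Sym) (o m : List Bool) (x : Option Bool),
      (get .main).Runs ⟨none, x, none, false⟩ (stk i o (wk m [] [] [])) ⟨none, m.head?, none, false⟩
        (stk i o (wk m.tail [] [] [])) 1 := fun i o m x => by
    have := wruns_pop (v := ⟨none, x, none, false⟩) (W := wk m [] [] []) .main
      (fun v x => { v with r := x }) i o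
    rwa [update_main] at this
  have hpush : ∀ (b : Bool) (i : List Sym) (o : List Bool) (v : Reg) (W : Work → List Bool),
      (.push .out fun _ => b : Pr).Runs v (stk i o W) v (stk i (b :: o) W) 1 := fun b i o v W => by
    have := runs_push (v := v) (S := stk i o W) Stk.out fun _ => b
    simpa using this
  induction l with
  | nil => intro i o; exact runs_loop_false rfl
  | cons b l ih =>
    intro i o
    have body : (.seq (get .main) (.seq (.ite (fun v => v.r.getD false)
        (.seq (get .main) (.seq (get .main) (.push .out fun _ => true))) (.push .out fun _ => false))
        (get .main)) : Pr).Runs ⟨none, (enc (b :: l)).word.head?, none, false⟩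
          (stk i o (wk (enc (b :: l)).word.tail [] [] [])) ⟨none, (enc l).word.head?, none, false⟩
          (stk i (b :: o) (wk (enc l).word.tail [] [] [])) 6 := by
      cases b with
      | false =>
        exact ((hget i o (false :: (enc l).word) _).seq ((Runs.ite_false rfl (hpush _ _ _ _ _)).seq
          (hget i (false :: o) (enc l).word _))).mono (by norm_num)
      | true =>
        exact ((hget i o (true :: false :: false :: (enc l).word) _).seq
          ((Runs.ite_true rfl ((hget i o (false :: false :: (enc l).word) _).seq
          ((hget i o (false :: (enc l).word) _).seq (hpush _ _ _ _ _)))).seq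
          (hget i (true :: o) (enc l).word _))).mono (by norm_num)
    rw [List.reverse_cons, List.append_assoc]
    exact (Runs.loop_true rfl body (ih i (b :: o))).mono (by simp; omega)

theorem runs_write (l : List Bool) (i : List Sym) (o : List Bool) :
    write.Runs Reg.zero (stk i o (wk (enc l).word [] [] [])) Reg.zero
      (stk i (l.reverse ++ o) (wk [] [] [] [])) (10 * l.length + 3) := by
  have h1 := wruns_pop (v := Reg.zero) (W := wk (enc l).word [] [] []) .main
      (fun v x => { v with r := x }) i o
  rw [update_main] at h1
  exact (h1.seq ((runs_writeLoop l i o).seq (runs_load _))).mono (by omega)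

end Pr

/-- The Turing machine of a program. -/
def Prog.machine (p : Pr) : Turing.TM2ComputableAux Sym Bool where
  tm :=
    { K := Stk
      k₀ := .inp
      k₁ := .out
      Γ := Alph
      Λ := p.Lab
      main := p.start
      ΛFin := p.labFintype
      σ := Reg
      initialState := Reg.zero
      Γk₀Fin := inferInstanceAs (Fintype Sym)
      m := p.code id .halt }
  inputAlphabet := Equiv.refl Sym
  outputAlphabet := Equiv.refl Bool

theorem Prog.runsInTime_machine {p : Pr} {i : List Sym} {o : List Bool} {T : ℕ}
    (h : p.Runs Reg.zero (stk i [] (wk [] [] [] [])) Reg.zero (stk [] o (wk [] [] [] [])) T) :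
    RunsInTime p.machine i o T := by
  obtain ⟨t, ht, h⟩ := h p.Lab (p.code id .halt) id .halt fun _ => rfl
  refine ⟨⟨⟨t, ?_⟩, ht⟩⟩
  have h1 : Turing.initList p.machine.tm (i.map p.machine.inputAlphabet.invFun) =
      (⟨some p.start, Reg.zero, stk i [] (wk [] [] [] [])⟩ : Turing.TM2.Cfg Alph p.Lab Reg) := by
    unfold Turing.initList
    congr 1
    funext k
    rcases k with _ | _ | k
    · exact List.map_id i
    · rfl
    · cases k <;> rfl
  have h2 : Turing.haltList p.machine.tm (o.map p.machine.outputAlphabet.invFun) =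
      (⟨none, Reg.zero, stk [] o (wk [] [] [] [])⟩ : Turing.TM2.Cfg Alph p.Lab Reg) := by
    unfold Turing.haltList
    congr 1
    funext k
    rcases k with _ | _ | k
    · rfl
    · exact List.map_id o
    · cases k <;> rfl
  rw [h1, Option.map_some, h2]
  exact h

/-- A function that is computed in polynomial time is computed by a Turing machine, which is given
the input in reverse order. -/
theorem Poly.exists_machine {α : Type} [Enc α] {w : α → List Sym} (hw : ∀ a, enc a = enc (w a))
    (hs : ∀ a, (w a).length ≤ Enc.size a) {f : α → List Bool} (hf : Poly f) :
    ∃ (M : Turing.TM2ComputableAux Sym Bool) (c : ℕ), ∀ a,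
      RunsInTime M (w a).reverse (f a) ((Enc.size a + 2) ^ c) := by
  -- Writing reverses the list, so the program computes the reversed result.
  obtain ⟨h1, p, T, hT, hp⟩ := hf.reverse
  have h2 : PB fun a => 50 * Enc.size a + 3 + (T a + (10 * Enc.size (f a).reverse + 3)) := by fun_prop
  obtain ⟨c, hc⟩ := h2
  refine ⟨Prog.machine (.seq Pr.read (.seq p Pr.write)), c, fun a => Prog.runsInTime_machine ?_⟩
  have e1 := Pr.runs_read (w a).reverse []
  rw [List.reverse_reverse, ← hw a] at e1
  have e2 := hp a [] [] []
  rw [List.append_nil, List.append_nil] at e2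
  have e3 := Pr.runs_write (f a).reverse [] []
  rw [List.reverse_reverse, List.append_nil] at e3
  refine (e1.seq (e2.seq e3)).mono (le_trans ?_ (hc a))
  have e4 := length_lt_size (f a).reverse
  have e5 := hs a
  rw [List.length_reverse]
  dsimp only
  omega

end MajMaj

namespace MajMaj

open Enc

/-! ### The time bound -/

/-- The converse of `lt_slack`: `2 ^ slack` overshoots `1 / q` by a factor of at most `4`. As `q <
1`, the numerator is no longer than the denominator, and the subtraction in `slack` is exact. -/
theorem mul_two_pow_slack_le {q : ℚ} (hq : 0 < q) (hq1 : q < 1) :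
    q.num.natAbs * 2 ^ slack (ratBits q) ≤ 4 * q.den := by
  have h0 : (q.num.natAbs : ℤ) = q.num := Int.natAbs_of_nonneg (Rat.num_nonneg.2 hq.le)
  have h1 : q.num.natAbs < q.den := by
    have := Rat.num_lt_denom_iff.2 hq1
    omega
  have h2 := Nat.size_le_size h1.le
  have h3 : 0 < q.den.size := Nat.size_pos.2 q.den_pos
  have h4 : q.num.natAbs < 2 ^ q.num.natAbs.size := Nat.lt_size_self _
  have h5 : 2 ^ (q.den.size - 1) ≤ q.den := Nat.lt_size.1 (by omega)
  rw [show slack (ratBits q) = q.den.size - q.num.natAbs.size + 1 by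
    rw [← Nat.size_eq_bits_len, ← Nat.size_eq_bits_len]; rfl]
  calc q.num.natAbs * 2 ^ (q.den.size - q.num.natAbs.size + 1)
      ≤ 2 ^ q.num.natAbs.size * 2 ^ (q.den.size - q.num.natAbs.size + 1) :=
        Nat.mul_le_mul_right _ h4.le
    _ = 2 ^ (2 + (q.den.size - 1)) := by rw [← pow_add]; congr 1; omega
    _ = 4 * 2 ^ (q.den.size - 1) := by rw [pow_add]; norm_num
    _ ≤ _ := Nat.mul_le_mul_left _ h5

theorem two_pow_slack_le {q : ℚ} (hq : 0 < q) (hq1 : q < 1) :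
    (2 : ℝ) ^ slack (ratBits q) ≤ 4 * (1 / (q : ℝ)) := by
  have h := mul_two_pow_slack_le hq hq1
  have h0 : (q.num.natAbs : ℤ) = q.num := Int.natAbs_of_nonneg (Rat.num_nonneg.2 hq.le)
  have h1 : (q.num.natAbs : ℝ) = q.num := by rw [← Int.cast_natCast, h0]
  have h2 : (q : ℝ) = (q.num : ℝ) / q.den := Rat.cast_def q
  have h3 : (0 : ℝ) < q.den := by exact_mod_cast q.den_pos
  have h4 : (0 : ℝ) < q.num := by exact_mod_cast Rat.num_pos.2 hq
  have h5 : (q.num : ℝ) * 2 ^ slack (ratBits q) ≤ 4 * q.den := by rw [← h1]; exact_mod_cast h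
  rw [h2, one_div_div, ← mul_div_assoc, le_div_iff₀ h4]
  linarith

theorem slack_le {q : ℚ} (hq : 0 < q) (hq1 : q < 1) :
    (slack (ratBits q) : ℝ) ≤ 2 + Real.logb 2 (1 / (q : ℝ)) := by
  have h0 : (0 : ℝ) < q := by exact_mod_cast hq
  have h1 : (0 : ℝ) < 1 / (q : ℝ) := by positivity
  have h2 : (2 : ℝ) = Real.logb 2 4 := by
    rw [show (4 : ℝ) = 2 ^ (2 : ℝ) by norm_num, Real.logb_rpow (by norm_num) (by norm_num)]
  rw [show (2 : ℝ) + Real.logb 2 (1 / (q : ℝ)) = Real.logb 2 (4 * (1 / (q : ℝ))) by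
    rw [Real.logb_mul (by norm_num) h1.ne', ← h2]]
  rw [Real.le_logb_iff_rpow_le (by norm_num) (by positivity), Real.rpow_natCast]
  exact two_pow_slack_le hq hq1

theorem Literal.length_encode_le {n n' : ℕ} (l : Literal (Fin n ⊕ Fin n')) :
    l.encode.length ≤ n + n' := by
  obtain ⟨i | j, s⟩ := l
  · simp [Literal.encode]; omega
  · simp [Literal.encode]; omega

theorem length_flatMap_le {α β : Type} (l : List α) (f : α → List β) {B : ℕ}
    (h : ∀ a ∈ l, (f a).length ≤ B) : (l.flatMap f).length ≤ l.length * B := by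
  induction l with
  | nil => simp
  | cons a l ih =>
    have h1 := ih fun a ha => h a (List.mem_cons_of_mem _ ha)
    have h2 := h a List.mem_cons_self
    simp only [List.flatMap_cons, List.length_append, List.length_cons, add_mul]
    omega

theorem Formula.length_encode_le {F : Formula} (hF : F.IsKCNF 2) :
    F.encode.length ≤ 3 * F.size ^ 2 := by
  have h1 : (F.clauses.flatMap fun C => Sym.clause :: C.flatMap Literal.encode).length ≤
      F.clauses.length * (1 + 2 * (F.n + F.n')) := by
    refine length_flatMap_le _ _ fun C hC => ?_
    have h2 := length_flatMap_le C Literal.encode fun l _ => l.length_encode_le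
    have h3 := Nat.mul_le_mul_right (F.n + F.n') (hF C hC)
    rw [List.length_cons]
    omega
  unfold Formula.encode Formula.size
  rw [List.length_append, List.length_append, List.length_replicate, List.length_replicate]
  nlinarith

theorem length_encodeInput_le {F : Formula} (ρ σ : ℚ) (hF : F.IsKCNF 2) :
    (encodeInput F ρ σ).length ≤ bitLength ρ + bitLength σ + 4 + 3 * F.size ^ 2 := by
  have := F.length_encode_le hF
  simp only [encodeInput, encodeRat, encodeBin, bitLength, List.length_append, List.length_map,
    List.length_singleton]
  omega

theorem bitLength_pos (q : ℚ) : 1 ≤ bitLength q := by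
  have h : 0 < q.den.size := Nat.size_pos.2 q.den_pos
  rw [← Nat.size_eq_bits_len] at h
  unfold bitLength
  omega

theorem boundX_encodeInput (F : Formula) (ρ σ : ℚ) :
    boundX (encodeInput F ρ σ).reverse = 27 ^ slack (ratBits ρ) := by
  rw [boundX, rhoOf, parse_encodeInput]
  rfl

theorem boundY_encodeInput (F : Formula) (ρ σ : ℚ) :
    boundY (encodeInput F ρ σ).reverse = (27 * (F.clauses.length + 1)) ^ slack (ratBits σ) := by
  rw [boundY, sigmaOf, parse_encodeInput]
  simp [Formula.list]

theorem boundX_le (F : Formula) {ρ : ℚ} (σ : ℚ) (hρ : 0 < ρ) (hρ1 : ρ < 1) :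
    (boundX (encodeInput F ρ σ).reverse : ℝ) ≤ 1024 * (1 / (ρ : ℝ)) ^ 5 := by
  rw [boundX_encodeInput]
  push_cast
  calc (27 : ℝ) ^ slack (ratBits ρ) ≤ (2 ^ 5) ^ slack (ratBits ρ) :=
        pow_le_pow_left₀ (by norm_num) (by norm_num) _
    _ = (2 ^ slack (ratBits ρ)) ^ 5 := by rw [← pow_mul, ← pow_mul, mul_comm]
    _ ≤ (4 * (1 / (ρ : ℝ))) ^ 5 := pow_le_pow_left₀ (by positivity) (two_pow_slack_le hρ hρ1) _
    _ = _ := by rw [mul_pow]; norm_num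

theorem boundY_le (F : Formula) (ρ : ℚ) {σ : ℚ} (hσ : 0 < σ) (hσ1 : σ < 1) :
    (boundY (encodeInput F ρ σ).reverse : ℝ) ≤
      (F.size : ℝ) ^ (6 * (2 + Real.logb 2 (1 / (σ : ℝ)))) := by
  rw [boundY_encodeInput]
  have h1 : F.clauses.length + 1 ≤ F.size := by unfold Formula.size; omega
  have h2 : 2 ≤ F.size := by unfold Formula.size; omega
  -- The size is at least `2`, so the constant is absorbed by `27 ≤ 2 ^ 5`.
  have h3 : 27 * (F.clauses.length + 1) ≤ F.size ^ 6 := by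
    have h4 : 2 ^ 5 ≤ F.size ^ 5 := Nat.pow_le_pow_left h2 5
    calc 27 * (F.clauses.length + 1) ≤ F.size ^ 5 * F.size := Nat.mul_le_mul (by omega) h1
      _ = _ := by ring
  have h5 := Nat.pow_le_pow_left h3 (slack (ratBits σ))
  have h6 : (1 : ℝ) ≤ F.size := by exact_mod_cast (by omega : 1 ≤ F.size)
  calc (((27 * (F.clauses.length + 1)) ^ slack (ratBits σ) : ℕ) : ℝ)
      ≤ (((F.size ^ 6) ^ slack (ratBits σ) : ℕ) : ℝ) := by exact_mod_cast h5
    _ = (F.size : ℝ) ^ ((6 * slack (ratBits σ) : ℕ) : ℝ) := by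
      rw [Real.rpow_natCast, pow_mul]; push_cast; rfl
    _ ≤ _ := Real.rpow_le_rpow_of_exponent_le h6 (by
      push_cast
      exact mul_le_mul_of_nonneg_left (slack_le hσ hσ1) (by norm_num))

/-- The size is a sum of terms coming from the word, `boundX` and `boundY`. All factors are at least
`1`, so each term is at most a constant times the product of the three. -/
theorem size_input_le {F : Formula} {ρ σ : ℚ} (hF : F.IsKCNF 2) (hρ : 0 < ρ) (hρ1 : ρ < 1) (hσ : 0 < σ)
    (hσ1 : σ < 1) :
    ((size (⟨(encodeInput F ρ σ).reverse⟩ : Input) + 2 : ℕ) : ℝ) ≤ 600000 * (1 / (ρ : ℝ)) ^ 5 *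
      ((bitLength ρ + bitLength σ : ℕ) : ℝ) *
      (F.size : ℝ) ^ (14 * (1 + Real.logb 2 (1 / (σ : ℝ)))) := by
  have hl : (0 : ℝ) ≤ Real.logb 2 (1 / (σ : ℝ)) :=
    Real.logb_nonneg (by norm_num) (by
      rw [le_div_iff₀ (by exact_mod_cast hσ), one_mul]
      exact_mod_cast hσ1.le)
  have hR : (1 : ℝ) ≤ 1 / (ρ : ℝ) := by
    rw [le_div_iff₀ (by exact_mod_cast hρ), one_mul]
    exact_mod_cast hρ1.le
  have hs : (2 : ℝ) ≤ F.size := by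
    exact_mod_cast (by unfold Formula.size; omega : 2 ≤ F.size)
  have hL : (1 : ℝ) ≤ ((bitLength ρ + bitLength σ : ℕ) : ℝ) := by
    exact_mod_cast (by have := bitLength_pos ρ; omega : 1 ≤ bitLength ρ + bitLength σ)
  have hlen : ((encodeInput F ρ σ).length : ℝ) ≤
      ((bitLength ρ + bitLength σ : ℕ) : ℝ) + 4 + 3 * (F.size : ℝ) ^ 2 := by
    exact_mod_cast length_encodeInput_le ρ σ hF
  have hX := boundX_le F σ hρ hρ1
  have hY := boundY_le F ρ hσ hσ1
  rw [size_input, size_word, List.length_reverse]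
  push_cast at hX hY hlen hL ⊢
  set R := 1 / (ρ : ℝ)
  set lam := Real.logb 2 (1 / (σ : ℝ))
  set s := (F.size : ℝ)
  set B := (bitLength ρ : ℝ) + (bitLength σ : ℝ)
  have hs2 : (4 : ℝ) ≤ s ^ 2 := by nlinarith
  have hA : 22 * ((encodeInput F ρ σ).length : ℝ) + 1 + 2 ≤ 180 * B * s ^ 2 := by
    have : s ^ 2 ≤ B * s ^ 2 := le_mul_of_one_le_left (by positivity) hL
    have : B * 4 ≤ B * s ^ 2 := mul_le_mul_of_nonneg_left hs2 (by linarith)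
    nlinarith
  have hC1 : (1 : ℝ) ≤ s ^ (6 * (2 + lam)) := Real.one_le_rpow (by linarith) (by linarith)
  have hR5 : (1 : ℝ) ≤ R ^ 5 := one_le_pow₀ hR
  have hA1 : (1 : ℝ) ≤ 180 * B * s ^ 2 := by nlinarith
  set A := 180 * B * s ^ 2 with hAdef
  set C := s ^ (6 * (2 + lam)) with hCdef
  have h1 : A ≤ A * C * R ^ 5 := by
    rw [mul_assoc]
    exact le_mul_of_one_le_right (by linarith) (one_le_mul_of_one_le_of_one_le hC1 hR5)
  have h2 : C ≤ A * C * R ^ 5 := by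
    rw [mul_comm A C, mul_assoc]
    exact le_mul_of_one_le_right (by linarith) (one_le_mul_of_one_le_of_one_le hA1 hR5)
  have h3 : R ^ 5 ≤ A * C * R ^ 5 :=
    le_mul_of_one_le_left (by linarith) (one_le_mul_of_one_le_of_one_le hA1 hC1)
  -- The exponents add up to `2 + 6 * (2 + lam) = 14 + 6 * lam`.
  have h4 : s ^ 2 * C ≤ s ^ (14 * (1 + lam)) := by
    rw [hCdef, ← Real.rpow_natCast, ← Real.rpow_add (by linarith)]
    refine Real.rpow_le_rpow_of_exponent_le (by linarith) ?_
    push_cast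
    linarith
  have h5 : A * C * R ^ 5 ≤ 180 * B * R ^ 5 * s ^ (14 * (1 + lam)) := by
    rw [hAdef, show 180 * B * s ^ 2 * C * R ^ 5 = 180 * B * R ^ 5 * (s ^ 2 * C) by ring]
    exact mul_le_mul_of_nonneg_left h4 (by positivity)
  nlinarith

/-- The single constant `600000 ^ d + 14 * d` dominates the coefficient `600000 ^ d` and the
exponents `5 * d`, `d` and `14 * d`; all the bases are at least `1`. -/
theorem time_le {F : Formula} {ρ σ : ℚ} (hF : F.IsKCNF 2) (hρ : 0 < ρ) (hρ1 : ρ < 1) (hσ : 0 < σ)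
    (hσ1 : σ < 1) (d : ℕ) :
    (((size (⟨(encodeInput F ρ σ).reverse⟩ : Input) + 2) ^ d : ℕ) : ℝ) ≤
      ((600000 ^ d + 14 * d : ℕ) : ℝ) * (1 / (ρ : ℝ)) ^ (600000 ^ d + 14 * d) *
      ((bitLength ρ + bitLength σ : ℕ) : ℝ) ^ (600000 ^ d + 14 * d) *
      (F.size : ℝ) ^ (((600000 ^ d + 14 * d : ℕ) : ℝ) * (1 + Real.logb 2 (1 / (σ : ℝ)))) := by
  have hl : (0 : ℝ) ≤ Real.logb 2 (1 / (σ : ℝ)) :=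
    Real.logb_nonneg (by norm_num) (by
      rw [le_div_iff₀ (by exact_mod_cast hσ), one_mul]
      exact_mod_cast hσ1.le)
  have hR : (1 : ℝ) ≤ 1 / (ρ : ℝ) := by
    rw [le_div_iff₀ (by exact_mod_cast hρ), one_mul]
    exact_mod_cast hρ1.le
  have hs : (1 : ℝ) ≤ F.size := by
    exact_mod_cast (by unfold Formula.size; omega : 1 ≤ F.size)
  have hL : (1 : ℝ) ≤ ((bitLength ρ + bitLength σ : ℕ) : ℝ) := by
    exact_mod_cast (by have := bitLength_pos ρ; omega : 1 ≤ bitLength ρ + bitLength σ)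
  have h := pow_le_pow_left₀ (Nat.cast_nonneg _) (size_input_le hF hρ hρ1 hσ hσ1) d
  rw [mul_pow, mul_pow, mul_pow, ← pow_mul, ← Real.rpow_natCast (_ ^ (_ : ℝ)), ← Real.rpow_mul
    (by linarith), show 14 * (1 + Real.logb 2 (1 / (σ : ℝ))) * (d : ℝ) =
      14 * d * (1 + Real.logb 2 (1 / (σ : ℝ))) by ring] at h
  rw [Nat.cast_pow]
  refine h.trans ?_
  have e : 14 * d ≤ 600000 ^ d + 14 * d := Nat.le_add_left _ _
  gcongr
  · push_cast
    linarith [(Nat.cast_nonneg d : (0 : ℝ) ≤ d)]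
  · omega
  · omega
  · push_cast
    linarith [show (0 : ℝ) ≤ 600000 ^ d by positivity]

theorem majmaj_mem_PTIME : MAJMAJkSAT 2 ∈ PTIME Sym := by
  have hf : Poly fun w : List Sym => [decideHalf w] := by fun_prop
  obtain ⟨M, c, hM⟩ := hf.exists_machine (w := id) (fun _ => rfl) fun w => by
    rw [size_word, id]; omega
  refine ⟨fun w => decideHalf w.reverse, decideHalf_iff, ⟨⟨M, (22 * Polynomial.X + 3) ^ c, fun w =>
    Classical.choice ?_⟩⟩⟩
  have h := hM w.reverse
  rw [size_word, List.length_reverse, id, List.reverse_reverse,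
    show 22 * w.length + 1 + 2 = 22 * w.length + 3 from rfl] at h
  simpa [RunsInTime, Computability.encodeBool] using h

theorem exists_threshold_machine :
    ∃ (M : Turing.TM2ComputableAux Sym Bool) (c : ℕ), ∀ (F : Formula) (ρ σ : ℚ),
      F.IsKCNF 2 → 0 < ρ → ρ < 1 → 0 < σ → σ < 1 → ∃ t : ℕ,
        RunsInTime M (encodeInput F ρ σ) (encodeAnswer (F.answer ρ σ)) t ∧
        (t : ℝ) ≤ (c : ℝ) * (1 / (ρ : ℝ)) ^ c * ((bitLength ρ + bitLength σ : ℕ) : ℝ) ^ c *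
          (F.size : ℝ) ^ ((c : ℝ) * (1 + Real.logb 2 (1 / (σ : ℝ)))) := by
  obtain ⟨M, d, hM⟩ := poly_answerOf.exists_machine (w := Input.word) (fun _ => rfl) fun I => by
    rw [size_input, size_word]; omega
  refine ⟨M, 600000 ^ d + 14 * d, fun F ρ σ hF hρ hρ1 hσ hσ1 => ⟨_, ?_, time_le hF hρ hρ1 hσ hσ1 d⟩⟩
  have h := hM ⟨(encodeInput F ρ σ).reverse⟩
  rwa [List.reverse_reverse, answerOf_encodeInput hF hρ hσ] at h

end MajMaj

theorem theorem3 :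
    MajMaj.MAJMAJkSAT 2 ∈ MajMaj.PTIME MajMaj.Sym ∧
    ∃ (M : Turing.TM2ComputableAux MajMaj.Sym Bool) (c : ℕ),
      ∀ (F : MajMaj.Formula) (ρ σ : ℚ),
        F.IsKCNF 2 → 0 < ρ → ρ < 1 → 0 < σ → σ < 1 →
          ∃ t : ℕ,
            MajMaj.RunsInTime M (MajMaj.encodeInput F ρ σ)
              (MajMaj.encodeAnswer (F.answer ρ σ)) t ∧
            (t : ℝ) ≤ (c : ℝ) * (1 / (ρ : ℝ)) ^ c *
              ((MajMaj.bitLength ρ + MajMaj.bitLength σ : ℕ) : ℝ) ^ c *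
              (F.size : ℝ) ^ ((c : ℝ) * (1 + Real.logb 2 (1 / (σ : ℝ)))) :=
  ⟨MajMaj.majmaj_mem_PTIME, MajMaj.exists_threshold_machine⟩
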